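/- Let $K$ be a field, $R=K[[x,y]]$, and let $I\subset R$ be a monomial ideal of finite colength. Say that $I$ has measuring sequence $m(r,s)$ if $(r,s)$ is the smallest pair of positive integers such that every $K$-automorphism of $R$ fixing the ideals $(x,y^r)$ and $(x^s,y)$ fixes $I$. Assume that $I$ has measuring sequence $m(4,1)$ or $m(3,2)$. Let $G$ be the group of automorphisms of $R$ fixing $(x,y^2)$ and let $F(I)$ be the $G$-orbit of $I$. Put $$g(a,b):\ x\mapsto x+ay^2+by^3,\ y\mapsto y,\qquad h(a,b):\ x\mapsto x+ay^2,\ y\mapsto y+bx .$$ In the case $m(4,1)$ (respectively $m(3,2)$), embed $F(I)$ in projective space by the Plücker coordinates of the ideals $g(a,b)(I)$ (respectively $h(a,b)(I)$) with respect to monomials; these are scalar multiples of monomials in $a,b$. Let $\bar F(I)$ be the closure, let $H\subset\mathbb R^2$ be the convex hull of the exponent vectors $(m,n)$ of the nonzero coordinate functions $a^mb^n$, and let the standard fan $\Delta(I)$ be the fan of outer normal cones of $H$ (the fan of the normalization of $\bar F(I)$). A cone $\sigma$ of $\Delta(I)$ corresponds to the torus orbit of those points of $\bar F(I)$ whose nonzero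 coordinates are exactly the ones with exponent vector on the face of $H$ dual to $\sigma$; for a two-dimensional cone this is a single ideal. For $(m,n)\ne(0,0)$ let $I^+(m,n)$ (respectively $I^-(m,n)$) in the case $m(4,1)$, and $I_+(m,n)$ (respectively $I_-(m,n)$) in the case $m(3,2)$, be the ideal corresponding to the two-dimensional cone of $\Delta(I)$ just clockwise (respectively counterclockwise) to the ray through $(m,n)$. Limits as $t\to\infty$ are flat limits of ideals. 1. The closed lower left quadrant and the negative coordinate axes are cones of $\Delta(I)$. Over every algebraically closed field $L\supseteq K$ (with $I$ replaced by the ideal it generates in $L[[x,y]]$), the map $(a,b)\mapsto g(a,b)(I)$ (respectively $h(a,b)(I)$) is a bijection from $L^2$ onto $F(I)$; $F(I)$ is the union of the torus orbits corresponding to the cones of $\Delta(I)$ contained in the quadrant; and the part of $F(I)$ lying over the cones in the quadrant that contain the negative $x$-axis (respectively the negative $y$-axis) is the line $a=0$ (respectively $b=0$). 2. If $I$ has measuring sequence $m(4,1)$, then $$I^+(-1,0)=I^-(0,1)=\lim_{t\to\infty}g(0,t)(I),\qquad I^-(0,-1)=\lim_{t\to\infty}g(t,0)(I),$$ $$I^+(0,1)=\lim_{t\to\infty}g(t,0)\,I^-(0,1),$$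 and, if the characteristic of $K$ is not $2$, $$I^-(0,-1)=I^+(1,2),\qquad I^-(1,2)=\lim_{t\to\infty}h(0,t)\,I^+(1,2).$$ 3. If $I$ has measuring sequence $m(3,2)$, then $$I_+(-1,0)=I_-(0,1)=\lim_{t\to\infty}h(0,t)(I),\qquad I_-(0,-1)=I_+(1,0)=\lim_{t\to\infty}h(t,0)(I),$$ $$I_+(0,1)=\lim_{t\to\infty}h(t,0)\,I_-(0,1),\qquad I_-(1,0)=\lim_{t\to\infty}h(0,t)\,I_+(1,0).$$ -/

import Mathlib

namespace ToricHilb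

open MvPowerSeries

/-- The power series ring `A[[x, y]]`; `x` is `X 0` and `y` is `X 1`. -/
abbrev PS (A : Type*) [CommRing A] : Type _ := MvPowerSeries (Fin 2) A

section Ideals

variable {K : Type*} [Field K]

/-- The ideal `(x ^ a, y ^ b)`. -/
noncomputable def powIdeal (K : Type*) [Field K] (a b : ℕ) : Ideal (PS K) :=
  Ideal.span {(X 0 : PS K) ^ a, (X 1 : PS K) ^ b}

/-- The maximal ideal `(x, y)`. -/
noncomputable def maxIdeal (K : Type*) [Field K] : Ideal (PS K) := powIdeal K 1 1

/-- An ideal generated by monomials. -/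
def IsMonomialIdeal (I : Ideal (PS K)) : Prop :=
  ∃ S : Set (Fin 2 →₀ ℕ), I = Ideal.span ((fun e => monomial e (1 : K)) '' S)

/-- The colength `dim_K K[[x, y]] / I` (used for ideals of finite colength only). -/
noncomputable def colength (I : Ideal (PS K)) : ℕ := Module.finrank K (PS K ⧸ I)

/-- The automorphism `φ` of `K[[x, y]]` sends the ideal `I` onto itself. -/
def Fixes (φ : PS K ≃ₐ[K] PS K) (I : Ideal (PS K)) : Prop := I.map φ = I

/-- `I` has measuring sequence `m(a, b)`: the pair `(a, b)` is the smallest pair of positive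
integers such that every automorphism fixing `(x, y ^ a)` and `(x ^ b, y)` fixes `I`. -/
def HasMeasuringSequence (I : Ideal (PS K)) (a b : ℕ) : Prop :=
  IsLeast {q : ℕ × ℕ | 1 ≤ q.1 ∧ 1 ≤ q.2 ∧
    ∀ φ : PS K ≃ₐ[K] PS K,
      Fixes φ (powIdeal K 1 q.1) → Fixes φ (powIdeal K q.2 1) → Fixes φ I} (a, b)

/-- The orbit `F(I)` of `I` under the group `G` of automorphisms fixing `(x, y ^ 2)`. -/
def orbitF (I : Ideal (PS K)) : Set (Ideal (PS K)) :=
  {J | ∃ φ : PS K ≃ₐ[K] PS K, Fixes φ (powIdeal K 1 2) ∧ J = I.map φ}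

end Ideals

/-! ### The two families of automorphisms -/

/-- The substitution `g(a, b)`: `x ↦ x + a y ^ 2 + b y ^ 3`, `y ↦ y`. -/
noncomputable def gSubst {A : Type*} [CommRing A] (a b : A) : Fin 2 → PS A :=
  ![X 0 + C a * X 1 ^ 2 + C b * X 1 ^ 3, X 1]

/-- The substitution `h(a, b)`: `x ↦ x + a y ^ 2`, `y ↦ y + b x`. -/
noncomputable def hSubst {A : Type*} [CommRing A] (a b : A) : Fin 2 → PS A :=
  ![X 0 + C a * X 1 ^ 2, X 1 + C b * X 0]

/-- The two kinds of ideals considered: measuring sequence `m(4, 1)` or `m(3, 2)`. -/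
inductive Kind
  | m41
  | m32

/-- The measuring sequence belonging to a kind. -/
def Kind.HasKind {K : Type*} [Field K] (κ : Kind) (I : Ideal (PS K)) : Prop :=
  match κ with
  | .m41 => HasMeasuringSequence I 4 1
  | .m32 => HasMeasuringSequence I 3 2

/-- Coset representatives: `g(a, b)` for `m(4, 1)` and `h(a, b)` for `m(3, 2)`. -/
noncomputable def Kind.rep {A : Type*} [CommRing A] (κ : Kind) (a b : A) : Fin 2 → PS A :=
  match κ with
  | .m41 => gSubst a b
  | .m32 => hSubst a b

theorem hasSubst_gSubst {A : Type*} [CommRing A] (a b : A) : HasSubst (gSubst a b) := by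
  apply hasSubst_of_constantCoeff_zero
  intro s
  fin_cases s <;> simp [gSubst]

theorem hasSubst_hSubst {A : Type*} [CommRing A] (a b : A) : HasSubst (hSubst a b) := by
  apply hasSubst_of_constantCoeff_zero
  intro s
  fin_cases s <;> simp [hSubst]

section Families

variable {K : Type*} [Field K]

/-- The ideal of `A[[x, y]]` generated by the image of `I` under a substitution with
coefficients in the `K`-algebra `A`. For `A = K` and `s = g(a, b)` this is `g(a, b)(I)`. -/
noncomputable def moved {A : Type*} [CommRing A] [Algebra K A] (s : Fin 2 → PS A)
    (I : Ideal (PS K)) : Ideal (PS A) :=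
  Ideal.span ((fun f : PS K => subst s f) '' I)

/-- The flat limit as `t → ∞` of a family of ideals over `K[t]`: the ideal of the coefficients
of `t ^ n` of those members of the family that have degree at most `n` in `t`. (Putting
`u = 1 / t`, these are the values at `u = 0` of the members of the family over `K[t, 1 / t]`
that are regular at `u = 0`.) -/
noncomputable def flatLimit (𝓘 : Ideal (PS (Polynomial K))) : Ideal (PS K) where
  carrier := {f | ∃ n : ℕ, ∃ F ∈ 𝓘, ∀ e : Fin 2 →₀ ℕ,
    (coeff e F).natDegree ≤ n ∧ (coeff e F).coeff n = coeff e f}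
  zero_mem' := ⟨0, 0, 𝓘.zero_mem, fun e => by simp⟩
  add_mem' := by
    rintro f₁ f₂ ⟨n₁, F₁, hF₁, h₁⟩ ⟨n₂, F₂, hF₂, h₂⟩
    refine ⟨n₁ + n₂, C (Polynomial.X ^ n₂) * F₁ + C (Polynomial.X ^ n₁) * F₂,
      𝓘.add_mem (𝓘.mul_mem_left _ hF₁) (𝓘.mul_mem_left _ hF₂), fun e => ?_⟩
    obtain ⟨a₁, b₁⟩ := h₁ e
    obtain ⟨a₂, b₂⟩ := h₂ e
    simp only [map_add, coeff_C_mul]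
    constructor
    · refine Polynomial.natDegree_add_le_of_degree_le ?_ ?_
      · refine Polynomial.natDegree_mul_le.trans ?_
        have := Polynomial.natDegree_X_pow_le (R := K) n₂
        omega
      · refine Polynomial.natDegree_mul_le.trans ?_
        have := Polynomial.natDegree_X_pow_le (R := K) n₁
        omega
    · rw [Polynomial.coeff_add, Polynomial.coeff_X_pow_mul, add_comm n₁ n₂,
        Polynomial.coeff_X_pow_mul, b₁, b₂]
  smul_mem' := by
    rintro r f ⟨n, F, hF, h⟩
    refine ⟨n, MvPowerSeries.map Polynomial.C r * F, 𝓘.mul_mem_left _ hF, fun e => ?_⟩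
    simp only [smul_eq_mul, coeff_mul, coeff_map]
    constructor
    · refine Polynomial.natDegree_sum_le_of_forall_le _ _ fun q _ => ?_
      exact (Polynomial.natDegree_C_mul_le _ _).trans (h q.2).1
    · rw [Polynomial.finsetSum_coeff]
      refine Finset.sum_congr rfl fun q _ => ?_
      rw [Polynomial.coeff_C_mul, (h q.2).2]

/-- `lim_{t → ∞} g(t, 0)(I)`. -/
noncomputable def limG₁ (I : Ideal (PS K)) : Ideal (PS K) :=
  flatLimit (moved (gSubst (Polynomial.X : Polynomial K) 0) I)

/-- `lim_{t → ∞} g(0, t)(I)`. -/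
noncomputable def limG₂ (I : Ideal (PS K)) : Ideal (PS K) :=
  flatLimit (moved (gSubst 0 (Polynomial.X : Polynomial K)) I)

/-- `lim_{t → ∞} h(t, 0)(I)`. -/
noncomputable def limH₁ (I : Ideal (PS K)) : Ideal (PS K) :=
  flatLimit (moved (hSubst (Polynomial.X : Polynomial K) 0) I)

/-- `lim_{t → ∞} h(0, t)(I)`. -/
noncomputable def limH₂ (I : Ideal (PS K)) : Ideal (PS K) :=
  flatLimit (moved (hSubst 0 (Polynomial.X : Polynomial K)) I)

end Families

/-! ### Plücker coordinates

An ideal `I` of colength `d` contains `(x, y) ^ d`, and so do all ideals of the same colength.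
They are regarded as subspaces of `V = K[[x, y]] / (x, y) ^ d`, which has the monomials of
degree less than `d` as a basis. -/

section Plucker

variable {K : Type*} [Field K]

/-- The exponents of the monomial basis of `V`. -/
abbrev LowExp (d : ℕ) : Type := {e : Fin 2 →₀ ℕ // e.degree < d}

instance (d : ℕ) : Finite (LowExp d) := (Finsupp.finite_of_degree_lt (σ := Fin 2) d).to_subtype

/-- The exponents of the monomials spanning the image of the monomial ideal `I` in `V`. -/
abbrev Row (I : Ideal (PS K)) : Type :=
  {e : LowExp (colength I) // monomial e.1 (1 : K) ∈ I}

noncomputable instance (I : Ideal (PS K)) : Fintype (Row I) := Fintype.ofFinite _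

/-- Plücker coordinates are indexed by the families of monomials of `V`, of length the dimension
of the image of `I` in `V` (the coordinate changes sign under odd permutations of a family, and
is zero if the family has a repetition). -/
abbrev Coord (I : Ideal (PS K)) : Type := Row I → LowExp (colength I)

/-- The Plücker coordinate `c` of the subspace spanned by the images of the `f i` in `V`. -/
noncomputable def minor {A : Type*} [CommRing A] (I : Ideal (PS K)) (f : Row I → PS A)
    (c : Coord I) : A :=
  Matrix.det (Matrix.of fun i j : Row I => coeff (c j).1 (f i))

/-- The coordinate functions of `F(I)`: the Plücker coordinates of `g(a, b)(I)`, respectively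
`h(a, b)(I)`, as polynomials in the variables `a` and `b`. -/
noncomputable def coordFun (κ : Kind) (I : Ideal (PS K)) (c : Coord I) :
    MvPolynomial (Fin 2) K :=
  minor I (fun i => subst
    (κ.rep (MvPolynomial.X 0 : MvPolynomial (Fin 2) K) (MvPolynomial.X 1))
    (monomial i.1.1 (1 : K))) c

/-- `P` is a vector of homogeneous Plücker coordinates of the ideal `J`, considered as a point
of the Grassmannian of subspaces of `V` of the same dimension as the image of `I`. -/
def IsPluckerVector (I J : Ideal (PS K)) (P : Coord I → K) : Prop :=
  P ≠ 0 ∧ ∃ f : Row I → PS K,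
    J.restrictScalars K =
      Submodule.span K (Set.range f) ⊔ (maxIdeal K ^ colength I).restrictScalars K ∧
    P = minor I f

/-- A vector of homogeneous coordinates that satisfies every homogeneous polynomial relation
between the coordinate functions of `F(I)`, i.e. that lies on the closure of the image of `F(I)`
in projective space. -/
def InClosure (κ : Kind) (I : Ideal (PS K)) (P : Coord I → K) : Prop :=
  ∀ (n : ℕ) (Φ : MvPolynomial (Coord I) K), Φ.IsHomogeneous n →
    MvPolynomial.aeval (coordFun κ I) Φ = 0 → MvPolynomial.eval P Φ = 0

/-! ### The standard fan -/

/-- The point of the plane with the coordinates of an exponent vector of a monomial in `a, b`. -/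
def expPoint (e : Fin 2 →₀ ℕ) : ℝ × ℝ := ((e 0 : ℝ), (e 1 : ℝ))

/-- The convex hull `H` of the exponent vectors `(m, n)` of the monomials `a ^ m b ^ n` occurring
in the coordinate functions of `F(I)`. -/
def hull (κ : Kind) (I : Ideal (PS K)) : Set (ℝ × ℝ) :=
  convexHull ℝ (expPoint '' {e | ∃ c : Coord I, e ∈ (coordFun κ I c).support})

/-- The cone of outer normals of `H` at its point `w`: the directions in which, among the points
of `H`, the point `w` is farthest. -/
def normalCone (H : Set (ℝ × ℝ)) (w : ℝ × ℝ) : Set (ℝ × ℝ) :=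
  {u | ∀ v ∈ H, u.1 * v.1 + u.2 * v.2 ≤ u.1 * w.1 + u.2 * w.2}

/-- The standard fan `Δ(I)`: the outer normal fan of `H`. Its rays are the outer normals to the
edges of `H`. -/
def standardFan (κ : Kind) (I : Ideal (PS K)) : Set (Set (ℝ × ℝ)) :=
  {σ | ∃ w ∈ hull κ I, σ = normalCone (hull κ I) w}

/-- The ideals forming the torus orbit in the closure of `F(I)` that corresponds to the cone `σ`
of `Δ(I)`: the points of the closure whose nonzero coordinates are exactly the ones with
exponent vector on the face of `H` dual to `σ`. For a two-dimensional cone this is the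
torus-fixed ideal corresponding to it. -/
def torusOrbit (κ : Kind) (I : Ideal (PS K)) (σ : Set (ℝ × ℝ)) : Set (Ideal (PS K)) :=
  {J | ∃ P : Coord I → K, IsPluckerVector I J P ∧ InClosure κ I P ∧
    ∀ c : Coord I, P c ≠ 0 ↔
      ∃ e ∈ (coordFun κ I c).support, σ ⊆ normalCone (hull κ I) (expPoint e)}

/-- The ideals corresponding to the cone of `Δ(I)` just clockwise to the ray through `u`
(`I⁺(u)` for `m(4, 1)`, `I₊(u)` for `m(3, 2)`). -/
def clockwise (κ : Kind) (I : Ideal (PS K)) (u : ℝ × ℝ) : Set (Ideal (PS K)) :=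
  {J | ∃ σ ∈ standardFan κ I, u ∈ σ ∧
    (∃ δ : ℝ, 0 < δ ∧ ∀ ε : ℝ, 0 < ε → ε < δ → (u.1 + ε * u.2, u.2 - ε * u.1) ∈ σ) ∧
    J ∈ torusOrbit κ I σ}

/-- The ideals corresponding to the cone of `Δ(I)` just counterclockwise to the ray through `u`
(`I⁻(u)` for `m(4, 1)`, `I₋(u)` for `m(3, 2)`). -/
def counterclockwise (κ : Kind) (I : Ideal (PS K)) (u : ℝ × ℝ) : Set (Ideal (PS K)) :=
  {J | ∃ σ ∈ standardFan κ I, u ∈ σ ∧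
    (∃ δ : ℝ, 0 < δ ∧ ∀ ε : ℝ, 0 < ε → ε < δ → (u.1 - ε * u.2, u.2 + ε * u.1) ∈ σ) ∧
    J ∈ torusOrbit κ I σ}

end Plucker

/-- The closed lower left quadrant. -/
def quadrant : Set (ℝ × ℝ) := {u | u.1 ≤ 0 ∧ u.2 ≤ 0}

/-- The negative horizontal axis (with the origin). -/
def negXAxis : Set (ℝ × ℝ) := {u | u.1 ≤ 0 ∧ u.2 = 0}

/-- The negative vertical axis (with the origin). -/
def negYAxis : Set (ℝ × ℝ) := {u | u.1 = 0 ∧ u.2 ≤ 0}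

/-- The same monomial ideal over an extension field. -/
noncomputable def extend {K : Type*} [Field K] (L : Type*) [Field L] [Algebra K L]
    (I : Ideal (PS K)) : Ideal (PS L) :=
  I.map (MvPowerSeries.map (σ := Fin 2) (algebraMap K L))

end ToricHilb

/-! Let d be the colength of I. All ideals that occur contain (x, y)^d, so each is the row space of
a matrix with columns indexed by the monomials of degree less than d, and its Plücker coordinates
are the maximal minors `pl`. A substitution without constant terms acts on the columns by a matrix
`tmat`, so the coordinates of g(a, b)(I) and h(a, b)(I) are the minors of `rowMat * tmat`.

The measuring sequence enters only through combinatorics. It says which shears x ↦ x + y^r and y ↦ y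
+ x^s preserve the set of exponents of I (`Kind.HasStab`), the characteristic appearing through
vanishing binomial coefficients. The positive half of this shows that a substitution with x ↦ (x,
y^r), y ↦ (x^s, y) only changes the basis of the row space (`exists_rowMat_mul_eq`). The negative
half shows that only a = b = 0 fixes I (`IsStaircase.eq_zero_of_moved_eq`).

The chart of the quadrant. Giving a and b suitable weights in ℤ² makes the substitutions
homogeneous; the two weights are linearly independent, so every coordinate is a scalar multiple of a
monomial. The coordinate belonging to I itself is 1, so 0 is an exponent. If no pure power of a
occurred, a = 1, b = 0 would fix I; hence pure powers of a and, likewise, of b occur. This makes the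
quadrant the normal cone at 0. It also makes K[a, b] integral over the algebra of coordinates, so by
lying over and the Nullstellensatz every point of the closure with nonzero base coordinate comes
from some (a, b). That these points form the whole orbit follows by writing an automorphism fixing
(x, y^2), up to a stable one, as a representative.

The limits. A flat limit in one parameter t has as Plücker vector, up to a factor, the coefficients
of the highest power of t in the minors (`isFrame_flatLimit`, `pl_replaceRows`). To find the vertex
of H reached, the families are factored, modulo stable substitutions, into two one-parameter
substitutions: g(a, b) and h(a, b) into their values on the axes, in either order, and g(a, -2a²c)
into h(0, c) ∘ g(a, 0). With t and s as the parameters of the two factors, a^m b^n becomes a nonzero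
scalar times t^p s^q. The second factor is constant in t, and multiplying by such a matrix does not
raise the t-degree of the minors (`natDegree_pl_mul_le`). So the maximum of p over all exponents is
already attained where q = 0: the first limit is the vertex at the end q = 0 of the edge on which p
is largest, and the second limit is the other end (`two_step_limit`). For the last factorization p =
m + 2n, which produces the ray (1, 2), and the scalar (-2)^n is the reason for excluding
characteristic 2. -/

namespace ToricHilb

open MvPowerSeries

/-! ### Power series modulo powers of (x, y), and matrices of substitutions. -/

section Series

variable {A : Type*} [CommRing A]

/-- The ideal `(x, y)` over a commutative ring. -/
noncomputable def originIdeal (A : Type*) [CommRing A] : Ideal (PS A) :=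
  Ideal.span {(X 0 : PS A), X 1}

theorem X_zero_mem_originIdeal : (X 0 : PS A) ∈ originIdeal A := Ideal.subset_span (by simp)

theorem X_one_mem_originIdeal : (X 1 : PS A) ∈ originIdeal A := Ideal.subset_span (by simp)

theorem maxIdeal_eq_originIdeal (K : Type*) [Field K] : maxIdeal K = originIdeal K := by
  simp [maxIdeal, powIdeal, originIdeal]

/-- The part of a power series divisible by `X i`, divided by `X i`. -/
noncomputable def shiftDown (i : Fin 2) (F : PS A) : PS A :=
  fun e => coeff (e + Finsupp.single i 1) F

theorem coeff_shiftDown (i : Fin 2) (F : PS A) (e : Fin 2 →₀ ℕ) :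
    coeff e (shiftDown i F) = coeff (e + Finsupp.single i 1) F := rfl

theorem coeff_X_mul_shiftDown (i : Fin 2) (F : PS A) (e : Fin 2 →₀ ℕ) :
    coeff e (X i * shiftDown i F) = if 1 ≤ e i then coeff e F else 0 := by
  rw [X, coeff_monomial_mul]
  have h : (Finsupp.single i 1 ≤ e) ↔ 1 ≤ e i := by
    rw [Finsupp.single_le_iff]
  simp only [h]
  split_ifs with h1
  · rw [coeff_shiftDown, tsub_add_cancel_of_le (h.2 h1), one_mul]
  · rfl

/-- A power series is its constant term plus multiples of `x` and `y`; orders are respected. -/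
theorem exists_eq_C_add (F : PS A) : ∃ G H : PS A, F = C (constantCoeff F) + X 0 * G + X 1 * H ∧
    ∀ d, (∀ e : Fin 2 →₀ ℕ, e.degree < d + 1 → coeff e F = 0) →
      (∀ e : Fin 2 →₀ ℕ, e.degree < d → coeff e G = 0) ∧
      (∀ e : Fin 2 →₀ ℕ, e.degree < d → coeff e H = 0) := by
  -- G collects every term divisible by x; what is left apart from the constant is divisible by y
  -- and goes to H.
  refine ⟨shiftDown 0 F, shiftDown 1 (F - X 0 * shiftDown 0 F), ?_, fun d hd => ⟨?_, ?_⟩⟩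
  · ext e
    simp only [map_add, coeff_X_mul_shiftDown, map_sub, coeff_C]
    by_cases h0 : 1 ≤ e 0
    · have : e ≠ 0 := by rintro rfl; simp at h0
      simp [h0, this]
    · by_cases h1 : 1 ≤ e 1
      · have : e ≠ 0 := by rintro rfl; simp at h1
        simp [h0, h1, this]
      · have : e = 0 := by
          ext i; fin_cases i
          · simpa using h0
          · simpa using h1
        subst this
        simp
  · intro e he
    rw [coeff_shiftDown]
    exact hd _ (by rw [map_add, Finsupp.degree_single]; omega)
  · intro e he
    rw [coeff_shiftDown, map_sub, coeff_X_mul_shiftDown, hd]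
    · simp
    · rw [map_add, Finsupp.degree_single]; omega

theorem coeff_eq_zero_of_mem_pow {d : ℕ} {F : PS A} (hF : F ∈ originIdeal A ^ d)
    {e : Fin 2 →₀ ℕ} (he : e.degree < d) : coeff e F = 0 := by
  induction d generalizing F e with
  | zero => omega
  | succ d ih =>
    rw [pow_succ'] at hF
    refine Submodule.mul_induction_on hF ?_ ?_
    · intro a ha b hb
      rw [originIdeal, Ideal.mem_span_pair] at ha
      obtain ⟨p, q, rfl⟩ := ha
      have key : ∀ (i : Fin 2) (r : PS A), coeff e (r * X i * b) = 0 := by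
        intro i r
        rw [mul_comm r, mul_assoc, X, coeff_monomial_mul]
        split_ifs with h
        · rw [one_mul]
          refine ih (Ideal.mul_mem_left _ r hb) ?_
          have := congrArg Finsupp.degree (tsub_add_cancel_of_le h)
          rw [map_add, Finsupp.degree_single] at this
          omega
        · rfl
      rw [add_mul, map_add, key, key, add_zero]
    · intro a b ha hb
      rw [map_add, ha, hb, add_zero]

/-- The power `(x, y) ^ d` consists of the power series of order at least `d`. -/
theorem mem_originIdeal_pow_iff {d : ℕ} {F : PS A} :
    F ∈ originIdeal A ^ d ↔ ∀ e : Fin 2 →₀ ℕ, e.degree < d → coeff e F = 0 := by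
  refine ⟨fun h e he => coeff_eq_zero_of_mem_pow h he, ?_⟩
  induction d generalizing F with
  | zero => simp
  | succ d ih =>
    intro h
    obtain ⟨G, H, hF, hGH⟩ := exists_eq_C_add F
    have h0 : constantCoeff F = 0 := by
      rw [← coeff_zero_eq_constantCoeff_apply]; exact h 0 (by simp)
    rw [hF, h0, map_zero, zero_add, pow_succ']
    exact add_mem (Ideal.mul_mem_mul X_zero_mem_originIdeal (ih (hGH d h).1))
      (Ideal.mul_mem_mul X_one_mem_originIdeal (ih (hGH d h).2))

theorem mem_originIdeal_iff {F : PS A} : F ∈ originIdeal A ↔ constantCoeff F = 0 := by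
  rw [← pow_one (originIdeal A), mem_originIdeal_pow_iff]
  constructor
  · intro h
    rw [← coeff_zero_eq_constantCoeff_apply]; exact h 0 (by simp)
  · intro h e he
    have : e = 0 := by rw [← Finsupp.degree_eq_zero_iff]; omega
    rw [this, coeff_zero_eq_constantCoeff_apply, h]

/-- The image of the monomial with exponent `e` under the substitution `s`. -/
noncomputable def powProd (s : Fin 2 → PS A) (e : Fin 2 →₀ ℕ) : PS A := s 0 ^ e 0 * s 1 ^ e 1

theorem powProd_add (s : Fin 2 → PS A) (e e' : Fin 2 →₀ ℕ) :
    powProd s (e + e') = powProd s e * powProd s e' := by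
  simp only [powProd, Finsupp.add_apply, pow_add]; ring

/-- The products of degree `d` of `s 0` and `s 1` generate the power `(s 0, s 1) ^ d`. -/
theorem span_pair_pow_le {s : Fin 2 → PS A} {d : ℕ} {J : Ideal (PS A)}
    (h : ∀ e : Fin 2 →₀ ℕ, e.degree = d → powProd s e ∈ J) : Ideal.span {s 0, s 1} ^ d ≤ J := by
  -- The induction peels one linear factor at a time off the ideal power and stores it in the
  -- exponent e, keeping the total degree d.
  have key : ∀ (k : ℕ) (e : Fin 2 →₀ ℕ), e.degree + k = d → ∀ F ∈ Ideal.span {s 0, s 1} ^ k,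
      powProd s e * F ∈ J := by
    intro k
    induction k with
    | zero => exact fun e he F _ => Ideal.mul_mem_right _ _ (h e (by simpa using he))
    | succ k ih =>
      intro e he F hF
      rw [pow_succ'] at hF
      refine Submodule.mul_induction_on hF ?_ ?_
      · intro a ha b hb
        rw [Ideal.mem_span_pair] at ha
        obtain ⟨u, v, rfl⟩ := ha
        have h0 := ih (e + Finsupp.single 0 1)
          (by rw [map_add, Finsupp.degree_single]; omega) b hb
        have h1 := ih (e + Finsupp.single 1 1)
          (by rw [map_add, Finsupp.degree_single]; omega) b hb
        rw [powProd_add] at h0 h1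
        have e0 : powProd s (Finsupp.single 0 1) = s 0 := by simp [powProd]
        have e1 : powProd s (Finsupp.single 1 1) = s 1 := by simp [powProd]
        rw [e0] at h0
        rw [e1] at h1
        have := add_mem (Ideal.mul_mem_left _ u h0) (Ideal.mul_mem_left _ v h1)
        convert this using 1
        ring
      · intro a b ha hb
        rw [mul_add]
        exact add_mem ha hb
  intro F hF
  have := key d 0 (by simp) F hF
  simpa [powProd] using this

theorem powProd_X (e : Fin 2 →₀ ℕ) : powProd (X : Fin 2 → PS A) e = monomial e 1 := by
  have he : Finsupp.single 0 (e 0) + Finsupp.single 1 (e 1) = e := by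
    ext i; fin_cases i <;> simp
  rw [powProd, X_pow_eq, X_pow_eq, monomial_mul_monomial, one_mul, he]

theorem powProd_mem {s : Fin 2 → PS A} (hs : ∀ i, constantCoeff (s i) = 0) (e : Fin 2 →₀ ℕ) :
    powProd s e ∈ originIdeal A ^ e.degree := by
  have : e.degree = e 0 + e 1 := by simp [Finsupp.degree_eq_sum]
  rw [this, pow_add]
  exact Ideal.mul_mem_mul (Ideal.pow_mem_pow (mem_originIdeal_iff.2 (hs 0)) _)
    (Ideal.pow_mem_pow (mem_originIdeal_iff.2 (hs 1)) _)

theorem hasSubst_of_zero {s : Fin 2 → PS A} (hs : ∀ i, constantCoeff (s i) = 0) : HasSubst s :=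
  hasSubst_of_constantCoeff_zero hs

theorem prod_eq_powProd (s : Fin 2 → PS A) (e : Fin 2 →₀ ℕ) :
    (e.prod fun i n => s i ^ n) = powProd s e := by
  rw [Finsupp.prod_fintype _ _ (by simp), Fin.prod_univ_two, powProd]

noncomputable instance (d : ℕ) : Fintype (LowExp d) := Fintype.ofFinite _

/-- The matrix of a substitution modulo `(x, y) ^ d`; its rows are the images of the monomials. -/
noncomputable def tmat (d : ℕ) (s : Fin 2 → PS A) : Matrix (LowExp d) (LowExp d) A :=
  Matrix.of fun e j => coeff j.1 (powProd s e.1)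

/-- The matrix of the coefficients, modulo `(x, y) ^ d`, of a family of power series. -/
noncomputable def cmat {ι : Type*} (d : ℕ) (f : ι → PS A) : Matrix ι (LowExp d) A :=
  Matrix.of fun i j => coeff j.1 (f i)

/-- Since s has no constant terms, a monomial of degree at least d contributes nothing in degrees
below d; the a priori infinite sum is a row of a finite matrix product. -/
theorem coeff_subst_low {R : Type*} [CommRing R] [Algebra R A] {d : ℕ} {s : Fin 2 → PS A}
    (hs : ∀ i, constantCoeff (s i) = 0) (F : PS R) (j : LowExp d) :
    coeff j.1 (subst s F) =
      ∑ e : LowExp d, algebraMap R A (coeff e.1 F) * coeff j.1 (powProd s e.1) := by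
  classical
  rw [coeff_subst (hasSubst_of_zero hs)]
  simp only [prod_eq_powProd]
  have hfin : {e : Fin 2 →₀ ℕ | e.degree < d}.Finite := Finsupp.finite_of_degree_lt (σ := Fin 2) d
  rw [finsum_eq_sum_of_support_subset (s := hfin.toFinset)]
  · rw [← Finset.sum_subtype hfin.toFinset (p := fun e => e.degree < d) (by simp)
      (fun e => algebraMap R A (coeff e F) * coeff j.1 (powProd s e))]
    simp only [Algebra.smul_def]
  · intro e he
    simp only [Set.Finite.coe_toFinset, Set.mem_ofPred_eq]
    by_contra h
    apply he
    have : coeff j.1 (powProd s e) = 0 :=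
      coeff_eq_zero_of_mem_pow (powProd_mem hs e) (by have := j.2; omega)
    simp [this]

theorem cmat_subst {ι R : Type*} [CommRing R] [Algebra R A] {d : ℕ} {s : Fin 2 → PS A}
    (hs : ∀ i, constantCoeff (s i) = 0) (f : ι → PS R) :
    cmat d (fun i => subst s (f i)) = (cmat d f).map (algebraMap R A) * tmat d s := by
  ext i j
  simp [cmat, tmat, Matrix.mul_apply, coeff_subst_low hs]

theorem subst_monomial_one {R : Type*} [CommRing R] [Algebra R A] {s : Fin 2 → PS A}
    (hs : ∀ i, constantCoeff (s i) = 0) (e : Fin 2 →₀ ℕ) :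
    subst s (monomial e (1 : R)) = powProd s e := by
  rw [subst_monomial (hasSubst_of_zero hs), prod_eq_powProd, map_one, one_mul]

theorem subst_powProd {s β : Fin 2 → PS A} (hs : ∀ i, constantCoeff (s i) = 0)
    (e : Fin 2 →₀ ℕ) : subst s (powProd β e) = powProd (fun i => subst s (β i)) e := by
  have h := hasSubst_of_zero hs
  simp only [powProd, subst_mul h, subst_pow h]

/-- The matrix of a composite. -/
theorem tmat_comp (d : ℕ) {s β : Fin 2 → PS A} (hs : ∀ i, constantCoeff (s i) = 0) :
    tmat d (fun i => subst s (β i)) = tmat d β * tmat d s := by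
  ext e j
  change coeff j.1 (powProd (fun i => subst s (β i)) e.1) = _
  rw [← subst_powProd hs, coeff_subst_low hs, Matrix.mul_apply]
  rfl

theorem tmat_map {B : Type*} [CommRing B] (φ : A →+* B) (d : ℕ) (s : Fin 2 → PS A) :
    tmat d (fun i => MvPowerSeries.map φ (s i)) = (tmat d s).map φ := by
  ext e j
  simp only [tmat, powProd, Matrix.of_apply, Matrix.map_apply, ← map_pow, ← map_mul, coeff_map]

theorem tmat_X (d : ℕ) : tmat d (X : Fin 2 → PS A) = 1 := by
  ext e j
  simp only [tmat, Matrix.of_apply, powProd_X, coeff_monomial, Matrix.one_apply]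
  by_cases h : e = j
  · simp [h]
  · rw [if_neg h, if_neg (fun h' => h (Subtype.ext h'.symm))]

/-- The substitution `s` generates the ideal `(x, y)`. -/
def IsCoordinates (s : Fin 2 → PS A) : Prop :=
  Ideal.span {s 0, s 1} = originIdeal A

theorem IsCoordinates.constantCoeff_eq_zero {s : Fin 2 → PS A} (hs : IsCoordinates s) (i : Fin 2) :
    constantCoeff (s i) = 0 := by
  rw [← mem_originIdeal_iff, ← hs]
  apply Ideal.subset_span
  fin_cases i <;> simp

theorem isCoordinates_of {s : Fin 2 → PS A} (hs : ∀ i, constantCoeff (s i) = 0)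
    (h0 : (X 0 : PS A) ∈ Ideal.span {s 0, s 1}) (h1 : (X 1 : PS A) ∈ Ideal.span {s 0, s 1}) :
    IsCoordinates s := by
  apply le_antisymm
  · rw [Ideal.span_le]
    rintro _ (rfl | rfl)
    · exact mem_originIdeal_iff.2 (hs 0)
    · exact mem_originIdeal_iff.2 (hs 1)
  · rw [originIdeal, Ideal.span_le]
    rintro _ (rfl | rfl)
    · exact h0
    · exact h1

/-- Modulo `(x, y) ^ d`, every power series is a polynomial in a system of coordinates. -/
theorem IsCoordinates.exists_expansion {s : Fin 2 → PS A} (hs : IsCoordinates s) (d : ℕ)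
    (F : PS A) : ∃ q ∈ Submodule.span A (Set.range (powProd s)), F - q ∈ originIdeal A ^ d := by
  induction d generalizing F with
  | zero => exact ⟨0, zero_mem _, by simp⟩
  | succ d ih =>
    have hF : F - C (constantCoeff F) ∈ Ideal.span {s 0, s 1} := by
      rw [hs, mem_originIdeal_iff]; simp
    rw [Ideal.mem_span_pair] at hF
    obtain ⟨G, H, hGH⟩ := hF
    obtain ⟨q₀, hq₀, h₀⟩ := ih G
    obtain ⟨q₁, hq₁, h₁⟩ := ih H
    have hmul : ∀ i : Fin 2, ∀ q ∈ Submodule.span A (Set.range (powProd s)),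
        q * s i ∈ Submodule.span A (Set.range (powProd s)) := by
      intro i q hq
      induction hq using Submodule.span_induction with
      | mem x hx =>
        obtain ⟨e, rfl⟩ := hx
        apply Submodule.subset_span
        refine ⟨e + Finsupp.single i 1, ?_⟩
        rw [powProd_add]
        congr 1
        fin_cases i <;> simp [powProd]
      | zero => simp
      | add x y _ _ hx hy => rw [add_mul]; exact add_mem hx hy
      | smul a x _ hx => rw [smul_mul_assoc]; exact Submodule.smul_mem _ _ hx
    refine ⟨constantCoeff F • powProd s 0 + q₀ * s 0 + q₁ * s 1, add_mem (add_mem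
      (Submodule.smul_mem _ _ (Submodule.subset_span ⟨0, rfl⟩)) (hmul 0 _ hq₀)) (hmul 1 _ hq₁), ?_⟩
    have h : F - (constantCoeff F • powProd s 0 + q₀ * s 0 + q₁ * s 1) =
        (G - q₀) * s 0 + (H - q₁) * s 1 := by
      have : constantCoeff F • powProd s 0 = C (constantCoeff F) := by
        simp [powProd, smul_eq_C_mul]
      rw [this]
      linear_combination -hGH
    rw [h, pow_succ]
    exact add_mem (Ideal.mul_mem_mul h₀ (mem_originIdeal_iff.2 (hs.constantCoeff_eq_zero 0)))
      (Ideal.mul_mem_mul h₁ (mem_originIdeal_iff.2 (hs.constantCoeff_eq_zero 1)))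

end Series

/-! ### Ideals containing (x, y)^d as row spaces. -/

section Frames

variable {K : Type*} [Field K] {ι : Type*} [Fintype ι]

/-- The power series `f i` span the ideal `J` modulo `(x, y) ^ d`, which is contained in `J`. -/
def IsFrame (d : ℕ) (J : Ideal (PS K)) (f : ι → PS K) : Prop :=
  J.restrictScalars K = Submodule.span K (Set.range f) ⊔ (maxIdeal K ^ d).restrictScalars K

/-- The dictionary between ideals and matrices: membership in J depends only on the low
coefficients, which have to form a vector of the row space. -/
theorem isFrame_iff {d : ℕ} {J : Ideal (PS K)} {f : ι → PS K} :
    IsFrame d J f ↔ ∀ F, F ∈ J ↔ ∃ p : ι → K, ∀ j : LowExp d,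
      coeff j.1 F = Matrix.vecMul p (cmat d f) j := by
  have key : ∀ F, F ∈ Submodule.span K (Set.range f) ⊔ (maxIdeal K ^ d).restrictScalars K ↔
      ∃ p : ι → K, ∀ j : LowExp d, coeff j.1 F = Matrix.vecMul p (cmat d f) j := by
    intro F
    rw [Submodule.mem_sup]
    constructor
    · rintro ⟨a, ha, b, hb, rfl⟩
      obtain ⟨p, rfl⟩ := (Submodule.mem_span_range_iff_exists_fun K).1 ha
      refine ⟨p, fun j => ?_⟩
      rw [Submodule.restrictScalars_mem, maxIdeal_eq_originIdeal] at hb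
      rw [map_add, coeff_eq_zero_of_mem_pow hb j.2, add_zero, map_sum]
      simp [Matrix.vecMul, dotProduct, cmat]
    · rintro ⟨p, hp⟩
      refine ⟨∑ i, p i • f i, (Submodule.mem_span_range_iff_exists_fun K).2 ⟨p, rfl⟩,
        F - ∑ i, p i • f i, ?_, by abel⟩
      rw [Submodule.restrictScalars_mem, maxIdeal_eq_originIdeal, mem_originIdeal_pow_iff]
      intro e he
      have := hp ⟨e, he⟩
      simp only [Matrix.vecMul, dotProduct, cmat, Matrix.of_apply] at this
      rw [map_sub, this, map_sum]
      simp
  constructor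
  · intro h F
    rw [← key F, ← h, Submodule.restrictScalars_mem]
  · intro h
    ext F
    rw [key F, Submodule.restrictScalars_mem, h F]

theorem IsFrame.pow_le {d : ℕ} {J : Ideal (PS K)} {f : ι → PS K} (h : IsFrame d J f) :
    originIdeal K ^ d ≤ J := by
  intro F hF
  rw [isFrame_iff.1 h]
  exact ⟨0, fun j => by rw [coeff_eq_zero_of_mem_pow hF j.2]; simp⟩

theorem IsFrame.mem {d : ℕ} {J : Ideal (PS K)} {f : ι → PS K} (h : IsFrame d J f) (i : ι) :
    f i ∈ J := by
  classical
  rw [isFrame_iff.1 h]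
  refine ⟨Pi.single i 1, fun j => by simp [cmat]⟩

/-- The members of `moved s J`, in terms of a frame of `J`. -/
theorem mem_moved_iff {A : Type*} [CommRing A] [Algebra K A] {d : ℕ} {J : Ideal (PS K)}
    {f : ι → PS K} (h : IsFrame d J f) {s : Fin 2 → PS A} (hs : IsCoordinates s) (F : PS A) :
    F ∈ moved s J ↔ ∃ p : ι → A, ∀ j : LowExp d,
      coeff j.1 F = Matrix.vecMul p ((cmat d f).map (algebraMap K A) * tmat d s) j := by
  have hs0 := hs.constantCoeff_eq_zero
  have hS := hasSubst_of_zero hs0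
  -- The right-hand side is only visibly an A-module. The work is to show that it absorbs
  -- multiplication by power series and contains the generators of `moved s J`.
  set N : Submodule A (PS A) := { 
    carrier := {F | ∃ p : ι → A, ∀ j : LowExp d,
      coeff j.1 F = Matrix.vecMul p ((cmat d f).map (algebraMap K A) * tmat d s) j}
    zero_mem' := ⟨0, fun j => by simp⟩
    add_mem' := by
      rintro a b ⟨p, hp⟩ ⟨q, hq⟩
      exact ⟨p + q, fun j => by rw [map_add, hp, hq, Matrix.add_vecMul]; rfl⟩
    smul_mem' := by
      rintro c a ⟨p, hp⟩
      exact ⟨c • p, fun j => by rw [Matrix.smul_vecMul, Pi.smul_apply, ← hp]; simp⟩ } with hN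
  have hNlow : ∀ F ∈ originIdeal A ^ d, F ∈ N := fun F hF =>
    ⟨0, fun j => by rw [coeff_eq_zero_of_mem_pow hF j.2]; simp⟩
  have hNsubst : ∀ g ∈ J, subst s g ∈ N := by
    intro g hg
    obtain ⟨p, hp⟩ := (isFrame_iff.1 h g).1 hg
    refine ⟨fun i => algebraMap K A (p i), fun j => ?_⟩
    rw [coeff_subst_low hs0, ← Matrix.vecMul_vecMul]
    simp only [Matrix.vecMul, dotProduct, tmat, Matrix.of_apply] at hp ⊢
    refine Finset.sum_congr rfl fun e _ => ?_
    rw [hp e]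
    simp [cmat]
  have hsub : ∀ {F : PS A} {p : ι → A}, (∀ j : LowExp d,
      coeff j.1 F = Matrix.vecMul p ((cmat d f).map (algebraMap K A) * tmat d s) j) →
      F - ∑ i, p i • subst s (f i) ∈ originIdeal A ^ d := by
    intro F p hp
    rw [mem_originIdeal_pow_iff]
    intro e he
    have := hp ⟨e, he⟩
    rw [← cmat_subst hs0] at this
    simp only [Matrix.vecMul, dotProduct, cmat, Matrix.of_apply] at this
    rw [map_sub, this, map_sum]
    simp
  have hrow : ∀ i, subst s (f i) ∈ moved s J := fun i => Ideal.subset_span ⟨f i, h.mem i, rfl⟩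
  -- As s generates (x, y), the power (x, y)^d is generated by the images of the monomials of degree
  -- d, which lie in J.
  have hpow : originIdeal A ^ d ≤ moved s J := by
    rw [← hs]
    refine span_pair_pow_le fun e he => ?_
    rw [← subst_monomial_one (R := K) hs0]
    refine Ideal.subset_span ⟨_, h.pow_le ?_, rfl⟩
    rw [mem_originIdeal_pow_iff]
    intro e' he'
    rw [coeff_monomial, if_neg]
    rintro rfl
    omega
  -- A product of powers of s is itself the image of a monomial, so multiplying by it amounts to
  -- multiplying inside J before substituting.
  have hNmul : ∀ e, ∀ F ∈ N, powProd s e * F ∈ N := by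
    rintro e F ⟨p, hp⟩
    have h2 := hsub hp
    have h3 : powProd s e * F = ∑ i, p i • subst s (monomial e (1 : K) * f i) +
        powProd s e * (F - ∑ i, p i • subst s (f i)) := by
      simp only [subst_mul hS, subst_monomial_one hs0]
      rw [mul_sub, Finset.mul_sum]
      simp only [mul_smul_comm]
      abel
    rw [h3]
    refine add_mem (sum_mem fun i _ => N.smul_mem _ (hNsubst _ (J.mul_mem_left _ (h.mem i))))
      (hNlow _ (Ideal.mul_mem_left _ _ h2))
  constructor
  · intro hF
    show F ∈ N
    refine Submodule.span_induction ?_ N.zero_mem (fun x y _ _ => N.add_mem) ?_ hF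
    · rintro _ ⟨g, hg, rfl⟩
      exact hNsubst g hg
    · intro a x _ hx
      -- An arbitrary multiplier is a polynomial in s up to order d, and the error term falls into
      -- (x, y)^d.
      obtain ⟨q, hq, haq⟩ := hs.exists_expansion d a
      have : a • x = q * x + (a - q) * x := by rw [smul_eq_mul]; ring
      rw [this]
      refine add_mem ?_ (hNlow _ (Ideal.mul_mem_right _ _ haq))
      clear haq this
      induction hq using Submodule.span_induction with
      | mem q hq => obtain ⟨e, rfl⟩ := hq; exact hNmul e x hx
      | zero => simp
      | add q q' _ _ h h' => rw [add_mul]; exact add_mem h h'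
      | smul c q _ h => rw [smul_mul_assoc]; exact N.smul_mem _ h
  · rintro ⟨p, hp⟩
    have h1 : ∑ i, p i • subst s (f i) ∈ moved s J := by
      refine Submodule.sum_mem _ fun i _ => ?_
      rw [smul_eq_C_mul]
      exact Ideal.mul_mem_left _ _ (hrow i)
    have h2 := hsub hp
    have := add_mem h1 (hpow h2)
    rwa [add_sub_cancel] at this

end Frames

end ToricHilb

namespace ToricHilb

/-! ### Maximal minors and row spaces. -/

section Minors

variable {A : Type*} [CommRing A] {ι κ : Type*} [Fintype ι] [DecidableEq ι]

/-- The maximal minor of `M` on the columns `c`. -/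
def pl (M : Matrix ι κ A) (c : ι → κ) : A := (M.submatrix id c).det

/-- Cramer's rule: solving for column j in terms of the columns c puts j in place of the k-th chosen
column. -/
theorem adjugate_mul_apply (M : Matrix ι κ A) (c : ι → κ) (k : ι) (j : κ) :
    ((M.submatrix id c).adjugate * M) k j = pl M (Function.update c k j) := by
  have h : M.submatrix id (Function.update c k j) =
      (M.submatrix id c).updateCol k (fun i => M i j) := by
    ext i l
    by_cases hl : l = k
    · subst hl; simp
    · simp [hl]
  rw [pl, h, ← Matrix.cramer_apply, Matrix.cramer_eq_adjugate_mulVec]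
  rfl

/-- This is B · adj(B) · M = det(B) · M for the square block B of M on the columns c. It expresses
every row, up to a factor, by minors alone, so proportional minors determine the same row space. -/
theorem pl_mul_apply (M : Matrix ι κ A) (c : ι → κ) (i : ι) (j : κ) :
    pl M c * M i j = ∑ k, M i (c k) * pl M (Function.update c k j) := by
  have h : M.submatrix id c * ((M.submatrix id c).adjugate * M) = pl M c • M := by
    rw [← Matrix.mul_assoc, Matrix.mul_adjugate, Matrix.smul_mul, Matrix.one_mul, pl]
  have h' := congrFun (congrFun h i) j
  rw [Matrix.mul_apply] at h'
  simp only [adjugate_mul_apply] at h'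
  rw [Matrix.smul_apply, smul_eq_mul] at h'
  rw [← h']
  rfl

theorem pl_mul_left (U : Matrix ι ι A) (M : Matrix ι κ A) (c : ι → κ) :
    pl (U * M) c = U.det * pl M c := by
  rw [pl, pl, ← Matrix.det_mul]
  rfl

theorem pl_map {B : Type*} [CommRing B] (φ : A →+* B) (M : Matrix ι κ A) (c : ι → κ) :
    pl (M.map φ) c = φ (pl M c) := by
  rw [pl, pl, RingHom.map_det]
  rfl

theorem pl_mul_vecMul (M : Matrix ι κ A) (c : ι → κ) (p : ι → A) (j : κ) :
    pl M c * Matrix.vecMul p M j =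
      ∑ k, Matrix.vecMul p M (c k) * pl M (Function.update c k j) := by
  simp only [Matrix.vecMul, dotProduct, Finset.mul_sum, Finset.sum_mul]
  rw [Finset.sum_comm]
  refine Finset.sum_congr rfl fun i _ => ?_
  rw [mul_left_comm, pl_mul_apply, Finset.mul_sum]
  exact Finset.sum_congr rfl fun k _ => by ring

theorem vecMul_adjugate (M : Matrix ι κ A) (c : ι → κ) (p : ι → A) (j : κ) :
    Matrix.vecMul (Matrix.vecMul p (M.submatrix id c).adjugate) M j =
      ∑ k, p k * pl M (Function.update c k j) := by
  rw [Matrix.vecMul_vecMul]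
  simp only [Matrix.vecMul, dotProduct, adjugate_mul_apply]

/-- The row space of a matrix over a field in terms of its maximal minors. -/
theorem exists_vecMul_iff {K : Type*} [Field K] (M : Matrix ι κ K) (c : ι → κ) (hc : pl M c ≠ 0)
    (F : κ → K) : (∃ p, ∀ j, F j = Matrix.vecMul p M j) ↔
      ∀ j, pl M c * F j = ∑ k, F (c k) * pl M (Function.update c k j) := by
  constructor
  · rintro ⟨p, hp⟩ j
    simp only [hp]
    exact pl_mul_vecMul M c p j
  · intro h
    refine ⟨Matrix.vecMul (fun k => (pl M c)⁻¹ * F (c k)) (M.submatrix id c).adjugate, fun j => ?_⟩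
    rw [vecMul_adjugate]
    simp only [mul_assoc, ← Finset.mul_sum]
    rw [← h j, inv_mul_cancel_left₀ hc]

/-- Proportional vectors of maximal minors belong to the same row space. -/
theorem exists_vecMul_congr {K : Type*} [Field K] {M M' : Matrix ι κ K} {μ : K} {c : ι → κ}
    (hc : pl M c ≠ 0) (hμ : μ ≠ 0) (h : ∀ c, pl M' c = μ * pl M c) (F : κ → K) :
    (∃ p, ∀ j, F j = Matrix.vecMul p M j) ↔ (∃ p, ∀ j, F j = Matrix.vecMul p M' j) := by
  rw [exists_vecMul_iff M c hc, exists_vecMul_iff M' c (by rw [h]; exact mul_ne_zero hμ hc)]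
  refine forall_congr' fun j => ?_
  simp only [h, mul_assoc, mul_left_comm _ μ, ← Finset.mul_sum]
  exact (mul_right_inj' hμ).symm

end Minors

/-! ### Leading coefficients of minors of polynomial matrices. -/

section Leading

open Polynomial

variable {S : Type*} [CommRing S] {ι κ : Type*} [Fintype ι] [DecidableEq ι]

theorem natDegree_det_le_coeff_det {N : Matrix ι ι S[X]} {D : ℕ}
    (h : ∀ i j, (N i j).natDegree ≤ D) :
    N.det.natDegree ≤ Fintype.card ι * D ∧
      N.det.coeff (Fintype.card ι * D) = (Matrix.of fun i j => (N i j).coeff D).det := by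
  constructor
  · rw [Matrix.det_apply]
    refine natDegree_sum_le_of_forall_le _ _ fun σ _ => ?_
    refine (natDegree_smul_le _ _).trans ((natDegree_prod_le _ _).trans ?_)
    refine (Finset.sum_le_card_nsmul _ _ D fun i _ => h _ _).trans ?_
    simp
  · rw [Matrix.det_apply, Matrix.det_apply, finsetSum_coeff]
    refine Finset.sum_congr rfl fun σ _ => ?_
    rw [coeff_smul, ← Finset.card_univ,
      coeff_prod_of_natDegree_le _ _ _ (fun i _ => h _ _)]
    rfl

/-- The rows obtained from a vector `Q` of maximal minors by replacing the columns in `c`. -/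
def replaceRows (Q : (ι → κ) → S) (c : ι → κ) : Matrix ι κ S :=
  Matrix.of fun k j => Q (Function.update c k j)

variable {M : Matrix ι κ S[X]} {D : ℕ} {Q : (ι → κ) → S} {c₀ : ι → κ}

/-- Multiplying M by the adjugate of its block on c₀ replaces its entries by minors, which have
degree at most D. The determinant of that adjugate accounts for the power of `pl M c₀`. -/
theorem natDegree_mul_pl_le [Fintype κ] (hD : ∀ c, (pl M c).natDegree ≤ D)
    (hQ : ∀ c, (pl M c).coeff D = Q c) (T : Matrix κ κ S) (c : ι → κ) :
    ((pl M c₀) ^ (Fintype.card ι - 1) * pl (M * T.map C) c).natDegree ≤ Fintype.card ι * D ∧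
    ((pl M c₀) ^ (Fintype.card ι - 1) * pl (M * T.map C) c).coeff (Fintype.card ι * D) =
      pl (replaceRows Q c₀ * T) c := by
  set N : Matrix ι κ S[X] := (M.submatrix id c₀).adjugate * (M * T.map C) with hN
  have hpl : pl M c₀ ^ (Fintype.card ι - 1) * pl (M * T.map C) c = (N.submatrix id c).det := by
    rw [hN]
    change _ = pl _ c
    rw [pl_mul_left, Matrix.det_adjugate]
    rfl
  have hentry : ∀ i j, N i j = ∑ l, pl M (Function.update c₀ i l) * C (T l j) := by
    intro i j
    rw [hN, ← Matrix.mul_assoc, Matrix.mul_apply]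
    simp only [adjugate_mul_apply, Matrix.map_apply]
  have hdeg : ∀ i j, (N i j).natDegree ≤ D := by
    intro i j
    rw [hentry]
    exact natDegree_sum_le_of_forall_le _ _ fun l _ => (natDegree_mul_C_le _ _).trans (hD _)
  rw [hpl]
  obtain ⟨h1, h2⟩ := natDegree_det_le_coeff_det (N := N.submatrix id c) (fun i j => hdeg i (c j))
  refine ⟨h1, ?_⟩
  rw [h2, pl]
  congr 1
  ext i j
  simp only [Matrix.of_apply, Matrix.submatrix_apply, id, hentry, finsetSum_coeff, coeff_mul_C, hQ,
    Matrix.mul_apply, replaceRows]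

/-- Right multiplication by a matrix constant in the variable does not raise the degree of the
minors, and their coefficients in degree D are the minors of the transformed leading rows. The
factor `pl M c₀` of the previous estimate has degree exactly D, so its power can be cancelled. -/
theorem natDegree_pl_mul_le [IsDomain S] [Fintype κ] (hD : ∀ c, (pl M c).natDegree ≤ D)
    (hQ : ∀ c, (pl M c).coeff D = Q c) (hc : Q c₀ ≠ 0) (T : Matrix κ κ S) (c : ι → κ) :
    (pl (M * T.map C) c).natDegree ≤ D ∧
    Q c₀ ^ (Fintype.card ι - 1) * (pl (M * T.map C) c).coeff D = pl (replaceRows Q c₀ * T) c := by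
  obtain ⟨h1, h2⟩ := natDegree_mul_pl_le (c₀ := c₀) hD hQ T c
  have hne : pl M c₀ ≠ 0 := by
    intro h; apply hc; rw [← hQ, h, coeff_zero]
  have hdeg : (pl M c₀).natDegree = D :=
    natDegree_eq_of_le_of_coeff_ne_zero (hD _) (by rw [hQ]; exact hc)
  have hpow : ((pl M c₀) ^ (Fintype.card ι - 1)).natDegree = (Fintype.card ι - 1) * D := by
    rw [natDegree_pow, hdeg]
  have hlead : ((pl M c₀) ^ (Fintype.card ι - 1)).coeff ((Fintype.card ι - 1) * D) =
      Q c₀ ^ (Fintype.card ι - 1) := by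
    rw [← hpow, coeff_natDegree, leadingCoeff_pow, leadingCoeff, hdeg, hQ]
  have hcard : (Fintype.card ι - 1) * D + D = Fintype.card ι * D := by
    -- Without rows the truncated subtraction would spoil the count, but then the only minor is 1
    -- and D = 0.
    rcases Nat.eq_zero_or_pos (Fintype.card ι) with h0 | h0
    · have : IsEmpty ι := Fintype.card_eq_zero_iff.1 h0
      have : pl M c₀ = 1 := by rw [pl, Matrix.det_isEmpty]
      rw [this, natDegree_one] at hdeg
      subst hdeg
      simp
    · rw [← Nat.succ_mul, Nat.succ_eq_add_one, Nat.sub_add_cancel h0]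
  have hle : (pl (M * T.map C) c).natDegree ≤ D := by
    by_cases h0 : pl (M * T.map C) c = 0
    · rw [h0, natDegree_zero]; exact Nat.zero_le _
    · rw [natDegree_mul (pow_ne_zero _ hne) h0, hpow, ← hcard] at h1
      omega
  refine ⟨hle, ?_⟩
  rw [← h2, ← hcard, coeff_mul_add_eq_of_natDegree_le hpow.le hle, hlead]

/-- The leading coefficients of the members of the row module of a polynomial matrix. -/
theorem exists_leading_iff {K : Type*} [Field K] {M : Matrix ι κ K[X]} {D : ℕ}
    {Q : (ι → κ) → K} {c₀ : ι → κ} (hD : ∀ c, (pl M c).natDegree ≤ D)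
    (hQ : ∀ c, (pl M c).coeff D = Q c) (hc : Q c₀ ≠ 0) (f : κ → K) :
    (∃ (n : ℕ) (p : ι → K[X]), ∀ j, (Matrix.vecMul p M j).natDegree ≤ n ∧
      (Matrix.vecMul p M j).coeff n = f j) ↔
    ∃ p, ∀ j, f j = Matrix.vecMul p (replaceRows Q c₀) j := by
  constructor
  · rintro ⟨n, p, hp⟩
    refine ⟨fun k => (Q c₀)⁻¹ * f (c₀ k), fun j => ?_⟩
    -- Comparing coefficients of degree D + n in the Cramer identity turns it into the same identity
    -- between leading terms.
    have h := congrArg (fun P => coeff P (D + n)) (pl_mul_vecMul M c₀ p j)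
    simp only [finsetSum_coeff] at h
    rw [coeff_mul_add_eq_of_natDegree_le (hD c₀) (hp j).1, hQ, (hp j).2] at h
    have h' : ∀ k, (Matrix.vecMul p M (c₀ k) * pl M (Function.update c₀ k j)).coeff (D + n) =
        f (c₀ k) * Q (Function.update c₀ k j) := by
      intro k
      rw [add_comm D n, coeff_mul_add_eq_of_natDegree_le (hp (c₀ k)).1 (hD _), hQ, (hp _).2]
    simp only [h'] at h
    simp only [Matrix.vecMul, dotProduct, replaceRows, Matrix.of_apply, mul_assoc,
      ← Finset.mul_sum]
    rw [← h, inv_mul_cancel_left₀ hc]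
  · rintro ⟨p, hp⟩
    -- The rows of the adjugate times M have minors as entries, so their coefficients of degree D
    -- are the rows of `replaceRows Q c₀`.
    refine ⟨D, Matrix.vecMul (fun k => C (p k)) (M.submatrix id c₀).adjugate, fun j => ?_⟩
    rw [vecMul_adjugate]
    constructor
    · exact natDegree_sum_le_of_forall_le _ _ fun k _ => (natDegree_C_mul_le _ _).trans (hD _)
    · rw [hp j]
      simp only [finsetSum_coeff, coeff_C_mul, hQ]
      rfl

/-- Read with T the identity, the preceding estimate says that the frame of the limit has Plücker
vector proportional to Q. -/
theorem pl_replaceRows {K : Type*} [Field K] [Finite κ] {M : Matrix ι κ K[X]} {D : ℕ}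
    {Q : (ι → κ) → K} {c₀ : ι → κ} (hD : ∀ c, (pl M c).natDegree ≤ D)
    (hQ : ∀ c, (pl M c).coeff D = Q c) (hc : Q c₀ ≠ 0) (c : ι → κ) :
    pl (replaceRows Q c₀) c = Q c₀ ^ (Fintype.card ι - 1) * Q c := by
  classical
  have := Fintype.ofFinite κ
  have h := (natDegree_pl_mul_le hD hQ hc (1 : Matrix κ κ K) c).2
  rw [Matrix.map_one _ (map_zero _) (map_one _), Matrix.mul_one, Matrix.mul_one, hQ] at h
  exact h.symm

end Leading

/-! ### Plücker vectors of ideals and of flat limits. -/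

section PluckerVectors

open MvPowerSeries

variable {K : Type*} [Field K] {I : Ideal (PS K)}

theorem minor_eq_pl {A : Type*} [CommRing A] (f : Row I → PS A) (c : Coord I) :
    minor I f c = pl (cmat (colength I) f) c := rfl

theorem isPluckerVector_iff {J : Ideal (PS K)} {P : Coord I → K} :
    IsPluckerVector I J P ↔ P ≠ 0 ∧ ∃ f : Row I → PS K, IsFrame (colength I) J f ∧
      ∀ c, P c = pl (cmat (colength I) f) c := by
  simp only [IsPluckerVector, IsFrame, funext_iff (f := P), minor_eq_pl]

/-- An ideal is determined by its Plücker coordinates up to a factor. -/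
theorem IsPluckerVector.eq_of_proportional {J J' : Ideal (PS K)} {P P' : Coord I → K} {μ : K}
    (h : IsPluckerVector I J P) (h' : IsPluckerVector I J' P') (hμ : ∀ c, P' c = μ * P c) :
    J = J' := by
  rw [isPluckerVector_iff] at h h'
  obtain ⟨h0, f, hf, hP⟩ := h
  obtain ⟨h0', f', hf', hP'⟩ := h'
  obtain ⟨c, hc⟩ := Function.ne_iff.1 h0
  have hμ0 : μ ≠ 0 := by
    rintro rfl
    exact h0' (funext fun c => by rw [hμ, zero_mul]; rfl)
  ext F
  rw [isFrame_iff.1 hf, isFrame_iff.1 hf']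
  refine exists_vecMul_congr (c := c) (μ := μ) ?_ hμ0 (fun c => ?_) (fun j => coeff j.1 F)
  · rw [← hP]; exact hc
  · rw [← hP, ← hP', hμ]

/-- A power series with prescribed coefficients in low degrees. -/
theorem exists_cmat_eq {d : ℕ} {ι : Type*} (v : Matrix ι (LowExp d) K) :
    ∃ g : ι → PS K, cmat d g = v := by
  classical
  refine ⟨fun i e => if h : e.degree < d then v i ⟨e, h⟩ else 0, ?_⟩
  ext i j
  change (if h : j.1.degree < d then v i ⟨j.1, h⟩ else 0) = _
  rw [dif_pos j.2]

/-- A frame of a flat limit. -/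
theorem isFrame_flatLimit {ι : Type*} [Fintype ι] [DecidableEq ι] {d : ℕ} {J : Ideal (PS K)}
    {f : ι → PS K} (hf : IsFrame d J f) {s : Fin 2 → PS (Polynomial K)} (hs : IsCoordinates s)
    {D : ℕ} {Q : (ι → LowExp d) → K} {c₀ : ι → LowExp d}
    (hD : ∀ c, (pl ((cmat d f).map (algebraMap K (Polynomial K)) * tmat d s) c).natDegree ≤ D)
    (hQ : ∀ c, (pl ((cmat d f).map (algebraMap K (Polynomial K)) * tmat d s) c).coeff D = Q c)
    (hc : Q c₀ ≠ 0) {g : ι → PS K} (hg : cmat d g = replaceRows Q c₀) :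
    IsFrame d (flatLimit (moved s J)) g := by
  classical
  rw [isFrame_iff]
  intro F
  rw [hg, ← exists_leading_iff hD hQ hc (fun j : LowExp d => coeff j.1 F)]
  constructor
  · rintro ⟨n, G, hG, hn⟩
    obtain ⟨p, hp⟩ := (mem_moved_iff hf hs G).1 hG
    exact ⟨n, p, fun j => by rw [← hp j]; exact hn j.1⟩
  · rintro ⟨n, p, hp⟩
    -- Coefficients in degree at least d are unrestricted in `moved s J`, so there G can simply be
    -- given the leading coefficients required by F.
    let G : PS (Polynomial K) := fun e => if h : e.degree < d then
      Matrix.vecMul p ((cmat d f).map (algebraMap K (Polynomial K)) * tmat d s) ⟨e, h⟩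
      else Polynomial.C (coeff e F) * Polynomial.X ^ n
    have hGlow : ∀ j : LowExp d, coeff j.1 G =
        Matrix.vecMul p ((cmat d f).map (algebraMap K (Polynomial K)) * tmat d s) j := by
      intro j
      change (if h : j.1.degree < d then _ else _) = _
      rw [dif_pos j.2]
    refine ⟨n, G, (mem_moved_iff hf hs G).2 ⟨p, hGlow⟩, fun e => ?_⟩
    by_cases he : e.degree < d
    · rw [hGlow ⟨e, he⟩]; exact hp ⟨e, he⟩
    · have : coeff e G = Polynomial.C (coeff e F) * Polynomial.X ^ n := by
        change (if h : e.degree < d then _ else _) = _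
        rw [dif_neg he]
      rw [this]
      exact ⟨Polynomial.natDegree_C_mul_X_pow_le _ _, by simp⟩

end PluckerVectors

end ToricHilb

namespace ToricHilb

open MvPowerSeries

/-! ### Exponents of monomials in x and y. -/

section Exponents

/-- The exponent of `x ^ p * y ^ q`. -/
noncomputable def ee (p q : ℕ) : Fin 2 →₀ ℕ := Finsupp.single 0 p + Finsupp.single 1 q

@[simp] theorem ee_zero (p q : ℕ) : ee p q 0 = p := by simp [ee]

@[simp] theorem ee_one (p q : ℕ) : ee p q 1 = q := by simp [ee]

theorem ee_self (e : Fin 2 →₀ ℕ) : ee (e 0) (e 1) = e := by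
  ext i; fin_cases i <;> simp

theorem ee_inj {p q p' q' : ℕ} : ee p q = ee p' q' ↔ p = p' ∧ q = q' := by
  constructor
  · intro h
    exact ⟨by simpa using DFunLike.congr_fun h 0, by simpa using DFunLike.congr_fun h 1⟩
  · rintro ⟨rfl, rfl⟩; rfl

theorem degree_ee (e : Fin 2 →₀ ℕ) : e.degree = e 0 + e 1 := by simp [Finsupp.degree_eq_sum]

theorem monomial_ee {A : Type*} [CommRing A] (p q : ℕ) (c : A) :
    monomial (ee p q) c = C c * (X 0 ^ p * X 1 ^ q : PS A) := by
  rw [X_pow_eq, X_pow_eq, monomial_mul_monomial, one_mul, ← monomial_zero_eq_C_apply,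
    monomial_mul_monomial, mul_one, zero_add]
  rfl

end Exponents

/-! ### Sets of exponents stable under shears. -/

section StaircaseIdeal

variable {S : Set (Fin 2 →₀ ℕ)}

/-- The power series all of whose exponents lie in the upper set `S`. -/
noncomputable def staircaseIdeal (A : Type*) [CommRing A] (hS : IsUpperSet S) : Ideal (PS A) where
  carrier := {F | ∀ e ∉ S, coeff e F = 0}
  zero_mem' := fun e _ => by simp
  add_mem' := fun ha hb e he => by rw [map_add, ha e he, hb e he, add_zero]
  smul_mem' := by
    classical
    intro a F hF e he
    rw [smul_eq_mul, coeff_mul]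
    refine Finset.sum_eq_zero fun x hx => ?_
    rw [hF, mul_zero]
    intro hx2
    refine he (hS ?_ hx2)
    rw [← Finset.HasAntidiagonal.mem_antidiagonal.1 hx]
    exact le_add_self

variable {A : Type*} [CommRing A] {hS : IsUpperSet S}

theorem monomial_mem_staircaseIdeal {e : Fin 2 →₀ ℕ} (he : e ∈ S) (c : A) :
    monomial e c ∈ staircaseIdeal A hS := by
  classical
  intro e' he'
  rw [coeff_monomial, if_neg]
  rintro rfl
  exact he' he

theorem X_pow_mul_mem_staircaseIdeal {p q : ℕ} (he : ee p q ∈ S) :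
    (X 0 ^ p * X 1 ^ q : PS A) ∈ staircaseIdeal A hS := by
  have := monomial_mem_staircaseIdeal (hS := hS) he (1 : A)
  rwa [monomial_ee, map_one, one_mul] at this

theorem subst_mem_staircaseIdeal {R : Type*} [CommRing R] [Algebra R A] {s : Fin 2 → PS A}
    (hs : ∀ i, constantCoeff (s i) = 0) (h : ∀ e ∈ S, powProd s e ∈ staircaseIdeal A hS) {F : PS R}
    (hF : F ∈ staircaseIdeal R hS) : subst s F ∈ staircaseIdeal A hS := by
  intro e he
  rw [coeff_subst_low hs F (⟨e, Nat.lt_succ_self _⟩ : LowExp (e.degree + 1))]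
  refine Finset.sum_eq_zero fun e' _ => ?_
  by_cases h' : e'.1 ∈ S
  · rw [h e'.1 h' e he, mul_zero]
  · rw [hF _ h', map_zero, zero_mul]

/-- In characteristic that of `K`, the set `S` is stable under `x ↦ x + y ^ r`. -/
def StabX (K : Type*) [Field K] (S : Set (Fin 2 →₀ ℕ)) (r : ℕ) : Prop :=
  ∀ p q k, ee p q ∈ S → k ≤ p → (p.choose k : K) ≠ 0 → ee (p - k) (q + r * k) ∈ S

/-- In characteristic that of `K`, the set `S` is stable under `y ↦ y + x ^ s`. -/
def StabY (K : Type*) [Field K] (S : Set (Fin 2 →₀ ℕ)) (s : ℕ) : Prop :=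
  ∀ p q l, ee p q ∈ S → l ≤ q → (q.choose l : K) ≠ 0 → ee (p + s * l) (q - l) ∈ S

/-- The set `S` is stable under both kinds of shears at once. -/
def StabXY (K : Type*) [Field K] (S : Set (Fin 2 →₀ ℕ)) (r s : ℕ) : Prop :=
  ∀ p q k l, ee p q ∈ S → k ≤ p → l ≤ q → (p.choose k : K) ≠ 0 → (q.choose l : K) ≠ 0 →
    ee (p - k + s * l) (q - l + r * k) ∈ S

/-- A larger r only increases the resulting exponent of y, and S is an upper set. -/
theorem StabX.succ (hS : IsUpperSet S) {K : Type*} [Field K] {r : ℕ} (h : StabX K S r) :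
    StabX K S (r + 1) := by
  intro p q k hpq hk hne
  refine hS ?_ (h p q k hpq hk hne)
  intro i
  fin_cases i
  · simp
  · simp [add_mul]

theorem stabX_iff_of_algebra {K L : Type*} [Field K] [Field L] [Algebra K L] {r : ℕ} :
    StabX L S r ↔ StabX K S r := by
  have h : ∀ n : ℕ, (n : L) ≠ 0 ↔ (n : K) ≠ 0 := fun n => by
    rw [← map_natCast (algebraMap K L), Ne, _root_.map_eq_zero]
  simp only [StabX, h]

theorem stabY_iff_of_algebra {K L : Type*} [Field K] [Field L] [Algebra K L] {r : ℕ} :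
    StabY L S r ↔ StabY K S r := by
  have h : ∀ n : ℕ, (n : L) ≠ 0 ↔ (n : K) ≠ 0 := fun n => by
    rw [← map_natCast (algebraMap K L), Ne, _root_.map_eq_zero]
  simp only [StabY, h]

variable {K : Type*} [Field K] [Algebra K A]

theorem natCast_eq_zero_of_algebra {n : ℕ} (h : (n : K) = 0) : (n : PS A) = 0 := by
  rw [← map_natCast (C : A →+* PS A), ← map_natCast (algebraMap K A), h, map_zero, map_zero]

/-- After binomial expansion each term either has a binomial coefficient that vanishes in K, hence
in A, or is a multiple of a monomial that stability puts in S. -/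
theorem StabXY.mem {r s : ℕ} (h : StabXY K S r s) (F G P Q : PS A) {p q : ℕ} (hpq : ee p q ∈ S) :
    (X 0 * F + X 1 ^ r * G) ^ p * (X 1 * P + X 0 ^ s * Q) ^ q ∈ staircaseIdeal A hS := by
  rw [add_comm (X 0 * F), add_comm (X 1 * P), add_pow, add_pow, Finset.sum_mul_sum]
  refine sum_mem fun k hk => sum_mem fun l hl => ?_
  rw [Finset.mem_range, Nat.lt_succ_iff] at hk hl
  by_cases h1 : (p.choose k : K) = 0
  · rw [natCast_eq_zero_of_algebra h1]; simp
  by_cases h2 : (q.choose l : K) = 0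
  · rw [natCast_eq_zero_of_algebra h2]; simp
  have := X_pow_mul_mem_staircaseIdeal (A := A) (hS := hS) (h p q k l hpq hk hl h1 h2)
  have := Ideal.mul_mem_left _ ((p.choose k * q.choose l : PS A) * F ^ (p - k) * G ^ k *
    P ^ (q - l) * Q ^ l) this
  convert this using 1
  simp only [mul_pow, pow_add, pow_mul]
  ring

theorem StabX.mem {r : ℕ} (h : StabX K S r) (F G P : PS A) {p q : ℕ} (hpq : ee p q ∈ S) :
    (X 0 * F + X 1 ^ r * G) ^ p * (X 1 * P) ^ q ∈ staircaseIdeal A hS := by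
  rw [add_comm (X 0 * F), add_pow, Finset.sum_mul]
  refine sum_mem fun k hk => ?_
  rw [Finset.mem_range, Nat.lt_succ_iff] at hk
  by_cases h1 : (p.choose k : K) = 0
  · rw [natCast_eq_zero_of_algebra h1]; simp
  have := X_pow_mul_mem_staircaseIdeal (A := A) (hS := hS) (h p q k hpq hk h1)
  have := Ideal.mul_mem_left _ ((p.choose k : PS A) * F ^ (p - k) * G ^ k * P ^ q) this
  convert this using 1
  simp only [mul_pow, pow_add, pow_mul]
  ring

theorem StabY.mem {s : ℕ} (h : StabY K S s) (F P Q : PS A) {p q : ℕ} (hpq : ee p q ∈ S) :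
    (X 0 * F) ^ p * (X 1 * P + X 0 ^ s * Q) ^ q ∈ staircaseIdeal A hS := by
  rw [add_comm (X 1 * P), add_pow, Finset.mul_sum]
  refine sum_mem fun l hl => ?_
  rw [Finset.mem_range, Nat.lt_succ_iff] at hl
  by_cases h2 : (q.choose l : K) = 0
  · rw [natCast_eq_zero_of_algebra h2]; simp
  have := X_pow_mul_mem_staircaseIdeal (A := A) (hS := hS) (h p q l hpq hl h2)
  have := Ideal.mul_mem_left _ ((q.choose l : PS A) * F ^ p * P ^ (q - l) * Q ^ l) this
  convert this using 1
  simp only [mul_pow, pow_add, pow_mul]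
  ring

/-- Different pairs (k, l) give different monomials because r s ≠ 1, so no cancellation occurs and a
single term of the double binomial sum survives. -/
theorem coeff_shear {r s : ℕ} (hrs : 2 ≤ r * s) (a b : A) {p q k l : ℕ} (hk : k ≤ p) (hl : l ≤ q) :
    coeff (ee (p - k + s * l) (q - l + r * k))
      ((X 0 + C a * X 1 ^ r) ^ p * (X 1 + C b * X 0 ^ s) ^ q : PS A) =
      p.choose k * q.choose l * a ^ k * b ^ l := by
  classical
  have hterm : ((X 0 + C a * X 1 ^ r) ^ p * (X 1 + C b * X 0 ^ s) ^ q : PS A) =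
      ∑ k ∈ Finset.range (p + 1), ∑ l ∈ Finset.range (q + 1),
        monomial (ee (p - k + s * l) (q - l + r * k))
          (p.choose k * q.choose l * a ^ k * b ^ l : A) := by
    rw [add_comm (X 0), add_comm (X 1), add_pow, add_pow, Finset.sum_mul_sum]
    refine Finset.sum_congr rfl fun k _ => Finset.sum_congr rfl fun l _ => ?_
    rw [monomial_ee]
    simp only [mul_pow, pow_add, pow_mul, map_mul, map_pow, map_natCast]
    ring
  rw [hterm]
  simp only [map_sum, coeff_monomial, ee_inj]
  rw [Finset.sum_eq_single k, Finset.sum_eq_single l]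
  · simp
  · intro l' hl' hne
    rw [Finset.mem_range] at hl'
    rw [if_neg]
    rintro ⟨h1, h2⟩
    omega
  · intro h; simp at h; omega
  · intro k' hk' hne
    refine Finset.sum_eq_zero fun l' hl' => ?_
    rw [Finset.mem_range] at hk' hl'
    rw [if_neg]
    rintro ⟨h1, h2⟩
    apply hne
    have h1' : (s : ℤ) * (l - l') = k - k' := by
      have : ((p - k + s * l : ℕ) : ℤ) = (p - k' + s * l' : ℕ) := by rw [h1]
      push_cast [Nat.cast_sub hk, Nat.cast_sub (Nat.lt_succ_iff.1 hk')] at this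
      linarith
    have h2' : (r : ℤ) * (k - k') = l - l' := by
      have : ((q - l + r * k : ℕ) : ℤ) = (q - l' + r * k' : ℕ) := by rw [h2]
      push_cast [Nat.cast_sub hl, Nat.cast_sub (Nat.lt_succ_iff.1 hl')] at this
      linarith
    -- Eliminating l - l' from the two relations between exponents leaves the factor r s - 1, which
    -- is not zero.
    have h3 : ((r * s : ℕ) - 1 : ℤ) * (k - k') = 0 := by
      push_cast
      linear_combination (s : ℤ) * h2' + h1'
    rcases mul_eq_zero.1 h3 with h | h
    · omega
    · omega
  · intro h; simp at h; omega

/-- Stability under the two kinds of shears together follows from stability under each. -/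
theorem StabX.stabXY (hS : IsUpperSet S) {r s : ℕ} (hX : StabX K S r) (hY : StabY K S s)
    (hrs : 2 ≤ r * s) : StabXY K S r s := by
  intro p q k l hpq hk hl hpk hql
  have hr : r ≠ 0 := by rintro rfl; simp at hrs
  have hs : s ≠ 0 := by rintro rfl; simp at hrs
  let ψ : Fin 2 → PS K := ![X 0 + X 1 ^ r, X 1]
  have hψ : ∀ i, constantCoeff (ψ i) = 0 := by
    intro i; fin_cases i <;> simp [ψ, hr]
  have hψS := hasSubst_of_zero hψ
  -- χ is chosen so that following it by ψ gives the simultaneous shear x ↦ x + y^r, y ↦ y + x^s.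
  -- Since (x - y^r)^s differs from x^s by a multiple of y, χ maps monomials of S into the ideal by
  -- `StabY` alone.
  let χ : Fin 2 → PS K := ![X 0, X 1 + (X 0 - X 1 ^ r) ^ s]
  have hcomp : (fun i => subst ψ (χ i)) = ![X 0 + X 1 ^ r, X 1 + X 0 ^ s] := by
    funext i
    fin_cases i
    · simp [χ, ψ, subst_X hψS]
    · simp only [χ, Fin.mk_one, Matrix.cons_val_one, Matrix.cons_val_fin_one]
      rw [subst_add hψS, subst_pow hψS, subst_sub hψS, subst_pow hψS, subst_X hψS, subst_X hψS]
      simp [ψ]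
  have hχ : powProd χ (ee p q) ∈ staircaseIdeal K hS := by
    obtain ⟨w, hw⟩ := sub_dvd_pow_sub_pow (X 0 - X 1 ^ r : PS K) (X 0) s
    obtain ⟨r', rfl⟩ := Nat.exists_eq_succ_of_ne_zero hr
    have := hY.mem (A := K) (hS := hS) 1 (1 - X 1 ^ r' * w) 1 hpq
    convert this using 1
    simp only [powProd, χ, ee_zero, ee_one, Matrix.cons_val_zero, Matrix.cons_val_one,
      Matrix.cons_val_fin_one, mul_one]
    congr 2
    rw [Nat.succ_eq_add_one, pow_succ] at hw ⊢
    linear_combination hw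
  have hψm : ∀ e ∈ S, powProd ψ e ∈ staircaseIdeal K hS := by
    intro e he
    have := hX.mem (A := K) (hS := hS) 1 1 1 (p := e 0) (q := e 1) (by rwa [ee_self])
    simpa [powProd, ψ] using this
  have hmem := subst_mem_staircaseIdeal hψ hψm hχ
  rw [subst_powProd hψ, hcomp] at hmem
  by_contra hnot
  have h0 := hmem _ hnot
  -- If the exponent were outside S, the coefficient there would be 0, whereas it is the product of
  -- the two nonzero binomial coefficients.
  have h1 := coeff_shear hrs (1 : K) 1 hk hl
  simp only [powProd, ee_zero, ee_one, Matrix.cons_val_zero, Matrix.cons_val_one,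
    Matrix.cons_val_fin_one] at h0
  simp only [map_one, one_mul, one_pow, mul_one] at h1
  rw [h0] at h1
  exact mul_ne_zero hpk hql h1.symm

end StaircaseIdeal

/-! ### Monomial ideals of finite colength. -/

section StaircaseIdeals

variable {K : Type*} [Field K]

/-- The exponents of the monomials in an ideal. -/
def expSet (I : Ideal (PS K)) : Set (Fin 2 →₀ ℕ) := {e | monomial e (1 : K) ∈ I}

theorem mem_expSet {I : Ideal (PS K)} {e : Fin 2 →₀ ℕ} :
    e ∈ expSet I ↔ monomial e (1 : K) ∈ I := Iff.rfl

theorem isUpperSet_expSet (I : Ideal (PS K)) : IsUpperSet (expSet I) := by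
  intro e e' h he
  have : monomial e' (1 : K) = monomial (e' - e) (1 : K) * monomial e (1 : K) := by
    rw [monomial_mul_monomial, one_mul, tsub_add_cancel_of_le h]
  rw [mem_expSet, this]
  exact I.mul_mem_left _ he

/-- A monomial ideal of finite colength. -/
structure IsStaircase (I : Ideal (PS K)) : Prop where
  eq : I = staircaseIdeal K (isUpperSet_expSet I)
  finite : (expSet I)ᶜ.Finite

theorem originIdeal_pow_le {I : Ideal (PS K)} {d : ℕ}
    (h : ∀ e : Fin 2 →₀ ℕ, e.degree = d → e ∈ expSet I) : originIdeal K ^ d ≤ I :=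
  span_pair_pow_le (s := X) fun e he => by rw [powProd_X]; exact h e he

theorem mem_of_low {I : Ideal (PS K)} {d : ℕ} (h : originIdeal K ^ d ≤ I) {F : PS K}
    (hF : ∀ e ∉ expSet I, coeff e F = 0) : F ∈ I := by
  classical
  have hfin : {e : Fin 2 →₀ ℕ | e.degree < d}.Finite := Finsupp.finite_of_degree_lt (σ := Fin 2) d
  have hlow : ∑ e ∈ hfin.toFinset, monomial e (coeff e F) ∈ I := by
    refine sum_mem fun e _ => ?_
    by_cases he : e ∈ expSet I
    · have : monomial e (coeff e F) = C (coeff e F) * monomial e (1 : K) := by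
        rw [← monomial_zero_eq_C_apply, monomial_mul_monomial, zero_add, mul_one]
      rw [this]
      exact I.mul_mem_left _ he
    · rw [hF e he, map_zero]; exact I.zero_mem
  have hhigh : F - ∑ e ∈ hfin.toFinset, monomial e (coeff e F) ∈ I := by
    refine h (mem_originIdeal_pow_iff.2 fun e he => ?_)
    rw [map_sub, map_sum, Finset.sum_eq_single e]
    · rw [coeff_monomial_same, sub_self]
    · intro e' _ hne
      rw [coeff_monomial, if_neg hne.symm]
    · intro h; simp [he] at h
  have := add_mem hlow hhigh
  rwa [add_sub_cancel] at this

theorem exists_originIdeal_pow_le {I : Ideal (PS K)} (h : (expSet I)ᶜ.Finite) :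
    ∃ d, originIdeal K ^ d ≤ I := by
  obtain ⟨d, hd⟩ := (h.image Finsupp.degree).bddAbove
  refine ⟨d + 1, originIdeal_pow_le fun e he => ?_⟩
  by_contra h'
  have := hd ⟨e, h', rfl⟩
  omega

theorem linearIndependent_of_le {I : Ideal (PS K)}
    (h : I ≤ staircaseIdeal K (isUpperSet_expSet I)) :
    LinearIndependent K
      (fun e : ((expSet I)ᶜ : Set (Fin 2 →₀ ℕ)) => Ideal.Quotient.mk I (monomial e.1 (1 : K))) := by
  classical
  rw [linearIndependent_iff']
  intro s g hg i hi
  have h1 : Ideal.Quotient.mk I (∑ e ∈ s, g e • monomial e.1 (1 : K)) = 0 := by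
    rw [map_sum, ← hg]
    rfl
  rw [Ideal.Quotient.eq_zero_iff_mem] at h1
  have h2 := h h1 i.1 i.2
  rw [map_sum, Finset.sum_eq_single i] at h2
  · simpa using h2
  · intro e _ hne
    simp only [map_smul, coeff_monomial]
    rw [if_neg (fun h => hne (Subtype.ext h.symm)), smul_zero]
  · intro h; exact absurd hi h

theorem isStaircase_of_le {I : Ideal (PS K)} (h : I ≤ staircaseIdeal K (isUpperSet_expSet I))
    (hfin : (expSet I)ᶜ.Finite) : IsStaircase I := by
  obtain ⟨d, hd⟩ := exists_originIdeal_pow_le hfin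
  exact ⟨le_antisymm h fun F hF => mem_of_low hd hF, hfin⟩

/-- The monomials outside I are independent modulo I, so finite colength leaves finitely many of
them. Hence I contains a power of (x, y), and membership can be tested coefficientwise on a finite
set. -/
theorem isStaircase_of_isMonomialIdeal {I : Ideal (PS K)} (hmon : IsMonomialIdeal I)
    (hfin : Module.Finite K (PS K ⧸ I)) : IsStaircase I := by
  have hle : I ≤ staircaseIdeal K (isUpperSet_expSet I) := by
    obtain ⟨T, hT⟩ := hmon
    conv_lhs => rw [hT]
    rw [Ideal.span_le]
    rintro _ ⟨e, he, rfl⟩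
    apply monomial_mem_staircaseIdeal
    rw [mem_expSet, hT]
    exact Ideal.subset_span ⟨e, he, rfl⟩
  have := (linearIndependent_of_le hle).finite
  exact isStaircase_of_le hle (Set.toFinite _)


theorem IsStaircase.mem_iff {I : Ideal (PS K)} (hI : IsStaircase I) {F : PS K} :
    F ∈ I ↔ ∀ e ∉ expSet I, coeff e F = 0 := by
  conv_lhs => rw [hI.eq]
  rfl

theorem IsStaircase.eq_span {I : Ideal (PS K)} (hI : IsStaircase I) :
    I = Ideal.span ((fun e => monomial e (1 : K)) '' expSet I) := by
  set I' := Ideal.span ((fun e => monomial e (1 : K)) '' expSet I) with hI'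
  have hle : I' ≤ I := by
    rw [hI', Ideal.span_le]
    rintro _ ⟨e, he, rfl⟩
    exact he
  have hexp : expSet I' = expSet I :=
    Set.Subset.antisymm (fun e he => hle he) fun e he => Ideal.subset_span ⟨e, he, rfl⟩
  obtain ⟨d, hd⟩ := exists_originIdeal_pow_le (I := I') (by rw [hexp]; exact hI.finite)
  refine le_antisymm (fun F hF => mem_of_low hd ?_) hle
  rw [hexp]
  exact hI.mem_iff.1 hF

theorem IsStaircase.colength_eq {I : Ideal (PS K)} (hI : IsStaircase I) :
    colength I = (expSet I)ᶜ.ncard := by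
  classical
  have hli := linearIndependent_of_le hI.eq.le
  have hfin := hI.finite.fintype
  obtain ⟨d, hd⟩ := exists_originIdeal_pow_le hI.finite
  have hsp : ⊤ ≤ Submodule.span K (Set.range
      (fun e : ((expSet I)ᶜ : Set (Fin 2 →₀ ℕ)) =>
        Ideal.Quotient.mk I (monomial e.1 (1 : K)))) := by
    intro G _
    obtain ⟨F, rfl⟩ := Ideal.Quotient.mk_surjective G
    rw [Submodule.mem_span_range_iff_exists_fun]
    refine ⟨fun e => coeff e.1 F, ?_⟩
    have : ∑ e : ((expSet I)ᶜ : Set (Fin 2 →₀ ℕ)), coeff e.1 F • monomial e.1 (1 : K) - F ∈ I := by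
      rw [hI.mem_iff]
      intro e he
      rw [map_sub, map_sum, Finset.sum_eq_single ⟨e, he⟩]
      · simp
      · intro e' _ hne
        simp only [map_smul, coeff_monomial]
        rw [if_neg (fun h => hne (Subtype.ext h.symm)), smul_zero]
      · intro h; simp at h
    rw [← Ideal.Quotient.mk_eq_mk_iff_sub_mem, map_sum] at this
    rw [← this]
    rfl
  rw [colength, Module.finrank_eq_card_basis (Module.Basis.mk hli hsp),
    ← Set.toFinset_card, Set.ncard_eq_toFinset_card']

/-- If e is outside I, so is the whole box of exponents below e, which has (e 0 + 1)(e 1 + 1) ≥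
e.degree + 1 elements; the colength counts at least these. Thus (x, y)^d ⊆ I for d the colength. -/
theorem IsStaircase.degree_lt {I : Ideal (PS K)} (hI : IsStaircase I) {e : Fin 2 →₀ ℕ}
    (he : e ∉ expSet I) : e.degree < colength I := by
  classical
  rw [hI.colength_eq]
  let T : Finset (Fin 2 →₀ ℕ) := (Finset.range (e 0 + 1) ×ˢ Finset.range (e 1 + 1)).image
    fun x => ee x.1 x.2
  have hT : (T : Set (Fin 2 →₀ ℕ)) ⊆ (expSet I)ᶜ := by
    intro e' he' h
    simp only [T, Finset.coe_image, Set.mem_image, Finset.mem_coe, Finset.mem_product,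
      Finset.mem_range] at he'
    obtain ⟨x, hx, rfl⟩ := he'
    refine he (isUpperSet_expSet I ?_ h)
    intro i
    fin_cases i
    · simp; omega
    · simp; omega
  have hcard : T.card = (e 0 + 1) * (e 1 + 1) := by
    rw [Finset.card_image_of_injective, Finset.card_product, Finset.card_range, Finset.card_range]
    rintro ⟨a, b⟩ ⟨a', b'⟩ h
    obtain ⟨rfl, rfl⟩ := ee_inj.1 h
    rfl
  have := Set.ncard_le_ncard hT hI.finite
  rw [Set.ncard_coe_finset, hcard] at this
  rw [degree_ee]
  nlinarith

/-- The monomials in `I` of low degree. -/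
noncomputable def rowFrame (I : Ideal (PS K)) (i : Row I) : PS K := monomial i.1.1 1

open Classical in
theorem vecMul_rowFrame (I : Ideal (PS K)) (p : Row I → K) (j : LowExp (colength I)) :
    Matrix.vecMul p (cmat (colength I) (rowFrame I)) j =
      if h : j.1 ∈ expSet I then p ⟨j, h⟩ else 0 := by
  classical
  simp only [Matrix.vecMul, dotProduct, cmat, rowFrame, Matrix.of_apply, coeff_monomial]
  split_ifs with h
  · rw [Finset.sum_eq_single ⟨j, h⟩]
    · simp
    · intro i _ hne
      rw [if_neg (fun h' => hne (Subtype.ext (Subtype.ext h'.symm))), mul_zero]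
    · intro h; simp at h
  · refine Finset.sum_eq_zero fun i _ => ?_
    rw [if_neg, mul_zero]
    intro h'
    apply h
    rw [h']
    exact i.2

theorem IsStaircase.isFrame {I : Ideal (PS K)} (hI : IsStaircase I) :
    IsFrame (colength I) I (rowFrame I) := by
  rw [isFrame_iff]
  intro F
  rw [hI.mem_iff]
  constructor
  · intro h
    refine ⟨fun i => coeff i.1.1 F, fun j => ?_⟩
    rw [vecMul_rowFrame]
    split_ifs with hj
    · rfl
    · exact h _ hj
  · rintro ⟨p, hp⟩ e he
    have := hp ⟨e, hI.degree_lt he⟩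
    rw [vecMul_rowFrame, dif_neg he] at this
    exact this

section Extension

variable {L : Type*} [Field L] [Algebra K L]

theorem extend_le {I : Ideal (PS K)} (hI : IsStaircase I) :
    extend L I ≤ staircaseIdeal L (isUpperSet_expSet I) := by
  rw [extend, Ideal.map_le_iff_le_comap]
  intro F hF e he
  rw [coeff_map, hI.mem_iff.1 hF e he, map_zero]

theorem expSet_extend {I : Ideal (PS K)} (hI : IsStaircase I) :
    expSet (extend L I) = expSet I := by
  ext e
  constructor
  · intro he
    by_contra h
    have := extend_le hI he e h
    rw [coeff_monomial_same] at this
    exact one_ne_zero this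
  · intro he
    have := Ideal.mem_map_of_mem (MvPowerSeries.map (σ := Fin 2) (algebraMap K L)) he
    rwa [map_monomial, map_one] at this

theorem IsStaircase.extend {I : Ideal (PS K)} (hI : IsStaircase I) :
    IsStaircase (extend L I) := by
  refine isStaircase_of_le ?_ (by rw [expSet_extend hI]; exact hI.finite)
  intro F hF e he
  rw [expSet_extend hI] at he
  exact extend_le hI hF e he

theorem colength_extend {I : Ideal (PS K)} (hI : IsStaircase I) :
    colength (ToricHilb.extend L I) = colength I := by
  rw [hI.extend.colength_eq, hI.colength_eq, expSet_extend hI]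

end Extension

/-! ### From measuring sequences to stability under shears. -/

section Automorphisms

/-- The endomorphism induced on the finite-dimensional quotient is surjective, hence injective,
which gives the reverse inclusion. -/
theorem map_eq_of_map_le {I : Ideal (PS K)} (hfin : Module.Finite K (PS K ⧸ I))
    (φ : PS K ≃ₐ[K] PS K) (h : I.map φ ≤ I) : I.map φ = I := by
  refine le_antisymm h fun F hF => ?_
  have hle : I ≤ I.comap (φ : PS K →ₐ[K] PS K) := by
    intro G hG
    exact h (Ideal.mem_map_of_mem _ hG)
  let f : (PS K ⧸ I) →ₐ[K] (PS K ⧸ I) := Ideal.quotientMapₐ I (φ : PS K →ₐ[K] PS K) hle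
  have hsurj : Function.Surjective f := by
    intro y
    obtain ⟨G, rfl⟩ := Ideal.Quotient.mk_surjective y
    refine ⟨Ideal.Quotient.mk I (φ.symm G), ?_⟩
    change Ideal.Quotient.mk I (φ (φ.symm G)) = _
    rw [φ.apply_symm_apply]
  have hinj : Function.Injective f := (LinearMap.injective_iff_surjective (f := f.toLinearMap)).2 hsurj
  have h0 : f (Ideal.Quotient.mk I (φ.symm F)) = 0 := by
    change Ideal.Quotient.mk I (φ (φ.symm F)) = _
    rw [φ.apply_symm_apply, Ideal.Quotient.eq_zero_iff_mem]
    exact hF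
  have h1 : Ideal.Quotient.mk I (φ.symm F) = 0 := hinj (by rw [h0, map_zero])
  rw [Ideal.Quotient.eq_zero_iff_mem] at h1
  have := Ideal.mem_map_of_mem φ h1
  rwa [φ.apply_symm_apply] at this

theorem IsStaircase.finite_quotient {I : Ideal (PS K)} (hI : IsStaircase I) :
    Module.Finite K (PS K ⧸ I) := by
  by_cases h : (expSet I)ᶜ = ∅
  · have : I = ⊤ := by
      rw [Ideal.eq_top_iff_one, hI.mem_iff]
      intro e he
      have : e ∈ (expSet I)ᶜ := he
      rw [h] at this
      exact this.elim
    subst this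
    exact inferInstance
  · apply Module.finite_of_finrank_pos
    change 0 < colength I
    rw [hI.colength_eq, Set.ncard_pos hI.finite]
    exact Set.nonempty_iff_ne_empty.2 h

/-- An automorphism maps a monomial ideal into itself if it maps its monomials into it. -/
theorem IsStaircase.map_eq {I : Ideal (PS K)} (hI : IsStaircase I) (φ : PS K ≃ₐ[K] PS K)
    (h : ∀ e ∈ expSet I, φ (X 0) ^ e 0 * φ (X 1) ^ e 1 ∈ I) : I.map φ = I := by
  refine map_eq_of_map_le hI.finite_quotient φ ?_
  rw [Ideal.map_le_iff_le_comap]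
  conv_lhs => rw [hI.eq_span]
  rw [Ideal.span_le]
  rintro _ ⟨e, he, rfl⟩
  have := h e he
  rw [← map_pow, ← map_pow, ← map_mul] at this
  change φ (monomial e (1 : K)) ∈ I
  rw [← powProd_X]
  exact this

/-- The automorphism given by a pair of mutually inverse substitutions. -/
noncomputable def substEquiv {A : Type*} [CommRing A] (s t : Fin 2 → PS A)
    (hs : ∀ i, constantCoeff (s i) = 0)
    (ht : ∀ i, constantCoeff (t i) = 0) (hst : ∀ i, subst s (t i) = X i)
    (hts : ∀ i, subst t (s i) = X i) : PS A ≃ₐ[A] PS A :=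
  AlgEquiv.ofAlgHom (substAlgHom (hasSubst_of_zero hs)) (substAlgHom (hasSubst_of_zero ht))
    (by
      refine AlgHom.ext fun F => ?_
      rw [AlgHom.comp_apply, substAlgHom_apply, substAlgHom_apply,
        subst_comp_subst_apply (hasSubst_of_zero ht) (hasSubst_of_zero hs), funext hst, subst_self]
      rfl)
    (by
      refine AlgHom.ext fun F => ?_
      rw [AlgHom.comp_apply, substAlgHom_apply, substAlgHom_apply,
        subst_comp_subst_apply (hasSubst_of_zero hs) (hasSubst_of_zero ht), funext hts, subst_self]
      rfl)

theorem substEquiv_apply {A : Type*} [CommRing A] (s t : Fin 2 → PS A) (hs) (ht) (hst) (hts)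
    (F : PS A) : substEquiv s t hs ht hst hts F = subst s F :=
  substAlgHom_apply (hasSubst_of_zero hs) _

theorem substEquiv_symm_apply {A : Type*} [CommRing A] (s t : Fin 2 → PS A) (hs) (ht) (hst) (hts)
    (F : PS A) : (substEquiv s t hs ht hst hts).symm F = subst t F :=
  substAlgHom_apply (hasSubst_of_zero ht) _

/-- `x ↦ x + P`, `y ↦ y` with `P` a polynomial in `y` without constant term. -/
noncomputable def shearX {A : Type*} [CommRing A] (P : Polynomial A) : Fin 2 → PS A :=
  ![X 0 + X 1 * Polynomial.aeval (X 1) P, X 1]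

/-- `x ↦ x`, `y ↦ y + P` with `P` a polynomial in `x` without constant term. -/
noncomputable def shearY {A : Type*} [CommRing A] (P : Polynomial A) : Fin 2 → PS A :=
  ![X 0, X 1 + X 0 * Polynomial.aeval (X 0) P]

theorem constantCoeff_shearX {A : Type*} [CommRing A] (P : Polynomial A) (i : Fin 2) :
    constantCoeff (shearX P i) = 0 := by
  fin_cases i <;> simp [shearX]

theorem constantCoeff_shearY {A : Type*} [CommRing A] (P : Polynomial A) (i : Fin 2) :
    constantCoeff (shearY P i) = 0 := by
  fin_cases i <;> simp [shearY]

theorem subst_aeval {A : Type*} [CommRing A] {s : Fin 2 → PS A}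
    (hs : ∀ i, constantCoeff (s i) = 0) (P : Polynomial A) (F : PS A) :
    subst s (Polynomial.aeval F P) = Polynomial.aeval (subst s F) P := by
  rw [← substAlgHom_apply (hasSubst_of_zero hs), ← substAlgHom_apply (hasSubst_of_zero hs),
    Polynomial.aeval_algHom_apply]

theorem subst_shearX {A : Type*} [CommRing A] (P Q : Polynomial A) (i : Fin 2) :
    subst (shearX P) (shearX Q i) = shearX (P + Q) i := by
  have h0 := constantCoeff_shearX P
  have hS := hasSubst_of_zero h0
  fin_cases i
  · change subst (shearX P) (X 0 + X 1 * Polynomial.aeval (X 1) Q) = _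
    rw [subst_add hS, subst_mul hS, subst_aeval h0, subst_X hS, subst_X hS]
    simp only [shearX, Matrix.cons_val_zero, Matrix.cons_val_one, Matrix.cons_val_fin_one, map_add,
      Fin.zero_eta]
    ring
  · change subst (shearX P) (X 1) = _
    rw [subst_X hS]
    rfl

theorem subst_shearY {A : Type*} [CommRing A] (P Q : Polynomial A) (i : Fin 2) :
    subst (shearY P) (shearY Q i) = shearY (P + Q) i := by
  have h0 := constantCoeff_shearY P
  have hS := hasSubst_of_zero h0
  fin_cases i
  · change subst (shearY P) (X 0) = _
    rw [subst_X hS]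
    rfl
  · change subst (shearY P) (X 1 + X 0 * Polynomial.aeval (X 0) Q) = _
    rw [subst_add hS, subst_mul hS, subst_aeval h0, subst_X hS, subst_X hS]
    simp only [shearY, Matrix.cons_val_zero, Matrix.cons_val_one, Matrix.cons_val_fin_one, map_add,
      Fin.mk_one]
    ring

theorem shearX_zero {A : Type*} [CommRing A] (i : Fin 2) : shearX (0 : Polynomial A) i = X i := by
  fin_cases i <;> simp [shearX]

theorem shearY_zero {A : Type*} [CommRing A] (i : Fin 2) : shearY (0 : Polynomial A) i = X i := by
  fin_cases i <;> simp [shearY]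

/-- The automorphism `x ↦ x + P(y)`. -/
noncomputable def equivX (P : Polynomial K) : PS K ≃ₐ[K] PS K :=
  substEquiv (shearX P) (shearX (-P)) (constantCoeff_shearX _) (constantCoeff_shearX _)
    (fun i => by rw [subst_shearX, add_neg_cancel, shearX_zero])
    (fun i => by rw [subst_shearX, neg_add_cancel, shearX_zero])

/-- The automorphism `y ↦ y + P(x)`. -/
noncomputable def equivY (P : Polynomial K) : PS K ≃ₐ[K] PS K :=
  substEquiv (shearY P) (shearY (-P)) (constantCoeff_shearY _) (constantCoeff_shearY _)
    (fun i => by rw [subst_shearY, add_neg_cancel, shearY_zero])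
    (fun i => by rw [subst_shearY, neg_add_cancel, shearY_zero])

theorem equivX_apply (P : Polynomial K) (F : PS K) : equivX P F = subst (shearX P) F :=
  substEquiv_apply _ _ _ _ _ _ _

theorem equivY_apply (P : Polynomial K) (F : PS K) : equivY P F = subst (shearY P) F :=
  substEquiv_apply _ _ _ _ _ _ _

theorem equivX_symm (P : Polynomial K) : (equivX P).symm = equivX (-P) := by
  ext1 F
  rw [equivX_apply, equivX, substEquiv_symm_apply]

theorem equivY_symm (P : Polynomial K) : (equivY P).symm = equivY (-P) := by
  ext1 F
  rw [equivY_apply, equivY, substEquiv_symm_apply]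

theorem equivX_X_zero (P : Polynomial K) :
    equivX P (X 0) = X 0 + X 1 * Polynomial.aeval (X 1) P := by
  rw [equivX_apply, subst_X (hasSubst_of_zero (constantCoeff_shearX P))]; rfl

theorem equivX_X_one (P : Polynomial K) : equivX P (X 1) = X 1 := by
  rw [equivX_apply, subst_X (hasSubst_of_zero (constantCoeff_shearX P))]; rfl

theorem equivY_X_zero (P : Polynomial K) : equivY P (X 0) = X 0 := by
  rw [equivY_apply, subst_X (hasSubst_of_zero (constantCoeff_shearY P))]; rfl

theorem equivY_X_one (P : Polynomial K) :
    equivY P (X 1) = X 1 + X 0 * Polynomial.aeval (X 0) P := by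
  rw [equivY_apply, subst_X (hasSubst_of_zero (constantCoeff_shearY P))]; rfl

theorem fixes_of_le {φ : PS K ≃ₐ[K] PS K} {J : Ideal (PS K)} (h : J.map φ ≤ J)
    (h' : J.map φ.symm ≤ J) : Fixes φ J := by
  refine le_antisymm h fun F hF => ?_
  have := Ideal.mem_map_of_mem φ (h' (Ideal.mem_map_of_mem φ.symm hF))
  rwa [φ.apply_symm_apply] at this

theorem map_powIdeal_le {φ : PS K ≃ₐ[K] PS K} {a b : ℕ} {J : Ideal (PS K)}
    (h0 : φ (X 0) ^ a ∈ J) (h1 : φ (X 1) ^ b ∈ J) : (powIdeal K a b).map φ ≤ J := by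
  rw [powIdeal, Ideal.map_span, Ideal.span_le]
  rintro _ ⟨_, rfl | rfl, rfl⟩
  · rw [SetLike.mem_coe, map_pow]; exact h0
  · rw [SetLike.mem_coe, map_pow]; exact h1

theorem mem_powIdeal_iff {a b : ℕ} {F : PS K} :
    F ∈ powIdeal K a b ↔ ∃ P Q, F = X 0 ^ a * P + X 1 ^ b * Q := by
  rw [powIdeal, Ideal.mem_span_pair]
  constructor
  · rintro ⟨P, Q, h⟩; exact ⟨P, Q, by rw [← h]; ring⟩
  · rintro ⟨P, Q, h⟩; exact ⟨P, Q, by rw [h]; ring⟩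

theorem add_mul_pow_mem_powIdeal {R : Type*} [CommRing R] (u v w : R) (n : ℕ) :
    ∃ Q, (u + v * w) ^ n = u ^ n + v * Q := by
  obtain ⟨Q, hQ⟩ := sub_dvd_pow_sub_pow (u + v * w) u n
  exact ⟨w * Q, by linear_combination hQ⟩

theorem fixes_equivX (r s : ℕ) (hr : 1 ≤ r) (c : K) :
    Fixes (equivX (Polynomial.C c * Polynomial.X ^ (r - 1))) (powIdeal K 1 r) ∧
    Fixes (equivX (Polynomial.C c * Polynomial.X ^ (r - 1))) (powIdeal K s 1) := by
  obtain ⟨r, rfl⟩ := Nat.exists_eq_add_of_le' hr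
  have h1 : ∀ c : K, (powIdeal K 1 (r + 1)).map
      (equivX (Polynomial.C c * Polynomial.X ^ r)) ≤ powIdeal K 1 (r + 1) := by
    intro c
    refine map_powIdeal_le ?_ ?_
    · rw [equivX_X_zero, mem_powIdeal_iff]
      refine ⟨1, C c, ?_⟩
      simp only [map_mul, Polynomial.aeval_C, map_pow, Polynomial.aeval_X, MvPowerSeries.algebraMap_apply,
        Algebra.algebraMap_self, RingHom.id_apply]
      ring
    · rw [equivX_X_one, mem_powIdeal_iff]
      exact ⟨0, 1, by ring⟩
  have h2 : ∀ c : K, (powIdeal K s 1).map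
      (equivX (Polynomial.C c * Polynomial.X ^ r)) ≤ powIdeal K s 1 := by
    intro c
    refine map_powIdeal_le ?_ ?_
    · rw [equivX_X_zero, mem_powIdeal_iff]
      obtain ⟨Q, hQ⟩ := add_mul_pow_mem_powIdeal (X 0 : PS K) (X 1)
        (Polynomial.aeval (X 1) (Polynomial.C c * Polynomial.X ^ r)) s
      exact ⟨1, Q, by rw [hQ]; ring⟩
    · rw [equivX_X_one, mem_powIdeal_iff]
      exact ⟨0, 1, by ring⟩
  have hn : -(Polynomial.C c * Polynomial.X ^ r) = Polynomial.C (-c) * Polynomial.X ^ r := by simp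
  rw [Nat.add_sub_cancel]
  constructor
  · exact fixes_of_le (h1 c) (by rw [equivX_symm, hn]; exact h1 (-c))
  · exact fixes_of_le (h2 c) (by rw [equivX_symm, hn]; exact h2 (-c))

theorem fixes_equivY (r s : ℕ) (hs : 1 ≤ s) (c : K) :
    Fixes (equivY (Polynomial.C c * Polynomial.X ^ (s - 1))) (powIdeal K 1 r) ∧
    Fixes (equivY (Polynomial.C c * Polynomial.X ^ (s - 1))) (powIdeal K s 1) := by
  obtain ⟨s, rfl⟩ := Nat.exists_eq_add_of_le' hs
  have h1 : ∀ c : K, (powIdeal K 1 r).map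
      (equivY (Polynomial.C c * Polynomial.X ^ s)) ≤ powIdeal K 1 r := by
    intro c
    refine map_powIdeal_le ?_ ?_
    · rw [equivY_X_zero, mem_powIdeal_iff]
      exact ⟨1, 0, by ring⟩
    · rw [equivY_X_one, mem_powIdeal_iff]
      obtain ⟨Q, hQ⟩ := add_mul_pow_mem_powIdeal (X 1 : PS K) (X 0)
        (Polynomial.aeval (X 0) (Polynomial.C c * Polynomial.X ^ s)) r
      exact ⟨Q, 1, by rw [hQ]; ring⟩
  have h2 : ∀ c : K, (powIdeal K (s + 1) 1).map
      (equivY (Polynomial.C c * Polynomial.X ^ s)) ≤ powIdeal K (s + 1) 1 := by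
    intro c
    refine map_powIdeal_le ?_ ?_
    · rw [equivY_X_zero, mem_powIdeal_iff]
      exact ⟨1, 0, by ring⟩
    · rw [equivY_X_one, mem_powIdeal_iff]
      refine ⟨C c, 1, ?_⟩
      simp only [map_mul, Polynomial.aeval_C, map_pow, Polynomial.aeval_X, MvPowerSeries.algebraMap_apply,
        Algebra.algebraMap_self, RingHom.id_apply]
      ring
  have hn : -(Polynomial.C c * Polynomial.X ^ s) = Polynomial.C (-c) * Polynomial.X ^ s := by simp
  rw [Nat.add_sub_cancel]
  constructor
  · exact fixes_of_le (h1 c) (by rw [equivY_symm, hn]; exact h1 (-c))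
  · exact fixes_of_le (h2 c) (by rw [equivY_symm, hn]; exact h2 (-c))

variable {I : Ideal (PS K)}

/-- The coefficient of the sheared monomial at the shifted exponent is the binomial coefficient. If
this is nonzero, the shifted monomial must belong to the fixed ideal. -/
theorem stabX_of_fixes {r : ℕ} (hr : 1 ≤ r) (hI : IsStaircase I)
    (h : Fixes (equivX (Polynomial.C 1 * Polynomial.X ^ (r - 1))) I) : StabX K (expSet I) r := by
  intro p q k hpq hk hne
  by_contra hnot
  have h1 := Ideal.mem_map_of_mem (equivX (Polynomial.C (1 : K) * Polynomial.X ^ (r - 1))) hpq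
  rw [h, ← powProd_X, powProd, map_mul, map_pow, map_pow, equivX_X_zero, equivX_X_one] at h1
  have h2 := hI.mem_iff.1 h1 _ hnot
  have h3 := coeff_shear (r := r) (s := 2) (by omega) (1 : K) 0 hk (Nat.zero_le q)
  rw [mul_zero, add_zero, Nat.sub_zero] at h3
  have h4 : (X 0 + C (1 : K) * X 1 ^ r) ^ p * (X 1 + C (0 : K) * X 0 ^ 2) ^ q =
      ((X 0 + X 1 * Polynomial.aeval (X 1) (Polynomial.C (1 : K) * Polynomial.X ^ (r - 1))) ^
        (ee p q) 0 * X 1 ^ (ee p q) 1 : PS K) := by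
    obtain ⟨r, rfl⟩ := Nat.exists_eq_add_of_le' hr
    simp [pow_succ, mul_comm]
  rw [h4, h2] at h3
  exact hne (by simpa using h3.symm)

theorem stabY_of_fixes {s : ℕ} (hs : 1 ≤ s) (hI : IsStaircase I)
    (h : Fixes (equivY (Polynomial.C 1 * Polynomial.X ^ (s - 1))) I) : StabY K (expSet I) s := by
  intro p q l hpq hl hne
  by_contra hnot
  have h1 := Ideal.mem_map_of_mem (equivY (Polynomial.C (1 : K) * Polynomial.X ^ (s - 1))) hpq
  rw [h, ← powProd_X, powProd, map_mul, map_pow, map_pow, equivY_X_zero, equivY_X_one] at h1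
  have h2 := hI.mem_iff.1 h1 _ hnot
  have h3 := coeff_shear (r := 2) (s := s) (by omega) (0 : K) 1 (Nat.zero_le p) hl
  rw [mul_zero, add_zero, Nat.sub_zero] at h3
  have h4 : (X 0 + C (0 : K) * X 1 ^ 2) ^ p * (X 1 + C (1 : K) * X 0 ^ s) ^ q =
      (X 0 ^ (ee p q) 0 * (X 1 + X 0 * Polynomial.aeval (X 0)
        (Polynomial.C (1 : K) * Polynomial.X ^ (s - 1))) ^ (ee p q) 1 : PS K) := by
    obtain ⟨s, rfl⟩ := Nat.exists_eq_add_of_le' hs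
    simp [pow_succ, mul_comm]
  rw [h4, h2] at h3
  exact hne (by simpa using h3.symm)

/-- The converse direction: only the classes of φ(x) modulo (x, y^r) and of φ(y) modulo (x^s, y)
matter, so stability under two shears controls all automorphisms fixing these ideals. -/
theorem IsStaircase.map_eq_of_stab (hI : IsStaircase I) {r s : ℕ} (hX : StabX K (expSet I) r)
    (hY : StabY K (expSet I) s) (hrs : 2 ≤ r * s) (φ : PS K ≃ₐ[K] PS K)
    (h0 : φ (X 0) ∈ powIdeal K 1 r) (h1 : φ (X 1) ∈ powIdeal K s 1) : I.map φ = I := by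
  refine hI.map_eq φ fun e he => ?_
  obtain ⟨F, G, h0⟩ := mem_powIdeal_iff.1 h0
  obtain ⟨Q, P, h1⟩ := mem_powIdeal_iff.1 h1
  have := (hX.stabXY (isUpperSet_expSet I) hY hrs).mem (A := K) (hS := isUpperSet_expSet I) F G P Q
    (p := e 0) (q := e 1) (by rwa [ee_self])
  rw [hI.mem_iff, h0, h1]
  simp only [pow_one]
  rw [add_comm (X 0 ^ s * Q)]
  exact this

theorem HasMeasuringSequence.stab (hI : IsStaircase I) {r s : ℕ} (h : HasMeasuringSequence I r s) :
    StabX K (expSet I) r ∧ StabY K (expSet I) s := by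
  obtain ⟨hr, hs, h⟩ := h.1
  exact ⟨stabX_of_fixes hr hI (h _ (fixes_equivX r s hr 1).1 (fixes_equivX r s hr 1).2),
    stabY_of_fixes hs hI (h _ (fixes_equivY r s hs 1).1 (fixes_equivY r s hs 1).2)⟩

/-- Stability for (r', s') would make (r', s') a competitor of (r, s), and the least pair is below
it in both components. The bound 2 ≤ r' s' is what combining the two shears needs. -/
theorem HasMeasuringSequence.not_stab (hI : IsStaircase I) {r s r' s' : ℕ}
    (h : HasMeasuringSequence I r s) (h2 : 2 ≤ r' * s') (hlt : r' < r ∨ s' < s) :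
    ¬ (StabX K (expSet I) r' ∧ StabY K (expSet I) s') := by
  rintro ⟨hX, hY⟩
  have hr : r' ≠ 0 := by rintro rfl; simp at h2
  have hs : s' ≠ 0 := by rintro rfl; simp at h2
  have hle := h.2 (show (r', s') ∈ _ from ⟨Nat.one_le_iff_ne_zero.2 hr, Nat.one_le_iff_ne_zero.2 hs,
    fun φ h0 h1 => hI.map_eq_of_stab hX hY h2 φ ?_ ?_⟩)
  · have h1 : r ≤ r' := hle.1
    have h2 : s ≤ s' := hle.2
    omega
  · rw [← h0]
    refine Ideal.mem_map_of_mem _ (mem_powIdeal_iff.2 ⟨1, 0, by ring⟩)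
  · rw [← h1]
    refine Ideal.mem_map_of_mem _ (mem_powIdeal_iff.2 ⟨0, 1, by ring⟩)

/-- The combinatorial content of the measuring sequences. -/
def Kind.HasStab (κ : Kind) (K : Type*) [Field K] (S : Set (Fin 2 →₀ ℕ)) : Prop :=
  match κ with
  | .m41 => StabX K S 4 ∧ StabY K S 1 ∧ ¬ StabX K S 3
  | .m32 => StabX K S 3 ∧ StabY K S 2 ∧ ¬ StabX K S 2 ∧ ¬ StabY K S 1

theorem Kind.HasKind.hasStab {κ : Kind} (hI : IsStaircase I) (h : κ.HasKind I) :
    κ.HasStab K (expSet I) := by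
  cases κ with
  | m41 =>
    have h : HasMeasuringSequence I 4 1 := h
    obtain ⟨h1, h2⟩ := h.stab hI
    exact ⟨h1, h2, fun h3 => h.not_stab hI (r' := 3) (s' := 1) (by omega) (by omega) ⟨h3, h2⟩⟩
  | m32 =>
    have h : HasMeasuringSequence I 3 2 := h
    obtain ⟨h1, h2⟩ := h.stab hI
    exact ⟨h1, h2, fun h3 => h.not_stab hI (r' := 2) (s' := 2) (by omega) (by omega) ⟨h3, h2⟩,
      fun h3 => h.not_stab hI (r' := 3) (s' := 1) (by omega) (by omega) ⟨h1, h3⟩⟩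

theorem Kind.HasStab.extend {κ : Kind} {L : Type*} [Field L] [Algebra K L] (hI : IsStaircase I)
    (h : κ.HasStab K (expSet I)) : κ.HasStab L (expSet (ToricHilb.extend L I)) := by
  rw [expSet_extend hI]
  cases κ with
  | m41 => simpa only [Kind.HasStab, stabX_iff_of_algebra (K := K), stabY_iff_of_algebra (K := K)]
  | m32 => simpa only [Kind.HasStab, stabX_iff_of_algebra (K := K), stabY_iff_of_algebra (K := K)]

end Automorphisms

end StaircaseIdeals

/-! ### The representatives g(a, b) and h(a, b) as coordinate systems. -/

section Coordinates

variable {A : Type*} [CommRing A]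

theorem constantCoeff_gSubst (a b : A) (i : Fin 2) : constantCoeff (gSubst a b i) = 0 := by
  fin_cases i <;> simp [gSubst]

theorem constantCoeff_hSubst (a b : A) (i : Fin 2) : constantCoeff (hSubst a b i) = 0 := by
  fin_cases i <;> simp [hSubst]

theorem isCoordinates_gSubst (a b : A) : IsCoordinates (gSubst a b) := by
  refine isCoordinates_of (constantCoeff_gSubst a b) ?_ ?_
  · rw [Ideal.mem_span_pair]
    refine ⟨1, -(C a * X 1 + C b * X 1 ^ 2), ?_⟩
    simp only [gSubst, Matrix.cons_val_zero, Matrix.cons_val_one, Matrix.cons_val_fin_one]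
    ring
  · exact Ideal.subset_span (by simp [gSubst])

theorem isCoordinates_hSubst (a b : A) : IsCoordinates (hSubst a b) := by
  have h1 : (X 1 : PS A) ∈ Ideal.span {hSubst a b 0, hSubst a b 1} := by
    -- The linear combination h₁ - b h₀ of the two series equals y (1 - a b y), so y is recovered
    -- after dividing by a unit.
    have hu : IsUnit (1 - C (a * b) * X 1 : PS A) := by
      rw [MvPowerSeries.isUnit_iff_constantCoeff]; simp
    rw [← Ideal.mul_unit_mem_iff_mem _ hu, Ideal.mem_span_pair]
    refine ⟨-C b, 1, ?_⟩
    simp only [hSubst, Matrix.cons_val_zero, Matrix.cons_val_one, Matrix.cons_val_fin_one, map_mul]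
    ring
  refine isCoordinates_of (constantCoeff_hSubst a b) ?_ h1
  have h0 : (X 0 : PS A) = hSubst a b 0 - (C a * X 1) * X 1 := by
    simp only [hSubst, Matrix.cons_val_zero]
    ring
  rw [h0]
  exact sub_mem (Ideal.subset_span (by simp)) (Ideal.mul_mem_left _ _ h1)

theorem Kind.isCoordinates_rep (κ : Kind) (a b : A) : IsCoordinates (κ.rep a b) := by
  cases κ
  · exact isCoordinates_gSubst a b
  · exact isCoordinates_hSubst a b

theorem Kind.constantCoeff_rep (κ : Kind) (a b : A) (i : Fin 2) :
    constantCoeff (κ.rep a b i) = 0 := (κ.isCoordinates_rep a b).constantCoeff_eq_zero i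

theorem map_gSubst {B : Type*} [CommRing B] (φ : A →+* B) (a b : A) (i : Fin 2) :
    MvPowerSeries.map φ (gSubst a b i) = gSubst (φ a) (φ b) i := by
  fin_cases i <;> simp [gSubst]

theorem map_hSubst {B : Type*} [CommRing B] (φ : A →+* B) (a b : A) (i : Fin 2) :
    MvPowerSeries.map φ (hSubst a b i) = hSubst (φ a) (φ b) i := by
  fin_cases i <;> simp [hSubst]

theorem Kind.map_rep (κ : Kind) {B : Type*} [CommRing B] (φ : A →+* B) (a b : A) (i : Fin 2) :
    MvPowerSeries.map φ (κ.rep a b i) = κ.rep (φ a) (φ b) i := by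
  cases κ
  · exact map_gSubst φ a b i
  · exact map_hSubst φ a b i

theorem gSubst_zero : gSubst (0 : A) 0 = X := by
  funext i; fin_cases i <;> simp [gSubst]

theorem hSubst_zero : hSubst (0 : A) 0 = X := by
  funext i; fin_cases i <;> simp [hSubst]

theorem Kind.rep_zero (κ : Kind) : κ.rep (0 : A) 0 = X := by
  cases κ
  · exact gSubst_zero
  · exact hSubst_zero

end Coordinates

/-! ### The action of substitutions on the row space of I. -/

section RowMatrix

variable {K : Type*} [Field K] (I : Ideal (PS K)) (A : Type*) [CommRing A] [Algebra K A]

/-- The coefficient matrix of the low monomials of `I`, over a `K`-algebra. -/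
noncomputable def rowMat : Matrix (Row I) (LowExp (colength I)) A :=
  (cmat (colength I) (rowFrame I)).map (algebraMap K A)

variable {I A}

theorem rowMat_mul_apply (T : Matrix (LowExp (colength I)) (LowExp (colength I)) A) (i : Row I)
    (j : LowExp (colength I)) : (rowMat I A * T) i j = T i.1 j := by
  classical
  rw [Matrix.mul_apply, Finset.sum_eq_single i.1]
  · simp [rowMat, cmat, rowFrame]
  · intro l _ hl
    simp only [rowMat, cmat, rowFrame, Matrix.map_apply, Matrix.of_apply, coeff_monomial]
    rw [if_neg (fun h => hl (Subtype.ext h)), map_zero, zero_mul]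
  · intro h; simp at h

theorem rowMat_mul_tmat (s : Fin 2 → PS A) : rowMat I A * tmat (colength I) s =
    cmat (colength I) (fun i : Row I => powProd s i.1.1) := by
  ext i j
  rw [rowMat_mul_apply]
  rfl

theorem rowMat_map {B : Type*} [CommRing B] [Algebra K B] (φ : A →ₐ[K] B) :
    (rowMat I A).map φ = rowMat I B := by
  ext i j
  simp [rowMat]

variable {S : Set (Fin 2 →₀ ℕ)}

/-- A substitution that is stable on `I` only changes the basis of the row space. -/
theorem exists_rowMat_mul_eq {s β : Fin 2 → PS A} (hs : ∀ i, constantCoeff (s i) = 0)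
    (hβ : ∀ e ∈ expSet I, powProd β e ∈ staircaseIdeal A (isUpperSet_expSet I)) :
    ∃ U : Matrix (Row I) (Row I) A, rowMat I A * tmat (colength I) (fun i => subst s (β i)) =
      U * (rowMat I A * tmat (colength I) s) := by
  classical
  -- β maps the monomials of I into the span of the monomials of I, up to high order; U is the
  -- matrix of this map in that basis.
  refine ⟨Matrix.of fun i k => coeff k.1.1 (powProd β i.1.1), ?_⟩
  have h : rowMat I A * tmat (colength I) β =
      (Matrix.of fun i k : Row I => coeff k.1.1 (powProd β i.1.1)) * rowMat I A := by
    ext i j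
    rw [rowMat_mul_apply, Matrix.mul_apply]
    simp only [tmat, rowMat, cmat, rowFrame, Matrix.of_apply, Matrix.map_apply, coeff_monomial]
    by_cases hj : j.1 ∈ expSet I
    · rw [Finset.sum_eq_single ⟨j, hj⟩]
      · simp
      · intro k _ hk
        rw [if_neg (fun h => hk (Subtype.ext (Subtype.ext h.symm))), map_zero, mul_zero]
      · intro h; simp at h
    · rw [hβ _ i.2 _ hj]
      symm
      refine Finset.sum_eq_zero fun k _ => ?_
      rw [if_neg, map_zero, mul_zero]
      intro h
      apply hj
      rw [h]
      exact k.2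
  rw [tmat_comp _ hs, ← Matrix.mul_assoc, h, Matrix.mul_assoc]

end RowMatrix

/-! ### The coordinate functions are scalar multiples of monomials. -/

section CoordinateFunctions

variable {K : Type*} [Field K] {I : Ideal (PS K)} (κ : Kind)

theorem coordFun_eq_pl (c : Coord I) : coordFun κ I c =
    pl (rowMat I (MvPolynomial (Fin 2) K) * tmat (colength I)
      (κ.rep (MvPolynomial.X 0 : MvPolynomial (Fin 2) K) (MvPolynomial.X 1))) c := by
  rw [coordFun, minor_eq_pl, rowMat_mul_tmat]
  congr 1
  ext i j
  simp only [cmat, Matrix.of_apply]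
  rw [subst_monomial_one (κ.constantCoeff_rep _ _)]

/-- Minors commute with ring homomorphisms, so specializing the universal coordinates gives the
coordinates for concrete parameters; the values may lie in any K-algebra, such as K[s][t] below. -/
theorem aeval_coordFun {B : Type*} [CommRing B] [Algebra K B] (a b : B) (c : Coord I) :
    MvPolynomial.aeval ![a, b] (coordFun κ I c) =
      pl (rowMat I B * tmat (colength I) (κ.rep a b)) c := by
  rw [coordFun_eq_pl]
  have h := pl_map (MvPolynomial.aeval (R := K) ![a, b] : MvPolynomial (Fin 2) K →ₐ[K] B).toRingHom
    (rowMat I (MvPolynomial (Fin 2) K) * tmat (colength I)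
      (κ.rep (MvPolynomial.X 0 : MvPolynomial (Fin 2) K) (MvPolynomial.X 1))) c
  refine h.symm.trans ?_
  congr 1
  rw [Matrix.map_mul, ← tmat_map]
  congr 1
  · exact rowMat_map _
  · congr 1
    funext i
    rw [κ.map_rep]
    simp

/-- The base point of the chart. -/
def baseCoord (I : Ideal (PS K)) : Coord I := fun i => i.1

/-- The weights of the parameters `a`, `b`. -/
def Kind.wt : Kind → Fin 2 → ℤ × ℤ
  | .m41 => ![(1, -2), (1, -3)]
  | .m32 => ![(1, -2), (-1, 1)]

/-- The weight of a monomial in `x`, `y`. -/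
def expWt (e : Fin 2 →₀ ℕ) : ℤ × ℤ := (e 0, e 1)

theorem expWt_add (e e' : Fin 2 →₀ ℕ) : expWt (e + e') = expWt e + expWt e' := by
  simp [expWt]

/-- Homogeneous power series, for the grading with weights `wt` of the coefficients. -/
def IsHomog (wt : Fin 2 → ℤ × ℤ) (F : PS (MvPolynomial (Fin 2) K)) (w : ℤ × ℤ) : Prop :=
  ∀ e, MvPolynomial.IsWeightedHomogeneous wt (coeff e F) (w - expWt e)

variable {wt : Fin 2 → ℤ × ℤ} {F G : PS (MvPolynomial (Fin 2) K)} {w w' : ℤ × ℤ}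

theorem IsHomog.add (hF : IsHomog wt F w) (hG : IsHomog wt G w) : IsHomog wt (F + G) w :=
  fun e => by rw [map_add]; exact (hF e).add (hG e)

theorem IsHomog.mul (hF : IsHomog wt F w) (hG : IsHomog wt G w') :
    IsHomog wt (F * G) (w + w') := by
  classical
  intro e
  rw [coeff_mul]
  refine MvPolynomial.IsWeightedHomogeneous.sum _ _ _ fun x hx => ?_
  have := (hF x.1).mul (hG x.2)
  rw [← Finset.HasAntidiagonal.mem_antidiagonal.1 hx, expWt_add]
  convert this using 1
  abel

theorem IsHomog.pow (hF : IsHomog wt F w) (n : ℕ) : IsHomog wt (F ^ n) (n • w) := by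
  induction n with
  | zero =>
    classical
    intro e
    rw [pow_zero, coeff_one]
    split_ifs with h
    · subst h
      simpa [expWt, Prod.mk_zero_zero] using MvPolynomial.isWeightedHomogeneous_one K wt
    · exact MvPolynomial.isWeightedHomogeneous_zero _ _ _
  | succ n ih => rw [pow_succ, succ_nsmul]; exact ih.mul hF

theorem isHomog_C_mul_monomial {φ : MvPolynomial (Fin 2) K} {e : Fin 2 →₀ ℕ}
    (h : MvPolynomial.IsWeightedHomogeneous wt φ (w - expWt e)) :
    IsHomog wt (monomial e φ) w := by
  classical
  intro e'
  rw [coeff_monomial]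
  split_ifs with h'
  · rw [h']; exact h
  · exact MvPolynomial.isWeightedHomogeneous_zero _ _ _

theorem Kind.isHomog_rep : IsHomog κ.wt
    (κ.rep (MvPolynomial.X 0 : MvPolynomial (Fin 2) K) (MvPolynomial.X 1) 0) (1, 0) ∧
    IsHomog κ.wt
    (κ.rep (MvPolynomial.X 0 : MvPolynomial (Fin 2) K) (MvPolynomial.X 1) 1) (0, 1) := by
  have hx : ∀ wt, IsHomog wt (X 0 : PS (MvPolynomial (Fin 2) K)) (1, 0) := fun wt =>
    isHomog_C_mul_monomial (by simpa [expWt] using MvPolynomial.isWeightedHomogeneous_one K wt)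
  have hy : ∀ wt, IsHomog wt (X 1 : PS (MvPolynomial (Fin 2) K)) (0, 1) := fun wt =>
    isHomog_C_mul_monomial (by simpa [expWt] using MvPolynomial.isWeightedHomogeneous_one K wt)
  have hmon : ∀ (i : Fin 2) (p q : ℕ), (C (MvPolynomial.X i) * (X 0 ^ p * X 1 ^ q) :
      PS (MvPolynomial (Fin 2) K)) = monomial (ee p q) (MvPolynomial.X i) := fun i p q =>
    (monomial_ee p q _).symm
  cases κ
  · refine ⟨?_, hy _⟩
    change IsHomog _ (X 0 + C (MvPolynomial.X 0) * X 1 ^ 2 + C (MvPolynomial.X 1) * X 1 ^ 3) _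
    have h0 := hmon 0 0 2
    have h1 := hmon 1 0 3
    rw [pow_zero, one_mul] at h0 h1
    rw [h0, h1]
    refine ((hx _).add (isHomog_C_mul_monomial ?_)).add (isHomog_C_mul_monomial ?_)
    · have := MvPolynomial.isWeightedHomogeneous_X K Kind.m41.wt 0
      simpa [expWt, Kind.wt] using this
    · have := MvPolynomial.isWeightedHomogeneous_X K Kind.m41.wt 1
      simpa [expWt, Kind.wt] using this
  · constructor
    · change IsHomog _ (X 0 + C (MvPolynomial.X 0) * X 1 ^ 2) _
      have h0 := hmon 0 0 2
      rw [pow_zero, one_mul] at h0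
      rw [h0]
      refine (hx _).add (isHomog_C_mul_monomial ?_)
      have := MvPolynomial.isWeightedHomogeneous_X K Kind.m32.wt 0
      simpa [expWt, Kind.wt] using this
    · change IsHomog _ (X 1 + C (MvPolynomial.X 1) * X 0) _
      have h0 := hmon 1 1 0
      rw [pow_zero, mul_one, pow_one] at h0
      rw [h0]
      refine (hy _).add (isHomog_C_mul_monomial ?_)
      have := MvPolynomial.isWeightedHomogeneous_X K Kind.m32.wt 1
      simpa [expWt, Kind.wt] using this

/-- The weights of a and b make the images of x and y homogeneous of the weights (1, 0) and (0, 1)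
of x and y. Each term of the determinant then has the weight of the rows minus that of the columns.
-/
theorem coordFun_isWeightedHomogeneous (c : Coord I) :
    MvPolynomial.IsWeightedHomogeneous κ.wt (coordFun κ I c)
      (∑ i : Row I, expWt i.1.1 - ∑ i, expWt (c i).1) := by
  have hrow : ∀ e, IsHomog κ.wt
      (powProd (κ.rep (MvPolynomial.X 0 : MvPolynomial (Fin 2) K) (MvPolynomial.X 1)) e)
      (expWt e) := by
    intro e
    have := ((κ.isHomog_rep (K := K)).1.pow (e 0)).mul (κ.isHomog_rep.2.pow (e 1))
    have hw : expWt e = e 0 • ((1, 0) : ℤ × ℤ) + e 1 • ((0, 1) : ℤ × ℤ) := by simp [expWt]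
    rw [hw]
    exact this
  rw [coordFun_eq_pl, rowMat_mul_tmat, pl, Matrix.det_apply]
  refine MvPolynomial.IsWeightedHomogeneous.sum _ _ _ fun σ _ => ?_
  rw [Units.smul_def, ← Int.cast_smul_eq_zsmul K, MvPolynomial.smul_eq_C_mul]
  refine MvPolynomial.IsWeightedHomogeneous.C_mul ?_ _
  have := MvPolynomial.IsWeightedHomogeneous.prod Finset.univ
    (fun i => (cmat (colength I) (fun i : Row I => powProd
      (κ.rep (MvPolynomial.X 0 : MvPolynomial (Fin 2) K) (MvPolynomial.X 1)) i.1.1)).submatrix id c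
      (σ i) i) (fun i => expWt (σ i).1.1 - expWt (c i).1) (w := κ.wt) fun i _ => hrow _ _
  rwa [Finset.sum_sub_distrib, Equiv.sum_comp σ (fun i : Row I => expWt i.1.1)] at this

/-- For each kind the weights of a and b are linearly independent, so a monomial in a and b is
determined by its weight. -/
theorem eq_of_mem_support {c : Coord I} {e e' : Fin 2 →₀ ℕ}
    (he : e ∈ (coordFun κ I c).support) (he' : e' ∈ (coordFun κ I c).support) : e = e' := by
  have h := coordFun_isWeightedHomogeneous κ c (MvPolynomial.mem_support_iff.1 he)
  rw [← coordFun_isWeightedHomogeneous κ c (MvPolynomial.mem_support_iff.1 he')] at h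
  rw [Finsupp.weight_apply, Finsupp.weight_apply, Finsupp.sum_fintype _ _ (by simp),
    Finsupp.sum_fintype _ _ (by simp), Fin.sum_univ_two, Fin.sum_univ_two] at h
  cases κ
  all_goals
    simp [Kind.wt] at h
    ext i
    fin_cases i
    · change e 0 = e' 0
      omega
    · change e 1 = e' 1
      omega

/-- The coordinate functions are scalar multiples of monomials. -/
theorem exists_coordFun_eq_monomial (c : Coord I) :
    ∃ e l, coordFun κ I c = MvPolynomial.monomial e l ∧
      (l ≠ 0 → e ∈ (coordFun κ I c).support) := by
  by_cases h : coordFun κ I c = 0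
  · exact ⟨0, 0, by rw [h, MvPolynomial.monomial_zero], fun h => absurd rfl h⟩
  · obtain ⟨e, he⟩ := MvPolynomial.support_nonempty.2 h
    refine ⟨e, (coordFun κ I c).coeff e, ?_, fun _ => he⟩
    ext e'
    classical
    rw [MvPolynomial.coeff_monomial]
    split_ifs with h'
    · rw [h']
    · rw [← MvPolynomial.notMem_support_iff]
      exact fun he' => h' (eq_of_mem_support κ he he')

theorem pl_rowMat_baseCoord (A : Type*) [CommRing A] [Algebra K A] :
    pl (rowMat I A) (baseCoord I) = 1 := by
  classical
  have : (rowMat I A).submatrix id (baseCoord I) = 1 := by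
    ext i j
    simp only [rowMat, cmat, rowFrame, baseCoord, Matrix.submatrix_apply, Matrix.map_apply,
      Matrix.of_apply, id, coeff_monomial, Matrix.one_apply]
    by_cases h : i = j
    · simp [h]
    · rw [if_neg h, if_neg (fun h' => h (Subtype.ext (Subtype.ext h'.symm))), map_zero]
  rw [pl, this, Matrix.det_one]

theorem aeval_coordFun_zero {B : Type*} [CommRing B] [Algebra K B] (c : Coord I) :
    MvPolynomial.aeval ![(0 : B), 0] (coordFun κ I c) = pl (rowMat I B) c := by
  rw [aeval_coordFun, κ.rep_zero, tmat_X, Matrix.mul_one]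

/-- A scalar multiple of a monomial that takes the value 1 at a = b = 0 is the constant 1. -/
theorem coordFun_baseCoord : coordFun κ I (baseCoord I) = 1 := by
  obtain ⟨e, l, hel, hl⟩ := exists_coordFun_eq_monomial κ (baseCoord I)
  have h1 := aeval_coordFun_zero (B := K) κ (baseCoord I)
  rw [pl_rowMat_baseCoord, hel, MvPolynomial.aeval_monomial, Finsupp.prod_fintype _ _ (by simp),
    Fin.prod_univ_two] at h1
  have hne : l ≠ 0 := by rintro rfl; simp at h1
  have he : e = 0 := by
    ext i
    by_contra h
    fin_cases i <;> simp_all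
  subst he
  rw [hel]
  simp at h1
  rw [h1]
  rfl

end CoordinateFunctions

/-! ### Factoring the representatives modulo stable substitutions. -/

section Composites

variable {A : Type*} [CommRing A]

theorem subst_hSubst_hSubst (a b : A) : (fun i => subst (hSubst a 0) (hSubst 0 b i)) =
    ![X 0 + C a * X 1 ^ 2, X 1 + C b * (X 0 + C a * X 1 ^ 2)] := by
  have h := hasSubst_hSubst a 0
  funext i
  fin_cases i
  · change subst (hSubst a 0) (X 0 + C 0 * X 1 ^ 2) = _
    rw [map_zero, zero_mul, add_zero, subst_X h]
    simp [hSubst]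
  · change subst (hSubst a 0) (X 1 + C b * X 0) = _
    rw [subst_add h, subst_mul h, subst_C, subst_X h, subst_X h]
    simp [hSubst]

theorem subst_hSubst_gSubst (a b : A) : (fun i => subst (hSubst 0 b) (gSubst a 0 i)) =
    ![X 0 + C a * (X 1 + C b * X 0) ^ 2, X 1 + C b * X 0] := by
  have h := hasSubst_hSubst 0 b
  funext i
  fin_cases i
  · change subst (hSubst 0 b) (X 0 + C a * X 1 ^ 2 + C 0 * X 1 ^ 3) = _
    rw [map_zero, zero_mul, add_zero, subst_add h, subst_mul h, subst_pow h, subst_C, subst_X h, subst_X h]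
    simp [hSubst]
  · change subst (hSubst 0 b) (X 1) = _
    rw [subst_X h]
    simp [hSubst]

theorem hSubst_zero_right (a : A) : hSubst a 0 = gSubst a 0 := by
  funext i
  fin_cases i <;> simp [hSubst, gSubst]

theorem subst_gSubst_gSubst (a b c d : A) :
    (fun i => subst (gSubst c d) (gSubst a b i)) = gSubst (a + c) (b + d) := by
  have h := hasSubst_gSubst c d
  funext i
  fin_cases i
  · change subst (gSubst c d) (X 0 + C a * X 1 ^ 2 + C b * X 1 ^ 3) = _
    simp only [subst_add h, subst_mul h, subst_pow h, subst_C, subst_X h]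
    simp only [gSubst, Matrix.cons_val_zero, Matrix.cons_val_one, Matrix.cons_val_fin_one, map_add,
      Fin.zero_eta]
    ring
  · change subst (gSubst c d) (X 1) = _
    rw [subst_X h]
    simp [gSubst]

theorem subst_hSubst_zero_hSubst_zero (b d : A) :
    (fun i => subst (hSubst 0 d) (hSubst 0 b i)) = hSubst 0 (b + d) := by
  have h := hasSubst_hSubst 0 d
  funext i
  fin_cases i
  · change subst (hSubst 0 d) (X 0 + C 0 * X 1 ^ 2) = _
    rw [map_zero, zero_mul, add_zero, subst_X h]
    simp [hSubst]
  · change subst (hSubst 0 d) (X 1 + C b * X 0) = _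
    simp only [subst_add h, subst_mul h, subst_C, subst_X h]
    simp only [hSubst, Matrix.cons_val_zero, Matrix.cons_val_one, Matrix.cons_val_fin_one, map_add,
      map_zero, zero_mul, add_zero, Fin.mk_one]
    ring

theorem IsCoordinates.comp {s β : Fin 2 → PS A} (hs : IsCoordinates s) (hβ : IsCoordinates β) :
    IsCoordinates (fun i => subst s (β i)) := by
  have h := hasSubst_of_zero hs.constantCoeff_eq_zero
  have key : ∀ i, s i ∈ Ideal.span {subst s (β 0), subst s (β 1)} := by
    intro i
    have hi : (X i : PS A) ∈ Ideal.span {β 0, β 1} := by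
      rw [hβ]
      fin_cases i
      · exact X_zero_mem_originIdeal
      · exact X_one_mem_originIdeal
    obtain ⟨u, v, huv⟩ := Ideal.mem_span_pair.1 hi
    rw [Ideal.mem_span_pair]
    refine ⟨subst s u, subst s v, ?_⟩
    rw [← subst_mul h, ← subst_mul h, ← subst_add h, huv, subst_X h]
  have hle : originIdeal A ≤ Ideal.span {subst s (β 0), subst s (β 1)} := by
    rw [← hs, Ideal.span_le]
    rintro _ (rfl | rfl)
    · exact key 0
    · exact key 1
  exact isCoordinates_of
    (fun i => constantCoeff_subst_eq_zero h hs.constantCoeff_eq_zero (hβ.constantCoeff_eq_zero i))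
    (hle X_zero_mem_originIdeal) (hle X_one_mem_originIdeal)

variable {K : Type*} [Field K] [Algebra K A] {S : Set (Fin 2 →₀ ℕ)} (hS : IsUpperSet S)

theorem StabX.powProd_mem {r s : ℕ} (hX : StabX K S r) (hY : StabY K S s) (hrs : 2 ≤ r * s)
    {β : Fin 2 → PS A} (F G P Q : PS A) (h0 : β 0 = X 0 * F + X 1 ^ r * G)
    (h1 : β 1 = X 1 * P + X 0 ^ s * Q) (e : Fin 2 →₀ ℕ) (he : e ∈ S) :
    powProd β e ∈ staircaseIdeal A hS := by
  rw [powProd, h0, h1]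
  exact (hX.stabXY hS hY hrs).mem F G P Q (by rwa [ee_self])

/-- `h(a, b)` and `h(a, 0) ∘ h(0, b)` differ by a stable substitution. -/
theorem exists_hSubst_eq_comp (hX : StabX K S 3) (hY : StabY K S 2) (a b : A) :
    ∃ β : Fin 2 → PS A, (∀ e ∈ S, powProd β e ∈ staircaseIdeal A hS) ∧
      hSubst a b = fun i => subst (fun i => subst (hSubst a 0) (hSubst 0 b i)) (β i) := by
  -- β is the preimage of the target under the composite s. As s sends x to x + a y² and y - b x to
  -- y, the surplus a b y² in s(y) is removed by subtracting a b (y - b x)²; the second entry stays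
  -- in (x², y).
  refine ⟨![X 0, X 1 - C (a * b) * (X 1 - C b * X 0) ^ 2],
    hX.powProd_mem hS hY (by omega) 1 0
      (1 - C (a * b) * X 1 + 2 * C (a * b * b) * X 0) (-C (a * b * b * b)) ?_ ?_, ?_⟩
  · simp
  · simp only [Matrix.cons_val_one, Matrix.cons_val_fin_one, map_mul]
    ring
  · rw [subst_hSubst_hSubst]
    set s : Fin 2 → PS A := ![X 0 + C a * X 1 ^ 2, X 1 + C b * (X 0 + C a * X 1 ^ 2)] with hs
    have h : HasSubst s := hasSubst_of_zero (by intro i; fin_cases i <;> simp [hs])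
    funext i
    fin_cases i
    · change _ = subst s (X 0)
      rw [subst_X h]
      simp [hs, hSubst]
    · change _ = subst s (X 1 - C (a * b) * (X 1 - C b * X 0) ^ 2)
      rw [subst_sub h, subst_mul h, subst_pow h, subst_sub h, subst_mul h, subst_C, subst_C,
        subst_X h, subst_X h]
      simp only [hs, hSubst, Matrix.cons_val_zero, Matrix.cons_val_one, Matrix.cons_val_fin_one,
        map_mul, Fin.mk_one]
      ring

/-- `h(a, b)` and `h(0, b) ∘ h(a, 0)` differ by a stable substitution. -/
theorem exists_hSubst_eq_comp' (hX : StabX K S 3) (hY : StabY K S 2) (a b : A) :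
    ∃ β : Fin 2 → PS A, (∀ e ∈ S, powProd β e ∈ staircaseIdeal A hS) ∧
      hSubst a b = fun i => subst (fun i => subst (hSubst 0 b) (hSubst a 0 i)) (β i) := by
  -- Here s sends x - a y² to x and y - b (x - a y²) to y, and x + a y² is rewritten in these
  -- preimages. The terms a y² cancel, which leaves the first entry in (x, y³).
  refine ⟨![X 0 - C a * X 1 ^ 2 + C a * (X 1 - C b * X 0 + C (a * b) * X 1 ^ 2) ^ 2, X 1],
    hX.powProd_mem hS hY (by omega)
      (1 - 2 * C (a * b) * (X 1 + C (a * b) * X 1 ^ 2) + C (a * b * b) * X 0)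
      (2 * C (a * a * b) + C (a * a * a * b * b) * X 1) 1 0 ?_ ?_, ?_⟩
  · simp only [Matrix.cons_val_zero, map_mul]
    ring
  · simp
  · rw [hSubst_zero_right, subst_hSubst_gSubst]
    set s : Fin 2 → PS A := ![X 0 + C a * (X 1 + C b * X 0) ^ 2, X 1 + C b * X 0] with hs
    have h : HasSubst s := hasSubst_of_zero (by intro i; fin_cases i <;> simp [hs])
    funext i
    fin_cases i
    · change _ = subst s
        (X 0 - C a * X 1 ^ 2 + C a * (X 1 - C b * X 0 + C (a * b) * X 1 ^ 2) ^ 2)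
      simp only [subst_add h, subst_sub h, subst_mul h, subst_pow h, subst_C, subst_X h]
      simp only [hs, hSubst, Matrix.cons_val_zero, Matrix.cons_val_one, Matrix.cons_val_fin_one,
        map_mul, Fin.zero_eta]
      ring
    · change _ = subst s (X 1)
      rw [subst_X h]
      simp [hs, hSubst]

/-- `g(a, -2 a ^ 2 c)` and `h(0, c) ∘ g(a, 0)` differ by a stable substitution. -/
theorem exists_gSubst_eq_comp (hX : StabX K S 4) (hY : StabY K S 1) (a c : A) :
    ∃ β : Fin 2 → PS A, (∀ e ∈ S, powProd β e ∈ staircaseIdeal A hS) ∧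
      gSubst a (-2 * a ^ 2 * c) =
        fun i => subst (fun i => subst (hSubst 0 c) (gSubst a 0 i)) (β i) := by
  -- With x' = x - a y² and y' = y - c x', which s sends to x and y, the first entry is x' + a y'² -
  -- 2a²c y'³. Modulo x, a y'² contributes 2a²c y³; the parameter b = -2a²c is the one that cancels
  -- it and leaves the entry in (x, y⁴).
  refine ⟨![X 0 - C a * X 1 ^ 2 + C a * (X 1 - C c * (X 0 - C a * X 1 ^ 2)) ^ 2 -
      2 * C (a * a * c) * (X 1 - C c * (X 0 - C a * X 1 ^ 2)) ^ 3,
      X 1 - C c * (X 0 - C a * X 1 ^ 2)],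
    hX.powProd_mem hS hY (by omega)
      (1 + C a * (-2 * C c * (X 1 + C (a * c) * X 1 ^ 2) + C (c * c) * X 0) - 2 * C (a * a * c) *
        (-3 * C c * (X 1 + C (a * c) * X 1 ^ 2) ^ 2 +
          3 * C (c * c) * (X 1 + C (a * c) * X 1 ^ 2) * X 0 - C (c * c * c) * X 0 ^ 2))
      (-5 * C (a * a * a * c * c) - 6 * C (a * a * a * a * c * c * c) * X 1 -
        2 * C (a * a * a * a * a * c * c * c * c) * X 1 ^ 2)
      (1 + C (a * c) * X 1) (-C c) ?_ ?_, ?_⟩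
  · simp only [Matrix.cons_val_zero, map_mul]
    ring
  · simp only [Matrix.cons_val_one, Matrix.cons_val_fin_one, map_mul]
    ring
  · rw [subst_hSubst_gSubst]
    set s : Fin 2 → PS A := ![X 0 + C a * (X 1 + C c * X 0) ^ 2, X 1 + C c * X 0] with hs
    have h : HasSubst s := hasSubst_of_zero (by intro i; fin_cases i <;> simp [hs])
    have h2 : (2 : PS A) = C 2 := (map_ofNat C 2).symm
    funext i
    fin_cases i
    · change _ = subst s (X 0 - C a * X 1 ^ 2 + C a * (X 1 - C c * (X 0 - C a * X 1 ^ 2)) ^ 2 -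
        2 * C (a * a * c) * (X 1 - C c * (X 0 - C a * X 1 ^ 2)) ^ 3)
      rw [h2]
      simp only [subst_add h, subst_sub h, subst_mul h, subst_pow h, subst_C, subst_X h]
      simp only [hs, gSubst, Matrix.cons_val_zero, Matrix.cons_val_one, Matrix.cons_val_fin_one,
        map_mul, map_neg, map_pow, Fin.zero_eta]
      ring
    · change _ = subst s (X 1 - C c * (X 0 - C a * X 1 ^ 2))
      simp only [subst_sub h, subst_mul h, subst_pow h, subst_C, subst_X h]
      simp only [hs, gSubst, Matrix.cons_val_zero, Matrix.cons_val_one, Matrix.cons_val_fin_one,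
        Fin.mk_one]
      ring

end Composites

/-! ### Moving ideals by substitutions. -/

section Movement

variable {K : Type*} [Field K] {I : Ideal (PS K)}

/-- The stable part β multiplies all minors by one determinant. It is a unit because the base
coordinate of the representative is 1. -/
theorem exists_unit_aeval_coordFun {A : Type*} [CommRing A] [Algebra K A] {κ : Kind} {a b : A}
    {s β : Fin 2 → PS A} (hs : ∀ i, constantCoeff (s i) = 0)
    (hβ : ∀ e ∈ expSet I, powProd β e ∈ staircaseIdeal A (isUpperSet_expSet I))
    (h : κ.rep a b = fun i => subst s (β i)) :
    ∃ u : A, IsUnit u ∧ ∀ c, MvPolynomial.aeval ![a, b] (coordFun κ I c) =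
      u * pl (rowMat I A * tmat (colength I) s) c := by
  obtain ⟨U, hU⟩ := exists_rowMat_mul_eq hs hβ
  have key : ∀ c, MvPolynomial.aeval ![a, b] (coordFun κ I c) =
      U.det * pl (rowMat I A * tmat (colength I) s) c := by
    intro c
    rw [aeval_coordFun, h, hU, pl_mul_left]
  refine ⟨U.det, ?_, key⟩
  have := key (baseCoord I)
  rw [coordFun_baseCoord, map_one] at this
  exact IsUnit.of_mul_eq_one _ this.symm

theorem isFrame_moved {d : ℕ} {ι : Type*} [Fintype ι] {J : Ideal (PS K)} {f : ι → PS K}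
    (hf : IsFrame d J f) {s : Fin 2 → PS K} (hs : IsCoordinates s) :
    IsFrame d (moved s J) (fun i => subst s (f i)) := by
  rw [isFrame_iff]
  intro F
  rw [mem_moved_iff hf hs, cmat_subst hs.constantCoeff_eq_zero]

theorem IsStaircase.isPluckerVector_moved_subst (hI : IsStaircase I) {s : Fin 2 → PS K}
    (hs : IsCoordinates s) (hne : ∃ c, pl (rowMat I K * tmat (colength I) s) c ≠ 0) :
    IsPluckerVector I (moved s I) (fun c => pl (rowMat I K * tmat (colength I) s) c) := by
  rw [isPluckerVector_iff]
  refine ⟨Function.ne_iff.2 hne, _, isFrame_moved hI.isFrame hs, fun c => ?_⟩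
  rw [cmat_subst hs.constantCoeff_eq_zero, rowMat]

theorem IsStaircase.isPluckerVector_moved (hI : IsStaircase I) (κ : Kind) (a b : K) :
    IsPluckerVector I (moved (κ.rep a b) I)
      (fun c => MvPolynomial.aeval ![a, b] (coordFun κ I c)) := by
  simp only [aeval_coordFun]
  refine hI.isPluckerVector_moved_subst (κ.isCoordinates_rep a b) ⟨baseCoord I, ?_⟩
  rw [← aeval_coordFun, coordFun_baseCoord, map_one]
  exact one_ne_zero

theorem moved_X (J : Ideal (PS K)) : moved (X : Fin 2 → PS K) J = J := by
  have : (fun f : PS K => subst (X : Fin 2 → PS K) f) = id := by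
    funext f
    rw [subst_self]
  rw [moved, this, Set.image_id, Ideal.span_eq]

theorem subst_mem_moved {A : Type*} [CommRing A] [Algebra K A] {s : Fin 2 → PS A}
    {J : Ideal (PS K)} {F : PS K} (hF : F ∈ J) : subst s F ∈ moved s J :=
  Ideal.subset_span ⟨F, hF, rfl⟩

theorem moved_subst {s β : Fin 2 → PS K} (hs : ∀ i, constantCoeff (s i) = 0)
    (hβ : ∀ i, constantCoeff (β i) = 0) (J : Ideal (PS K)) :
    moved s (moved β J) = moved (fun i => subst s (β i)) J := by
  have hc := subst_comp_subst_apply (R := K) (hasSubst_of_zero hβ) (hasSubst_of_zero hs)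
  apply le_antisymm
  · rw [moved, Ideal.span_le]
    rintro _ ⟨F, hF, rfl⟩
    change subst s F ∈ _
    rw [← substAlgHom_apply (hasSubst_of_zero hs)]
    revert F
    change moved β J ≤ Ideal.comap (substAlgHom (R := K) (hasSubst_of_zero hs))
      (moved (fun i => subst s (β i)) J)
    rw [moved, Ideal.span_le]
    rintro _ ⟨F, hF, rfl⟩
    change substAlgHom (R := K) (hasSubst_of_zero hs) (subst β F) ∈ moved (fun i => subst s (β i)) J
    rw [substAlgHom_apply, hc]
    exact subst_mem_moved hF
  · rw [moved, Ideal.span_le]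
    rintro _ ⟨F, hF, rfl⟩
    change subst _ F ∈ _
    rw [← hc]
    exact subst_mem_moved (subst_mem_moved hF)

theorem moved_eq_map {s : Fin 2 → PS K} {φ : PS K ≃ₐ[K] PS K} (h : ∀ F, φ F = subst s F)
    (J : Ideal (PS K)) : moved s J = J.map φ := by
  rw [moved, Ideal.map]
  congr 1
  exact Set.image_congr fun F _ => (h F).symm

/-- Representatives that differ by a stable substitution move `I` to the same ideal. -/
theorem IsStaircase.moved_rep_eq (hI : IsStaircase I) {κ : Kind} {a b : K}
    {s β : Fin 2 → PS K} (hs : IsCoordinates s)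
    (hβ : ∀ e ∈ expSet I, powProd β e ∈ staircaseIdeal K (isUpperSet_expSet I))
    (h : κ.rep a b = fun i => subst s (β i)) : moved (κ.rep a b) I = moved s I := by
  obtain ⟨u, hu, key⟩ := exists_unit_aeval_coordFun hs.constantCoeff_eq_zero hβ h
  refine ((hI.isPluckerVector_moved_subst hs ⟨baseCoord I, fun h0 => ?_⟩).eq_of_proportional
    (hI.isPluckerVector_moved κ a b) key).symm
  have := key (baseCoord I)
  rw [h0, coordFun_baseCoord, map_one, mul_zero] at this
  exact one_ne_zero this

theorem moved_hSubst_eq (hI : IsStaircase I) (hS : Kind.m32.HasStab K (expSet I)) (a b : K) :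
    moved (hSubst a b) I = moved (hSubst a 0) (moved (hSubst 0 b) I) := by
  obtain ⟨β, hβ, h⟩ := exists_hSubst_eq_comp (isUpperSet_expSet I) hS.1 hS.2.1 a b
  rw [moved_subst (constantCoeff_hSubst _ _) (constantCoeff_hSubst _ _)]
  exact hI.moved_rep_eq (κ := .m32) ((isCoordinates_hSubst a 0).comp (isCoordinates_hSubst 0 b))
    hβ h

theorem moved_hSubst_eq' (hI : IsStaircase I) (hS : Kind.m32.HasStab K (expSet I)) (a b : K) :
    moved (hSubst a b) I = moved (hSubst 0 b) (moved (hSubst a 0) I) := by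
  obtain ⟨β, hβ, h⟩ := exists_hSubst_eq_comp' (isUpperSet_expSet I) hS.1 hS.2.1 a b
  rw [moved_subst (constantCoeff_hSubst _ _) (constantCoeff_hSubst _ _)]
  exact hI.moved_rep_eq (κ := .m32) ((isCoordinates_hSubst 0 b).comp (isCoordinates_hSubst a 0))
    hβ h

end Movement

/-! ### Triviality of the stabilizer, and pure powers among the coordinates. -/

section Stabilizer

variable {K : Type*} [Field K] {I : Ideal (PS K)}

/-- The exponent p - k of x fixes the number k of factors a y² + b y³ used, and the lowest exponent
q + 2k of y forces a y² from each of them. Thus b plays no role. -/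
theorem coeff_gSubst_pow {A : Type*} [CommRing A] (a b : A) {p q k : ℕ} (hk : k ≤ p) :
    coeff (ee (p - k) (q + 2 * k)) (powProd (gSubst a b) (ee p q)) = p.choose k * a ^ k := by
  classical
  have hterm : powProd (gSubst a b) (ee p q) =
      ∑ k ∈ Finset.range (p + 1), ∑ j ∈ Finset.range (k + 1),
        monomial (ee (p - k) (q + 2 * k + j))
          (p.choose k * k.choose j * a ^ (k - j) * b ^ j : A) := by
    have h0 : gSubst a b 0 = X 1 ^ 2 * (C b * X 1 + C a) + X 0 := by
      simp only [gSubst, Matrix.cons_val_zero]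
      ring
    have h1 : gSubst a b 1 = X 1 := rfl
    rw [powProd, h0, h1, ee_zero, ee_one, add_pow, Finset.sum_mul]
    refine Finset.sum_congr rfl fun k _ => ?_
    rw [mul_pow, add_pow, Finset.mul_sum, Finset.sum_mul, Finset.sum_mul, Finset.sum_mul]
    refine Finset.sum_congr rfl fun j _ => ?_
    rw [monomial_ee]
    simp only [mul_pow, pow_add, pow_mul, map_mul, map_pow, map_natCast]
    ring
  rw [hterm]
  simp only [map_sum, coeff_monomial, ee_inj]
  rw [Finset.sum_eq_single k, Finset.sum_eq_single 0]
  · simp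
  · intro j _ hj
    rw [if_neg]
    omega
  · intro h; simp at h
  · intro k' hk' hne
    refine Finset.sum_eq_zero fun j _ => ?_
    rw [Finset.mem_range] at hk'
    rw [if_neg]
    omega
  · intro h; simp at h; omega

theorem powProd_mem_of_moved_eq {s : Fin 2 → PS K} (hs : ∀ i, constantCoeff (s i) = 0)
    (h : moved s I = I) {e : Fin 2 →₀ ℕ} (he : e ∈ expSet I) : powProd s e ∈ I := by
  have := subst_mem_moved (s := s) he
  rwa [h, subst_monomial_one hs] at this

/-- Only the trivial representative fixes `I`. -/
theorem IsStaircase.eq_zero_of_moved_eq (hI : IsStaircase I) {κ : Kind}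
    (hS : κ.HasStab K (expSet I)) {a b : K} (h : moved (κ.rep a b) I = I) : a = 0 ∧ b = 0 := by
  have hmem := fun e => powProd_mem_of_moved_eq (e := e) (κ.constantCoeff_rep a b) h
  cases κ with
  | m41 =>
    have ha : a = 0 := by
      by_contra ha
      -- A nonzero a would make the exponents stable for r = 2, hence also for r = 3, against the
      -- minimality of 4. Once a = 0, a nonzero b gives r = 3 directly.
      refine hS.2.2 (StabX.succ (isUpperSet_expSet I) (r := 2) fun p q k hpq hk hne => ?_)
      by_contra hnot
      have h1 := hI.mem_iff.1 (hmem _ hpq) _ hnot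
      change coeff _ (powProd (gSubst a b) _) = 0 at h1
      rw [coeff_gSubst_pow a b hk] at h1
      exact mul_ne_zero hne (pow_ne_zero _ ha) h1
    refine ⟨ha, ?_⟩
    by_contra hb
    refine hS.2.2 fun p q k hpq hk hne => ?_
    by_contra hnot
    have h1 := hI.mem_iff.1 (hmem _ hpq) _ hnot
    have h2 := coeff_shear (r := 3) (s := 1) (by omega) b 0 hk (Nat.zero_le q)
    have h3 : powProd (Kind.m41.rep a b) (ee p q) =
        (X 0 + C b * X 1 ^ 3) ^ p * (X 1 + C 0 * X 0 ^ 1) ^ q := by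
      simp [powProd, Kind.rep, gSubst, ha]
    rw [mul_zero, add_zero, Nat.sub_zero, ← h3, h1] at h2
    exact mul_ne_zero hne (pow_ne_zero k hb) (by simpa using h2.symm)
  | m32 =>
    have h3 : ∀ p q, powProd (Kind.m32.rep a b) (ee p q) =
        (X 0 + C a * X 1 ^ 2) ^ p * (X 1 + C b * X 0 ^ 1) ^ q := by
      intro p q
      simp [powProd, Kind.rep, hSubst]
    constructor
    · by_contra ha
      refine hS.2.2.1 fun p q k hpq hk hne => ?_
      by_contra hnot
      have h1 := hI.mem_iff.1 (hmem _ hpq) _ hnot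
      have h2 := coeff_shear (r := 2) (s := 1) (by omega) a b hk (Nat.zero_le q)
      rw [mul_zero, add_zero, Nat.sub_zero, ← h3, h1] at h2
      exact mul_ne_zero hne (pow_ne_zero k ha) (by simpa using h2.symm)
    · by_contra hb
      refine hS.2.2.2 fun p q l hpq hl hne => ?_
      by_contra hnot
      have h1 := hI.mem_iff.1 (hmem _ hpq) _ hnot
      have h2 := coeff_shear (r := 2) (s := 1) (by omega) a b (Nat.zero_le p) hl
      rw [mul_zero, add_zero, Nat.sub_zero, ← h3, h1] at h2
      exact mul_ne_zero hne (pow_ne_zero l hb) (by simpa using h2.symm)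

/-- The exponent vectors of the coordinate functions. -/
def exponents (κ : Kind) (I : Ideal (PS K)) : Set (Fin 2 →₀ ℕ) :=
  {e | ∃ c : Coord I, e ∈ (coordFun κ I c).support}

theorem finite_exponents (κ : Kind) (I : Ideal (PS K)) : (exponents κ I).Finite := by
  have : exponents κ I = ⋃ c : Coord I, ((coordFun κ I c).support : Set (Fin 2 →₀ ℕ)) := by
    ext e; simp [exponents]
  rw [this]
  exact Set.finite_iUnion fun c => Finset.finite_toSet _

theorem zero_mem_exponents (κ : Kind) (I : Ideal (PS K)) : (0 : Fin 2 →₀ ℕ) ∈ exponents κ I := by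
  refine ⟨baseCoord I, ?_⟩
  rw [coordFun_baseCoord, MvPolynomial.mem_support_iff, MvPolynomial.coeff_zero_one]
  exact one_ne_zero

theorem IsStaircase.moved_eq_of_aeval_eq (hI : IsStaircase I) {κ : Kind} {J : Ideal (PS K)}
    {P : Coord I → K} (hP : IsPluckerVector I J P) {μ a b : K}
    (h : ∀ c, MvPolynomial.aeval ![a, b] (coordFun κ I c) = μ * P c) : J = moved (κ.rep a b) I :=
  hP.eq_of_proportional (hI.isPluckerVector_moved κ a b) h

theorem aeval_eq_of_forall {κ : Kind} {a b : K}
    (h : ∀ e ∈ exponents κ I, e ≠ 0 → a ^ e 0 * b ^ e 1 = 0) (c : Coord I) :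
    MvPolynomial.aeval ![a, b] (coordFun κ I c) =
      MvPolynomial.aeval ![(0 : K), 0] (coordFun κ I c) := by
  obtain ⟨e, l, hel, hl⟩ := exists_coordFun_eq_monomial κ c
  rw [hel]
  simp only [MvPolynomial.aeval_monomial, Finsupp.prod_fintype _ _ (fun i => pow_zero _),
    Fin.prod_univ_two, Matrix.cons_val_zero, Matrix.cons_val_one, Matrix.cons_val_fin_one]
  by_cases h0 : l = 0
  · simp [h0]
  by_cases he : e = 0
  · simp [he]
  rw [h e ⟨c, hl h0⟩ he, mul_zero]
  have : e 0 ≠ 0 ∨ e 1 ≠ 0 := by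
    by_contra hcon
    push Not at hcon
    apply he
    ext i; fin_cases i
    · exact hcon.1
    · exact hcon.2
  rcases this with h | h <;> simp [h]

theorem IsStaircase.moved_eq_self_of_forall (hI : IsStaircase I) {κ : Kind} {a b : K}
    (h : ∀ e ∈ exponents κ I, e ≠ 0 → a ^ e 0 * b ^ e 1 = 0) : moved (κ.rep a b) I = I := by
  have h0 := hI.moved_eq_of_aeval_eq (hI.isPluckerVector_moved κ a b) (μ := 1) (a := 0) (b := 0)
    (fun c => by rw [one_mul, aeval_eq_of_forall h])
  rw [h0, κ.rep_zero, moved_X]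

/-- Without a pure power of a among the coordinates, all nonconstant ones vanish at (1, 0), so (1,
0) has the same coordinates as (0, 0) and would fix I. -/
theorem IsStaircase.exists_axis_zero (hI : IsStaircase I) {κ : Kind}
    (hS : κ.HasStab K (expSet I)) : ∃ e ∈ exponents κ I, e 1 = 0 ∧ 0 < e 0 := by
  by_contra hcon
  push Not at hcon
  refine one_ne_zero (hI.eq_zero_of_moved_eq hS (hI.moved_eq_self_of_forall
    (a := 1) (b := 0) fun e he hne => ?_)).1
  by_cases h1 : e 1 = 0
  · exfalso
    apply hne
    ext i; fin_cases i
    · simpa using hcon e he h1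
    · exact h1
  · simp [h1]

theorem IsStaircase.exists_axis_one (hI : IsStaircase I) {κ : Kind}
    (hS : κ.HasStab K (expSet I)) : ∃ e ∈ exponents κ I, e 0 = 0 ∧ 0 < e 1 := by
  by_contra hcon
  push Not at hcon
  refine one_ne_zero (hI.eq_zero_of_moved_eq hS (hI.moved_eq_self_of_forall
    (a := 0) (b := 1) fun e he hne => ?_)).2
  by_cases h1 : e 0 = 0
  · exfalso
    apply hne
    ext i; fin_cases i
    · exact h1
    · simpa using hcon e he h1
  · simp [h1]

end Stabilizer

/-! ### Flat limits as torus-fixed points. -/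

section Limits

variable {K : Type*} [Field K] {I : Ideal (PS K)} {κ : Kind}

/-- The ideal `J` is the torus-fixed point belonging to the exponent vector `w`. -/
def IsVertexIdeal (κ : Kind) (I J : Ideal (PS K)) (w : Fin 2 →₀ ℕ) : Prop :=
  ∃ μ : K, μ ≠ 0 ∧ IsPluckerVector I J (fun c => μ * (coordFun κ I c).coeff w)

/-- If the leading coefficients of the minors pick out the coordinates with exponent w, the limit is
the ideal of w. The frame g is returned as well, so that a second limit can start from it. -/
theorem isVertexIdeal_flatLimit {J : Ideal (PS K)} {f : Row I → PS K}
    (hf : IsFrame (colength I) J f) {s : Fin 2 → PS (Polynomial K)} (hs : IsCoordinates s) {D : ℕ}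
    {Q : Coord I → K} {μ : K} (hμ : μ ≠ 0) {w : Fin 2 →₀ ℕ} (hw : w ∈ exponents κ I)
    (hD : ∀ c, (pl ((cmat (colength I) f).map (algebraMap K (Polynomial K)) *
      tmat (colength I) s) c).natDegree ≤ D)
    (hQ : ∀ c, (pl ((cmat (colength I) f).map (algebraMap K (Polynomial K)) *
      tmat (colength I) s) c).coeff D = Q c)
    (hQμ : ∀ c, Q c = μ * (coordFun κ I c).coeff w) :
    ∃ c₀, Q c₀ ≠ 0 ∧ IsVertexIdeal κ I (flatLimit (moved s J)) w ∧
      ∃ g : Row I → PS K, IsFrame (colength I) (flatLimit (moved s J)) g ∧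
        cmat (colength I) g = replaceRows Q c₀ := by
  obtain ⟨c₀, hc₀⟩ := hw
  have hQ0 : Q c₀ ≠ 0 := by
    rw [hQμ]
    exact mul_ne_zero hμ (MvPolynomial.mem_support_iff.1 hc₀)
  obtain ⟨g, hg⟩ := exists_cmat_eq (K := K) (replaceRows Q c₀)
  have hframe := isFrame_flatLimit hf hs hD hQ hQ0 hg
  have hpl := pl_replaceRows hD hQ hQ0
  refine ⟨c₀, hQ0, ⟨Q c₀ ^ (Fintype.card (Row I) - 1) * μ,
    mul_ne_zero (pow_ne_zero _ hQ0) hμ, ?_⟩, g, hframe, hg⟩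
  rw [isPluckerVector_iff]
  refine ⟨Function.ne_iff.2 ⟨c₀, mul_ne_zero (mul_ne_zero (pow_ne_zero _ hQ0) hμ)
    (MvPolynomial.mem_support_iff.1 hc₀)⟩, g, hframe, fun c => ?_⟩
  rw [hg, hpl, hQμ c, mul_assoc]

/-- The bivariate monomials `t ^ m * s ^ n` as iterated polynomials in `t` over `K[s]`. -/
noncomputable def biMonomial (l : K) (n m : ℕ) : Polynomial (Polynomial K) :=
  Polynomial.C (Polynomial.C l * Polynomial.X ^ n) * Polynomial.X ^ m

/-- A limit along `σ₁` and a second limit along `σ₂`, computed from the coordinate functions: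
the parameters are `a`, `b`, polynomials in the variable `t` of `σ₁` and the variable of `σ₂`. -/
theorem two_step_limit (hI : IsStaircase I) (a b : Polynomial (Polynomial K))
    {σ₁ σ₂ : Fin 2 → PS (Polynomial K)} (hσ₁ : IsCoordinates σ₁) (hσ₂ : IsCoordinates σ₂)
    (hσ₂0 : (fun i => MvPowerSeries.map (Polynomial.evalRingHom 0) (σ₂ i)) = X)
    {u : Polynomial (Polynomial K)} (hu : IsUnit u)
    (hpl : ∀ c, MvPolynomial.aeval ![a, b] (coordFun κ I c) =
      u * pl (rowMat I (Polynomial (Polynomial K)) *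
        ((tmat (colength I) σ₁).map (Polynomial.mapRingHom Polynomial.C) *
        (tmat (colength I) σ₂).map Polynomial.C)) c)
    (p q : (Fin 2 →₀ ℕ) → ℕ) (θ : (Fin 2 →₀ ℕ) → K) (hθ : ∀ e, θ e ≠ 0)
    (hab : ∀ e, a ^ e 0 * b ^ e 1 = biMonomial (θ e) (q e) (p e))
    (hinj : ∀ e e', p e = p e' → q e = q e' → e = e')
    {w₀ : Fin 2 →₀ ℕ} (hw₀ : w₀ ∈ exponents κ I) (hq₀ : q w₀ = 0)
    (hmax : ∀ e ∈ exponents κ I, q e = 0 → p e ≤ p w₀) :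
    IsVertexIdeal κ I (flatLimit (moved σ₁ I)) w₀ ∧ (∀ e ∈ exponents κ I, p e ≤ p w₀) ∧
    ∀ w₁ ∈ exponents κ I, p w₁ = p w₀ → (∀ e ∈ exponents κ I, p e = p w₀ → q e ≤ q w₁) →
      IsVertexIdeal κ I (flatLimit (moved σ₂ (flatLimit (moved σ₁ I)))) w₁ := by
  obtain ⟨v, hv, rfl⟩ := Polynomial.isUnit_iff.1 hu
  obtain ⟨u, hu', rfl⟩ := Polynomial.isUnit_iff.1 hv
  have hu0 : u ≠ 0 := hu'.ne_zero
  set T := rowMat I (Polynomial (Polynomial K)) *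
        ((tmat (colength I) σ₁).map (Polynomial.mapRingHom Polynomial.C) *
        (tmat (colength I) σ₂).map Polynomial.C) with hT
  -- Each minor of the composite is a single term in the two variables, with the unit u divided out.
  have hmon : ∀ c, ∃ e l, coordFun κ I c = MvPolynomial.monomial e l ∧
      (l ≠ 0 → e ∈ exponents κ I) ∧ pl T c = biMonomial (u⁻¹ * (l * θ e)) (q e) (p e) := by
    intro c
    obtain ⟨e, l, hel, hl⟩ := exists_coordFun_eq_monomial κ c
    refine ⟨e, l, hel, fun h => ⟨c, hl h⟩, ?_⟩
    have h1 := hpl c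
    rw [hel, MvPolynomial.aeval_monomial, Finsupp.prod_fintype _ _ (fun i => pow_zero _),
      Fin.prod_univ_two] at h1
    simp only [Matrix.cons_val_zero, Matrix.cons_val_one, Matrix.cons_val_fin_one] at h1
    rw [hab] at h1
    have h2 : Polynomial.C (Polynomial.C u⁻¹) * Polynomial.C (Polynomial.C u) =
        (1 : Polynomial (Polynomial K)) := by
      rw [← map_mul, ← map_mul, inv_mul_cancel₀ hu0, map_one, map_one]
    have h3 : pl T c = Polynomial.C (Polynomial.C u⁻¹) *
        (algebraMap K (Polynomial (Polynomial K)) l * biMonomial (θ e) (q e) (p e)) := by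
      rw [h1, ← mul_assoc, h2, one_mul]
    rw [h3]
    have h4 : algebraMap K (Polynomial (Polynomial K)) l = Polynomial.C (Polynomial.C l) := rfl
    rw [h4]
    simp only [biMonomial, map_mul]
    ring
  -- the first limit
  have hev : ∀ c, pl (rowMat I (Polynomial K) * tmat (colength I) σ₁) c =
      Polynomial.mapRingHom (Polynomial.evalRingHom 0) (pl T c) := by
    intro c
    rw [← pl_map, hT, Matrix.map_mul, Matrix.map_mul]
    congr 1
    have h1 : ((tmat (colength I) σ₂).map Polynomial.C).map
        (Polynomial.mapRingHom (Polynomial.evalRingHom (0 : K))) = 1 := by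
      have := tmat_map (Polynomial.evalRingHom (0 : K)) (colength I) σ₂
      rw [hσ₂0, tmat_X] at this
      refine Matrix.ext fun i j => ?_
      have h : Polynomial.evalRingHom (0 : K) (tmat (colength I) σ₂ i j) =
          (1 : Matrix (LowExp (colength I)) (LowExp (colength I)) K) i j :=
        (congrFun (congrFun this i) j).symm
      change Polynomial.map (Polynomial.evalRingHom (0 : K))
        (Polynomial.C (tmat (colength I) σ₂ i j)) = _
      rw [Polynomial.map_C, h]
      by_cases hij : i = j
      · subst hij
        rw [Matrix.one_apply_eq, Matrix.one_apply_eq, map_one]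
      · rw [Matrix.one_apply_ne hij, Matrix.one_apply_ne hij, map_zero]
    have h2 : ((tmat (colength I) σ₁).map (Polynomial.mapRingHom Polynomial.C)).map
        (Polynomial.mapRingHom (Polynomial.evalRingHom (0 : K))) = tmat (colength I) σ₁ := by
      ext1 i j
      simp only [Matrix.map_apply, Polynomial.coe_mapRingHom, Polynomial.map_map]
      have : (Polynomial.evalRingHom (0 : K)).comp Polynomial.C = RingHom.id K := by
        ext x; simp
      rw [this, Polynomial.map_id]
    rw [h1, h2, Matrix.mul_one]
    congr 1
    ext1 i j
    simp only [rowMat, Matrix.map_apply]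
    have : ∀ x : K, algebraMap K (Polynomial (Polynomial K)) x = Polynomial.C (Polynomial.C x) :=
      fun _ => rfl
    simp [this, Polynomial.algebraMap_eq]
  -- Setting the second variable to 0 turns σ₂ into the identity and kills every term with q ≠ 0.
  -- Among the remaining ones p is injective, so degree p w₀ isolates the exponent w₀.
  have hQμ : ∀ c, (pl (rowMat I (Polynomial K) * tmat (colength I) σ₁) c).natDegree ≤ p w₀ ∧
      (pl (rowMat I (Polynomial K) * tmat (colength I) σ₁) c).coeff (p w₀) =
        (u⁻¹ * θ w₀) * (coordFun κ I c).coeff w₀ := by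
    intro c
    obtain ⟨e, l, hel, hl, hplT⟩ := hmon c
    have h1 : pl (rowMat I (Polynomial K) * tmat (colength I) σ₁) c =
        Polynomial.C (u⁻¹ * (l * θ e) * 0 ^ q e) * Polynomial.X ^ p e := by
      rw [hev, hplT, biMonomial]
      simp
    rw [h1, hel, MvPolynomial.coeff_monomial, Polynomial.coeff_C_mul_X_pow]
    by_cases hl0 : l = 0
    · simp [hl0]
    by_cases hq : q e = 0
    · have hle := hmax e (hl hl0) hq
      refine ⟨(Polynomial.natDegree_C_mul_X_pow_le _ _).trans hle, ?_⟩
      by_cases he : e = w₀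
      · subst he; simp [hq]; ring
      · rw [if_neg he, if_neg, mul_zero]
        intro h
        exact he (hinj e w₀ h.symm (by rw [hq, hq₀]))
    · rw [zero_pow hq, mul_zero, map_zero, zero_mul]
      refine ⟨by simp, ?_⟩
      have he : e ≠ w₀ := by rintro rfl; exact hq hq₀
      rw [if_neg he, ite_self, mul_zero]
  have hμ : u⁻¹ * θ w₀ ≠ 0 := mul_ne_zero (inv_ne_zero hu0) (hθ _)
  obtain ⟨c₀, hc₀, hJ, g, hgframe, hg⟩ := isVertexIdeal_flatLimit hI.isFrame hσ₁ hμ hw₀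
    (fun c => (hQμ c).1) (fun c => rfl) (fun c => (hQμ c).2)
  set Q : Coord I → K := fun c =>
    (pl (rowMat I (Polynomial K) * tmat (colength I) σ₁) c).coeff (p w₀) with hQ
  -- the second limit
  set M : Matrix (Row I) (LowExp (colength I)) (Polynomial (Polynomial K)) :=
    (rowMat I (Polynomial K) * tmat (colength I) σ₁).map (Polynomial.mapRingHom Polynomial.C)
    with hM
  have hTM : T = M * (tmat (colength I) σ₂).map Polynomial.C := by
    rw [hT, hM, Matrix.map_mul, ← Matrix.mul_assoc]
    congr 2
    ext1 i j
    have : ∀ x : K, algebraMap K (Polynomial (Polynomial K)) x = Polynomial.C (Polynomial.C x) :=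
      fun _ => rfl
    simp [rowMat, this, Polynomial.algebraMap_eq]
  have hMQ : ∀ c, (pl M c).natDegree ≤ p w₀ ∧ (pl M c).coeff (p w₀) = Polynomial.C (Q c) := by
    intro c
    rw [hM, pl_map, Polynomial.coe_mapRingHom, Polynomial.coeff_map]
    exact ⟨Polynomial.natDegree_map_le.trans (hQμ c).1, rfl⟩
  -- In degree p w₀ of the first variable, the minors of the composite are, up to a nonzero
  -- constant, those of the first limit moved by σ₂.
  have hstep : ∀ c, (pl T c).natDegree ≤ p w₀ ∧
      Polynomial.C (Q c₀) ^ (Fintype.card (Row I) - 1) * (pl T c).coeff (p w₀) =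
        pl ((cmat (colength I) g).map (algebraMap K (Polynomial K)) * tmat (colength I) σ₂) c := by
    intro c
    have h := natDegree_pl_mul_le (c₀ := c₀) (fun c => (hMQ c).1) (fun c => (hMQ c).2)
      (by rw [Ne, Polynomial.C_eq_zero]; exact hc₀) (tmat (colength I) σ₂) c
    rw [← hTM] at h
    rw [hg]
    exact h
  -- σ₂ does not involve the first variable, so it cannot raise the degree: the bound known for q =
  -- 0 extends to all exponents.
  have hbound : ∀ e ∈ exponents κ I, p e ≤ p w₀ := by
    rintro e ⟨c, hc⟩
    obtain ⟨e', l, hel, hl, hplT⟩ := hmon c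
    have hc' := hc
    rw [hel, MvPolynomial.mem_support_iff, MvPolynomial.coeff_monomial] at hc'
    have he : e' = e := by by_contra h; rw [if_neg h] at hc'; exact hc' rfl
    subst he
    rw [if_pos rfl] at hc'
    have := (hstep c).1
    rwa [hplT, biMonomial, Polynomial.natDegree_C_mul_X_pow] at this
    rw [Ne, Polynomial.C_mul_X_pow_eq_monomial, Polynomial.monomial_eq_zero_iff]
    exact mul_ne_zero (inv_ne_zero hu0) (mul_ne_zero hc' (hθ _))
  refine ⟨hJ, hbound, fun w₁ hw₁ hp₁ hmax₁ => ?_⟩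
  -- Only exponents on the edge p = p w₀ survive the first limit, and on this edge q is injective;
  -- the largest q isolates w₁.
  have hQ₁ : ∀ c, (pl ((cmat (colength I) g).map (algebraMap K (Polynomial K)) *
        tmat (colength I) σ₂) c).natDegree ≤ q w₁ ∧
      (pl ((cmat (colength I) g).map (algebraMap K (Polynomial K)) *
        tmat (colength I) σ₂) c).coeff (q w₁) =
        (Q c₀ ^ (Fintype.card (Row I) - 1) * u⁻¹ * θ w₁) * (coordFun κ I c).coeff w₁ := by
    intro c
    obtain ⟨e, l, hel, hl, hplT⟩ := hmon c
    rw [← (hstep c).2, ← Polynomial.C_pow, hplT, biMonomial, Polynomial.coeff_C_mul_X_pow, hel,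
      MvPolynomial.coeff_monomial]
    by_cases hl0 : l = 0
    · simp [hl0]
    by_cases hp : p e = p w₀
    · rw [if_pos hp.symm, ← mul_assoc, ← map_mul, Polynomial.coeff_C_mul_X_pow]
      refine ⟨(Polynomial.natDegree_C_mul_X_pow_le _ _).trans (hmax₁ e (hl hl0) hp), ?_⟩
      by_cases he : e = w₁
      · subst he
        rw [if_pos rfl, if_pos rfl]
        ring
      · rw [if_neg he, if_neg, mul_zero]
        intro h
        exact he (hinj e w₁ (by rw [hp, hp₁]) h.symm)
    · have he : e ≠ w₁ := by rintro rfl; exact hp hp₁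
      rw [if_neg (Ne.symm hp), if_neg he]
      simp
  exact (isVertexIdeal_flatLimit hgframe hσ₂
    (mul_ne_zero (mul_ne_zero (pow_ne_zero _ hc₀) (inv_ne_zero hu0)) (hθ w₁)) hw₁
    (fun c => (hQ₁ c).1) (fun c => rfl) (fun c => (hQ₁ c).2)).choose_spec.2.1

end Limits

/-! ### Normal cones and directions near a ray. -/

section Fan

variable {K : Type*} [Field K] {I : Ideal (PS K)} {κ : Kind}

/-- The pairing of a direction with a point of the plane. -/
def pairing (u v : ℝ × ℝ) : ℝ := u.1 * v.1 + u.2 * v.2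

theorem expPoint_injective : Function.Injective expPoint := by
  intro e e' h
  simp only [expPoint, Prod.mk.injEq, Nat.cast_inj] at h
  ext i; fin_cases i
  · exact h.1
  · exact h.2

theorem pairing_expPoint_add (u : ℝ × ℝ) (e e' : Fin 2 →₀ ℕ) :
    pairing u (expPoint (e + e')) = pairing u (expPoint e) + pairing u (expPoint e') := by
  simp only [pairing, expPoint, Finsupp.add_apply, Nat.cast_add]
  ring

theorem expPoint_mem_hull {e : Fin 2 →₀ ℕ} (he : e ∈ exponents κ I) : expPoint e ∈ hull κ I :=
  subset_convexHull _ _ ⟨e, he, rfl⟩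

theorem pairing_le_of_mem_hull {u : ℝ × ℝ} {t : ℝ}
    (h : ∀ e ∈ exponents κ I, pairing u (expPoint e) ≤ t) {v : ℝ × ℝ} (hv : v ∈ hull κ I) :
    pairing u v ≤ t := by
  have hconv : Convex ℝ {v : ℝ × ℝ | pairing u v ≤ t} := by
    intro x hx y hy a b ha hb hab
    simp only [Set.mem_ofPred_eq, pairing, Prod.fst_add, Prod.snd_add, Prod.smul_fst, Prod.smul_snd,
      smul_eq_mul] at hx hy ⊢
    have h1 := mul_le_mul_of_nonneg_left hx ha
    have h2 := mul_le_mul_of_nonneg_left hy hb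
    have h3 : t = a * t + b * t := by rw [← add_mul, hab, one_mul]
    linarith
  refine convexHull_min ?_ hconv hv
  rintro _ ⟨e, he, rfl⟩
  exact h e he

theorem mem_normalCone_hull {u w : ℝ × ℝ} : u ∈ normalCone (hull κ I) w ↔
    ∀ e ∈ exponents κ I, pairing u (expPoint e) ≤ pairing u w :=
  ⟨fun h _ he => h _ (expPoint_mem_hull he), fun h _ hv => pairing_le_of_mem_hull h hv⟩

/-- The ideals corresponding to the cone of `Δ(I)` next to the ray through `u` on the side
of `u'`. -/
def beside (κ : Kind) (I : Ideal (PS K)) (u u' : ℝ × ℝ) : Set (Ideal (PS K)) :=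
  {J | ∃ σ ∈ standardFan κ I, u ∈ σ ∧
    (∃ δ : ℝ, 0 < δ ∧ ∀ ε : ℝ, 0 < ε → ε < δ → u + ε • u' ∈ σ) ∧ J ∈ torusOrbit κ I σ}

theorem clockwise_eq_beside (u : ℝ × ℝ) : clockwise κ I u = beside κ I u (u.2, -u.1) := by
  have : ∀ ε : ℝ, u + ε • ((u.2, -u.1) : ℝ × ℝ) = (u.1 + ε * u.2, u.2 - ε * u.1) := by
    intro ε
    ext
    · simp
    · simp; ring
  simp only [clockwise, beside, this]

theorem counterclockwise_eq_beside (u : ℝ × ℝ) :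
    counterclockwise κ I u = beside κ I u (-u.2, u.1) := by
  have : ∀ ε : ℝ, u + ε • ((-u.2, u.1) : ℝ × ℝ) = (u.1 - ε * u.2, u.2 + ε * u.1) := by
    intro ε
    ext
    · simp; ring
    · simp
  simp only [counterclockwise, beside, this]

theorem pairing_add_smul (u u' v : ℝ × ℝ) (ε : ℝ) :
    pairing (u + ε • u') v = pairing u v + ε * pairing u' v := by
  simp only [pairing, Prod.fst_add, Prod.snd_add, Prod.smul_fst, Prod.smul_snd, smul_eq_mul]
  ring

theorem eq_of_pairing_eq {u u' v w : ℝ × ℝ} (hdet : u.1 * u'.2 - u.2 * u'.1 ≠ 0)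
    (h : pairing u v = pairing u w) (h' : pairing u' v = pairing u' w) : v = w := by
  simp only [pairing] at h h'
  ext
  · apply mul_left_cancel₀ hdet
    linear_combination u'.2 * h - u.2 * h'
  · apply mul_left_cancel₀ hdet
    linear_combination u.1 * h' - u'.1 * h

/-- A lexicographically maximal exponent is strictly maximal in all nearby directions. -/
theorem exists_strict_direction {u u' : ℝ × ℝ} {w : Fin 2 →₀ ℕ}
    (hdet : u.1 * u'.2 - u.2 * u'.1 ≠ 0)
    (hu : ∀ e ∈ exponents κ I, pairing u (expPoint e) ≤ pairing u (expPoint w))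
    (hu' : ∀ e ∈ exponents κ I, pairing u (expPoint e) = pairing u (expPoint w) →
      pairing u' (expPoint e) ≤ pairing u' (expPoint w)) :
    ∃ δ : ℝ, 0 < δ ∧ ∀ ε : ℝ, 0 < ε → ε < δ → ∀ e ∈ exponents κ I, e ≠ w →
      pairing (u + ε • u') (expPoint e) < pairing (u + ε • u') (expPoint w) := by
  have key : ∀ e ∈ exponents κ I, ∃ δ : ℝ, 0 < δ ∧ ∀ ε : ℝ, 0 < ε → ε < δ → e ≠ w →
      pairing (u + ε • u') (expPoint e) < pairing (u + ε • u') (expPoint w) := by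
    intro e he
    rcases (hu e he).eq_or_lt with h | h
    · refine ⟨1, one_pos, fun ε hε _ hne => ?_⟩
      have hlt : pairing u' (expPoint e) < pairing u' (expPoint w) :=
        lt_of_le_of_ne (hu' e he h) fun h' =>
          hne (expPoint_injective (eq_of_pairing_eq hdet h h'))
      rw [pairing_add_smul, pairing_add_smul, h]
      have := mul_lt_mul_of_pos_left hlt hε
      linarith
    -- g is the gap in the direction u and m bounds what one unit of u' can make up, so the
    -- comparison is safe for ε < g / m.
    · set g := pairing u (expPoint w) - pairing u (expPoint e) with hg
      set m := |pairing u' (expPoint e) - pairing u' (expPoint w)| + 1 with hm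
      have hgpos : 0 < g := by rw [hg]; linarith
      have hmpos : 0 < m := by positivity
      refine ⟨g / m, by positivity, fun ε hε hlt _ => ?_⟩
      rw [lt_div_iff₀ hmpos] at hlt
      rw [pairing_add_smul, pairing_add_smul]
      have h1 : pairing u' (expPoint e) - pairing u' (expPoint w) ≤ m := by
        rw [hm]
        have := le_abs_self (pairing u' (expPoint e) - pairing u' (expPoint w))
        linarith
      have h2 := mul_le_mul_of_nonneg_left h1 hε.le
      rw [mul_sub] at h2
      linarith
  choose! δ hδ hkey using key
  have hfin := finite_exponents κ I
  obtain ⟨e₁, he₁, hmin₁⟩ := Set.exists_min_image (exponents κ I) δ hfin ⟨0, zero_mem_exponents κ I⟩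
  exact ⟨δ e₁, hδ e₁ he₁, fun ε hε hlt e he => hkey e he ε hε (hlt.trans_le (hmin₁ e he))⟩

end Fan

/-! ### Torus-fixed points of the closure. -/

section Leading

variable {K : Type*} [Field K] {I : Ideal (PS K)} {κ : Kind}

/-- Leading coefficients in the direction `u` are multiplicative. -/
theorem coeff_mul_of_dominated {u : ℝ × ℝ} {f g : MvPolynomial (Fin 2) K} {w w' : Fin 2 →₀ ℕ}
    (hf : ∀ e ∈ f.support, e ≠ w → pairing u (expPoint e) < pairing u (expPoint w))
    (hg : ∀ e ∈ g.support, e ≠ w' → pairing u (expPoint e) < pairing u (expPoint w')) :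
    (∀ e ∈ (f * g).support, e ≠ w + w' →
      pairing u (expPoint e) < pairing u (expPoint (w + w'))) ∧
    (f * g).coeff (w + w') = f.coeff w * g.coeff w' := by
  classical
  have key : ∀ x : (Fin 2 →₀ ℕ) × (Fin 2 →₀ ℕ), x ≠ (w, w') → f.coeff x.1 * g.coeff x.2 ≠ 0 →
      pairing u (expPoint (x.1 + x.2)) < pairing u (expPoint (w + w')) := by
    intro x hx hne
    have h1 := hf x.1 (MvPolynomial.mem_support_iff.2 (left_ne_zero_of_mul hne))
    have h2 := hg x.2 (MvPolynomial.mem_support_iff.2 (right_ne_zero_of_mul hne))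
    rw [pairing_expPoint_add, pairing_expPoint_add]
    by_cases hx1 : x.1 = w
    · have hx2 : x.2 ≠ w' := fun h => hx (Prod.ext hx1 h)
      rw [hx1]
      have := h2 hx2
      linarith
    · have h1 := h1 hx1
      by_cases hx2 : x.2 = w'
      · rw [hx2]; linarith
      · have := h2 hx2; linarith
  constructor
  · intro e he hne
    rw [MvPolynomial.mem_support_iff, MvPolynomial.coeff_mul] at he
    obtain ⟨x, hx, hx0⟩ := Finset.exists_ne_zero_of_sum_ne_zero he
    rw [Finset.HasAntidiagonal.mem_antidiagonal] at hx
    rw [← hx]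
    refine key x ?_ hx0
    rintro rfl
    exact hne hx.symm
  · rw [MvPolynomial.coeff_mul, Finset.sum_eq_single (w, w')]
    · intro x hx hne
      by_contra h0
      have := key x hne h0
      rw [Finset.HasAntidiagonal.mem_antidiagonal.1 hx] at this
      exact lt_irrefl _ this
    · intro h
      rw [Finset.HasAntidiagonal.mem_antidiagonal] at h
      exact absurd rfl h

theorem coeff_prod_of_dominated {u : ℝ × ℝ} {ι : Type*} {f : ι → MvPolynomial (Fin 2) K}
    {w : Fin 2 →₀ ℕ}
    (hf : ∀ i, ∀ e ∈ (f i).support, e ≠ w → pairing u (expPoint e) < pairing u (expPoint w))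
    (s : Finset ι) (m : ι → ℕ) :
    (∀ e ∈ (∏ i ∈ s, f i ^ m i).support, e ≠ (∑ i ∈ s, m i) • w →
      pairing u (expPoint e) < pairing u (expPoint ((∑ i ∈ s, m i) • w))) ∧
    (∏ i ∈ s, f i ^ m i).coeff ((∑ i ∈ s, m i) • w) = ∏ i ∈ s, (f i).coeff w ^ m i := by
  classical
  have h1 : (∀ e ∈ (1 : MvPolynomial (Fin 2) K).support, e ≠ 0 →
      pairing u (expPoint e) < pairing u (expPoint 0)) := by
    intro e he hne
    rw [MvPolynomial.mem_support_iff, MvPolynomial.coeff_one, if_neg hne.symm] at he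
    exact absurd rfl he
  have hpow : ∀ i n, (∀ e ∈ (f i ^ n).support, e ≠ n • w →
      pairing u (expPoint e) < pairing u (expPoint (n • w))) ∧
      (f i ^ n).coeff (n • w) = (f i).coeff w ^ n := by
    intro i n
    induction n with
    | zero => simp
    | succ n ih =>
      have := coeff_mul_of_dominated ih.1 (hf i)
      rw [pow_succ, succ_nsmul, pow_succ, ← ih.2]
      exact this
  induction s using Finset.induction_on with
  | empty => simp
  | insert i s hi ih =>
    have := coeff_mul_of_dominated (hpow i (m i)).1 ih.1
    rw [Finset.prod_insert hi, Finset.sum_insert hi, Finset.prod_insert hi, add_smul,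
      ← (hpow i (m i)).2, ← ih.2]
    exact this

theorem sum_support_eq_of_isHomogeneous {ι R : Type*} [CommRing R] {n : ℕ} {Φ : MvPolynomial ι R}
    (hΦ : Φ.IsHomogeneous n) {d : ι →₀ ℕ} (hd : d ∈ Φ.support) : ∑ i ∈ d.support, d i = n := by
  have h := hΦ (MvPolynomial.mem_support_iff.1 hd)
  rw [← h, Finsupp.weight_apply, Finsupp.sum]
  simp

theorem eval_mul_of_isHomogeneous {ι R : Type*} [CommRing R] {n : ℕ} {Φ : MvPolynomial ι R}
    (hΦ : Φ.IsHomogeneous n) (μ : R) (P : ι → R) :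
    MvPolynomial.eval (fun c => μ * P c) Φ = μ ^ n * MvPolynomial.eval P Φ := by
  rw [MvPolynomial.eval_eq, MvPolynomial.eval_eq, Finset.mul_sum]
  refine Finset.sum_congr rfl fun d hd => ?_
  have hdeg := sum_support_eq_of_isHomogeneous hΦ hd
  simp only [mul_pow, Finset.prod_mul_distrib, Finset.prod_pow_eq_pow_sum, hdeg]
  ring

theorem InClosure.mul {P : Coord I → K} (h : InClosure κ I P) (μ : K) :
    InClosure κ I (fun c => μ * P c) := by
  intro n Φ hΦ h0
  rw [eval_mul_of_isHomogeneous hΦ, h n Φ hΦ h0, mul_zero]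

/-- Taking the coefficient of n • w in a homogeneous relation of degree n between the coordinate
functions leaves the relation evaluated at their coefficients of w, since w strictly dominates in
the direction u. -/
theorem inClosure_of_dominated {u : ℝ × ℝ} {w : Fin 2 →₀ ℕ}
    (h : ∀ e ∈ exponents κ I, e ≠ w → pairing u (expPoint e) < pairing u (expPoint w)) :
    InClosure κ I (fun c => (coordFun κ I c).coeff w) := by
  intro n Φ hΦ h0
  have hf : ∀ c, ∀ e ∈ (coordFun κ I c).support, e ≠ w →
      pairing u (expPoint e) < pairing u (expPoint w) := fun c e he => h e ⟨c, he⟩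
  have h1 : (MvPolynomial.aeval (coordFun κ I) Φ).coeff (n • w) = 0 := by
    rw [h0, MvPolynomial.coeff_zero]
  rw [MvPolynomial.aeval_def, MvPolynomial.eval₂_eq, MvPolynomial.coeff_sum] at h1
  rw [MvPolynomial.eval_eq, ← h1]
  refine Finset.sum_congr rfl fun d hd => ?_
  have hdeg := sum_support_eq_of_isHomogeneous hΦ hd
  rw [MvPolynomial.algebraMap_eq, MvPolynomial.coeff_C_mul, ← hdeg,
    (coeff_prod_of_dominated hf d.support d).2]

/-- The ideals next to a ray of the fan are the torus-fixed ideals of the vertices. -/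
theorem beside_eq_singleton {u u' : ℝ × ℝ} {w : Fin 2 →₀ ℕ} {J : Ideal (PS K)}
    (hdet : u.1 * u'.2 - u.2 * u'.1 ≠ 0) (hw : w ∈ exponents κ I)
    (hu : ∀ e ∈ exponents κ I, pairing u (expPoint e) ≤ pairing u (expPoint w))
    (hu' : ∀ e ∈ exponents κ I, pairing u (expPoint e) = pairing u (expPoint w) →
      pairing u' (expPoint e) ≤ pairing u' (expPoint w))
    (hJ : IsVertexIdeal κ I J w) : beside κ I u u' = {J} := by
  obtain ⟨δ, hδ, hstrict⟩ := exists_strict_direction hdet hu hu'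
  obtain ⟨μ, hμ, hP⟩ := hJ
  have hcone : ∀ ε : ℝ, 0 < ε → ε < δ → u + ε • u' ∈ normalCone (hull κ I) (expPoint w) := by
    intro ε h1 h2
    rw [mem_normalCone_hull]
    intro e he
    by_cases hew : e = w
    · rw [hew]
    · exact (hstrict ε h1 h2 e he hew).le
  have hcone0 : u ∈ normalCone (hull κ I) (expPoint w) := mem_normalCone_hull.2 hu
  -- A cone containing u and the directions slightly towards u' belongs to a point of H maximal for
  -- both u and u + ε u'. These are independent functionals, so the point is unique.
  have huniq : ∀ v ∈ hull κ I, u ∈ normalCone (hull κ I) v →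
      (∃ δ : ℝ, 0 < δ ∧ ∀ ε : ℝ, 0 < ε → ε < δ → u + ε • u' ∈ normalCone (hull κ I) v) →
      v = expPoint w := by
    rintro v hv h1 ⟨δ', hδ', h2⟩
    have hwh := expPoint_mem_hull hw
    have e1 : pairing u v = pairing u (expPoint w) := le_antisymm (hcone0 v hv) (h1 _ hwh)
    obtain ⟨ε, hε, hlt⟩ := exists_between (lt_min hδ hδ')
    have e2 : pairing (u + ε • u') v = pairing (u + ε • u') (expPoint w) :=
      le_antisymm (hcone ε hε (hlt.trans_le (min_le_left _ _)) v hv)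
        (h2 ε hε (hlt.trans_le (min_le_right _ _)) _ hwh)
    rw [pairing_add_smul, pairing_add_smul, e1] at e2
    exact eq_of_pairing_eq hdet e1 (mul_left_cancel₀ hε.ne' (add_left_cancel e2))
  have hsub : ∀ c, (∃ e ∈ (coordFun κ I c).support,
      normalCone (hull κ I) (expPoint w) ⊆ normalCone (hull κ I) (expPoint e)) ↔
      (coordFun κ I c).coeff w ≠ 0 := by
    intro c
    constructor
    · rintro ⟨e, he, hsub⟩
      have := huniq _ (expPoint_mem_hull ⟨c, he⟩) (hsub hcone0)
        ⟨δ, hδ, fun ε h1 h2 => hsub (hcone ε h1 h2)⟩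
      rw [← expPoint_injective this]
      exact MvPolynomial.mem_support_iff.1 he
    · intro h
      exact ⟨w, MvPolynomial.mem_support_iff.2 h, subset_rfl⟩
  ext J'
  rw [Set.mem_singleton_iff]
  constructor
  · rintro ⟨σ, ⟨v, hv, rfl⟩, h1, h2, P', hP', hcl, hpat⟩
    obtain rfl := huniq v hv h1 h2
    simp only [hsub] at hpat
    obtain ⟨c₁, hc₁⟩ := hw
    rw [MvPolynomial.mem_support_iff] at hc₁
    have hmon : ∀ c, (coordFun κ I c).coeff w ≠ 0 →
        coordFun κ I c = MvPolynomial.monomial w ((coordFun κ I c).coeff w) := by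
      intro c hc
      obtain ⟨e, l, hel, -⟩ := exists_coordFun_eq_monomial κ c
      rw [hel, MvPolynomial.coeff_monomial] at hc ⊢
      split_ifs at hc ⊢ with h
      · rw [h]
      · exact absurd rfl hc
    -- Coordinate functions with the same exponent w are proportional. These linear relations
    -- persist on the closure and determine the point up to a factor.
    have hrel : ∀ c, (coordFun κ I c₁).coeff w * P' c = (coordFun κ I c).coeff w * P' c₁ := by
      intro c
      by_cases hc : (coordFun κ I c).coeff w = 0
      · have : P' c = 0 := by
          by_contra h
          exact (hpat c).1 h hc
        rw [this, hc, mul_zero, zero_mul]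
      · have := hcl 1 (MvPolynomial.C ((coordFun κ I c₁).coeff w) * MvPolynomial.X c -
            MvPolynomial.C ((coordFun κ I c).coeff w) * MvPolynomial.X c₁)
          (((MvPolynomial.isHomogeneous_X K c).C_mul _).sub
            ((MvPolynomial.isHomogeneous_X K c₁).C_mul _)) ?_
        · simpa [sub_eq_zero] using this
        · simp only [map_sub, map_mul, MvPolynomial.aeval_X, MvPolynomial.aeval_C,
            MvPolynomial.algebraMap_eq]
          conv_lhs =>
            congr
            · rw [hmon c hc]
            · rw [hmon c₁ hc₁]
          simp only [MvPolynomial.C_mul_monomial]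
          rw [mul_comm, sub_self]
    refine (hP.eq_of_proportional hP' (μ := P' c₁ / ((coordFun κ I c₁).coeff w * μ))
      fun c => ?_).symm
    field_simp
    linear_combination hrel c
  · rintro rfl
    obtain ⟨ε, hε, hlt⟩ := exists_between hδ
    refine ⟨_, ⟨_, expPoint_mem_hull hw, rfl⟩, hcone0, ⟨δ, hδ, hcone⟩, _, hP,
      (inClosure_of_dominated (hstrict ε hε hlt)).mul μ, fun c => ?_⟩
    rw [hsub, mul_ne_zero_iff]
    exact ⟨fun h => h.2, fun h => ⟨hμ, h⟩⟩

end Leading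

/-! ### The limits at the rays of the fan. -/

section LimitIdeals

variable {K : Type*} [Field K] {I : Ideal (PS K)} {κ : Kind}

/-- The ideals `J₀` and `J₁` are the torus-fixed ideals at the ends `w₀`, with `q = 0`, and `w₁`,
with `q` largest, of the edge of the exponents on which `p` is largest. -/
def IsEdgePair (κ : Kind) (I : Ideal (PS K)) (p q : (Fin 2 →₀ ℕ) → ℕ) (J₀ J₁ : Ideal (PS K)) :
    Prop :=
  ∃ w₀ ∈ exponents κ I, ∃ w₁ ∈ exponents κ I, q w₀ = 0 ∧ p w₁ = p w₀ ∧
    (∀ e ∈ exponents κ I, p e ≤ p w₀) ∧ (∀ e ∈ exponents κ I, p e = p w₀ → q e ≤ q w₁) ∧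
    IsVertexIdeal κ I J₀ w₀ ∧ IsVertexIdeal κ I J₁ w₁

/-- The exponent 0 has q = 0, so a largest p among the exponents with q = 0 exists; `two_step_limit`
shows that it is the largest overall and identifies both limits. -/
theorem IsStaircase.isEdgePair (hI : IsStaircase I) (a b : Polynomial (Polynomial K))
    {σ₁ σ₂ : Fin 2 → PS (Polynomial K)} (hσ₁ : IsCoordinates σ₁) (hσ₂ : IsCoordinates σ₂)
    (hσ₂0 : (fun i => MvPowerSeries.map (Polynomial.evalRingHom 0) (σ₂ i)) = X)
    {s₁ s₂ β : Fin 2 → PS (Polynomial (Polynomial K))}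
    (hs₁ : ∀ i, MvPowerSeries.map (Polynomial.mapRingHom Polynomial.C) (σ₁ i) = s₁ i)
    (hs₂ : ∀ i, MvPowerSeries.map Polynomial.C (σ₂ i) = s₂ i)
    (hβ : ∀ e ∈ expSet I, powProd β e ∈ staircaseIdeal _ (isUpperSet_expSet I))
    (h : κ.rep a b = fun i => subst (fun i => subst s₂ (s₁ i)) (β i))
    (p q : (Fin 2 →₀ ℕ) → ℕ) (θ : (Fin 2 →₀ ℕ) → K) (hθ : ∀ e, θ e ≠ 0)
    (hab : ∀ e, a ^ e 0 * b ^ e 1 = biMonomial (θ e) (q e) (p e))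
    (hinj : ∀ e e', p e = p e' → q e = q e' → e = e') (hq0 : q 0 = 0) :
    IsEdgePair κ I p q (flatLimit (moved σ₁ I)) (flatLimit (moved σ₂ (flatLimit (moved σ₁ I)))) := by
  have hs₁0 : ∀ i, constantCoeff (s₁ i) = 0 := fun i => by
    rw [← hs₁, constantCoeff_map, hσ₁.constantCoeff_eq_zero, map_zero]
  have hs₂0 : ∀ i, constantCoeff (s₂ i) = 0 := fun i => by
    rw [← hs₂, constantCoeff_map, hσ₂.constantCoeff_eq_zero, map_zero]
  obtain ⟨u, hu, hpl⟩ := exists_unit_aeval_coordFun (I := I) (fun i =>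
    constantCoeff_subst_eq_zero (hasSubst_of_zero hs₂0) hs₂0 (hs₁0 i)) hβ h
  have htmat : tmat (colength I) (fun i => subst s₂ (s₁ i)) =
      (tmat (colength I) σ₁).map (Polynomial.mapRingHom Polynomial.C) *
        (tmat (colength I) σ₂).map Polynomial.C := by
    rw [tmat_comp _ hs₂0, ← tmat_map, ← tmat_map, funext hs₁, funext hs₂]
  rw [htmat] at hpl
  obtain ⟨w₀, ⟨hw₀, hqw₀⟩, hmax₀⟩ := Set.exists_max_image (exponents κ I ∩ {e | q e = 0}) p
    ((finite_exponents κ I).inter_of_left _) ⟨0, zero_mem_exponents κ I, hq0⟩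
  obtain ⟨hJ₀, hp, hJ₁⟩ := two_step_limit hI a b hσ₁ hσ₂ hσ₂0 hu hpl p q θ hθ hab hinj hw₀ hqw₀
    fun e he hq => hmax₀ e ⟨he, hq⟩
  obtain ⟨w₁, ⟨hw₁, hpw₁⟩, hmax₁⟩ := Set.exists_max_image (exponents κ I ∩ {e | p e = p w₀}) q
    ((finite_exponents κ I).inter_of_left _) ⟨w₀, hw₀, rfl⟩
  have hmax₁' : ∀ e ∈ exponents κ I, p e = p w₀ → q e ≤ q w₁ := fun e he h => hmax₁ e ⟨he, h⟩
  exact ⟨w₀, hw₀, w₁, hw₁, hqw₀, hpw₁, hp, hmax₁', hJ₀, hJ₁ w₁ hw₁ hpw₁ hmax₁'⟩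

theorem pairing_expPoint (u₁ u₂ : ℤ) (e : Fin 2 →₀ ℕ) :
    pairing ((u₁ : ℝ), (u₂ : ℝ)) (expPoint e) = ((u₁ * e 0 + u₂ * e 1 : ℤ) : ℝ) := by
  simp [pairing, expPoint]

theorem IsVertexIdeal.beside_eq {J : Ideal (PS K)} {w : Fin 2 →₀ ℕ} (h : IsVertexIdeal κ I J w)
    (hw : w ∈ exponents κ I) (u₁ u₂ v₁ v₂ : ℤ) (hdet : u₁ * v₂ - u₂ * v₁ ≠ 0)
    (hmax : ∀ e ∈ exponents κ I, u₁ * e 0 + u₂ * e 1 ≤ u₁ * w 0 + u₂ * w 1 ∧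
      (u₁ * e 0 + u₂ * e 1 = u₁ * w 0 + u₂ * w 1 → v₁ * e 0 + v₂ * e 1 ≤ v₁ * w 0 + v₂ * w 1)) :
    beside κ I ((u₁ : ℝ), (u₂ : ℝ)) ((v₁ : ℝ), (v₂ : ℝ)) = {J} := by
  have hdet' : (u₁ * v₂ - u₂ * v₁ : ℝ) ≠ 0 := by exact_mod_cast hdet
  refine beside_eq_singleton hdet' hw (fun e he => ?_) (fun e he => ?_) h
  · rw [pairing_expPoint, pairing_expPoint, Int.cast_le]
    exact (hmax e he).1
  · rw [pairing_expPoint, pairing_expPoint, pairing_expPoint, pairing_expPoint, Int.cast_le,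
      Int.cast_inj]
    exact (hmax e he).2

theorem powProd_X_mem {A : Type*} [CommRing A] [Algebra K A] (e : Fin 2 →₀ ℕ)
    (he : e ∈ expSet I) : powProd (X : Fin 2 → PS A) e ∈ staircaseIdeal A (isUpperSet_expSet I) := by
  rw [powProd_X]
  intro j hj
  classical
  rw [coeff_monomial, if_neg]
  rintro rfl
  exact hj he

theorem subst_X_right {A : Type*} [CommRing A] {s : Fin 2 → PS A} (hs : HasSubst s) :
    (fun i => subst s (X i : PS A)) = s :=
  funext fun i => subst_X hs i

/-- Here b is the outer variable and a the inner one. The g(a, b) compose additively, so no stable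
correction is needed and β is the identity. -/
theorem IsStaircase.isEdgePair_limG₂_limG₁ (hI : IsStaircase I) :
    IsEdgePair .m41 I (fun e => e 1) (fun e => e 0) (limG₂ I) (limG₁ (limG₂ I)) := by
  refine hI.isEdgePair (Polynomial.C Polynomial.X) Polynomial.X (isCoordinates_gSubst _ _)
    (isCoordinates_gSubst _ _) ?_ (s₁ := gSubst 0 Polynomial.X)
    (s₂ := gSubst (Polynomial.C Polynomial.X) 0) (β := X) ?_ ?_ powProd_X_mem ?_
    _ _ (fun _ => 1) (fun _ => one_ne_zero) ?_ ?_ rfl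
  · funext i
    rw [map_gSubst]
    simp [gSubst_zero]
  · intro i
    rw [map_gSubst]
    simp
  · intro i
    rw [map_gSubst]
    simp
  · rw [subst_gSubst_gSubst, add_zero, zero_add, subst_X_right (hasSubst_gSubst _ _)]
    rfl
  · intro e
    simp [biMonomial]
  · intro e e' h1 h0
    ext i; fin_cases i
    · exact h0
    · exact h1

theorem IsStaircase.isEdgePair_limG₁_limG₂ (hI : IsStaircase I) :
    IsEdgePair .m41 I (fun e => e 0) (fun e => e 1) (limG₁ I) (limG₂ (limG₁ I)) := by
  refine hI.isEdgePair Polynomial.X (Polynomial.C Polynomial.X) (isCoordinates_gSubst _ _)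
    (isCoordinates_gSubst _ _) ?_ (s₁ := gSubst Polynomial.X 0)
    (s₂ := gSubst 0 (Polynomial.C Polynomial.X)) (β := X) ?_ ?_ powProd_X_mem ?_
    _ _ (fun _ => 1) (fun _ => one_ne_zero) ?_ ?_ rfl
  · funext i
    rw [map_gSubst]
    simp [gSubst_zero]
  · intro i
    rw [map_gSubst]
    simp
  · intro i
    rw [map_gSubst]
    simp
  · rw [subst_gSubst_gSubst, add_zero, zero_add, subst_X_right (hasSubst_gSubst _ _)]
    rfl
  · intro e
    simp [biMonomial, mul_comm]
  · intro e e' h0 h1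
    ext i; fin_cases i
    · exact h0
    · exact h1

/-- With a = t and b = -2 t² s, the monomial a^m b^n becomes (-2)^n t^(m + 2n) s^n. The exponent of
t is the pairing with the direction (1, 2), and the scalar must not vanish. -/
theorem IsStaircase.isEdgePair_limG₁_limH₂ (hI : IsStaircase I)
    (hS : Kind.m41.HasStab K (expSet I)) (h2 : (2 : K) ≠ 0) :
    IsEdgePair .m41 I (fun e => e 0 + 2 * e 1) (fun e => e 1) (limG₁ I) (limH₂ (limG₁ I)) := by
  obtain ⟨β, hβ, h⟩ := exists_gSubst_eq_comp (isUpperSet_expSet I) hS.1 hS.2.1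
    (Polynomial.X : Polynomial (Polynomial K)) (Polynomial.C Polynomial.X)
  refine hI.isEdgePair (κ := .m41) Polynomial.X (-2 * Polynomial.X ^ 2 * Polynomial.C Polynomial.X)
    (isCoordinates_gSubst _ _)
    (isCoordinates_hSubst _ _) ?_ (s₁ := gSubst Polynomial.X 0)
    (s₂ := hSubst 0 (Polynomial.C Polynomial.X)) ?_ ?_ hβ h
    _ _ (fun e => (-2) ^ e 1) (fun _ => pow_ne_zero _ (neg_ne_zero.2 h2)) ?_ ?_ rfl
  · funext i
    rw [map_hSubst]
    simp [hSubst_zero]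
  · intro i
    rw [map_gSubst]
    simp
  · intro i
    rw [map_hSubst]
    simp
  · intro e
    have : (-2 : Polynomial (Polynomial K)) = Polynomial.C (Polynomial.C (-2)) := by
      simp only [map_neg, map_ofNat]
    simp only [biMonomial, this, map_mul, map_pow, mul_pow, pow_add, pow_mul]
    ring
  · intro e e' h0 h1
    ext i; fin_cases i
    · change e 0 = e' 0
      omega
    · exact h1

theorem IsStaircase.isEdgePair_limH₂_limH₁ (hI : IsStaircase I)
    (hS : Kind.m32.HasStab K (expSet I)) :
    IsEdgePair .m32 I (fun e => e 1) (fun e => e 0) (limH₂ I) (limH₁ (limH₂ I)) := by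
  obtain ⟨β, hβ, h⟩ := exists_hSubst_eq_comp (isUpperSet_expSet I) hS.1 hS.2.1
    (Polynomial.C Polynomial.X : Polynomial (Polynomial K)) Polynomial.X
  refine hI.isEdgePair (κ := .m32) (Polynomial.C Polynomial.X) Polynomial.X (isCoordinates_hSubst _ _)
    (isCoordinates_hSubst _ _) ?_ (s₁ := hSubst 0 Polynomial.X)
    (s₂ := hSubst (Polynomial.C Polynomial.X) 0) ?_ ?_ hβ h
    _ _ (fun _ => 1) (fun _ => one_ne_zero) ?_ ?_ rfl
  · funext i
    rw [map_hSubst]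
    simp [hSubst_zero]
  · intro i
    rw [map_hSubst]
    simp
  · intro i
    rw [map_hSubst]
    simp
  · intro e
    simp [biMonomial]
  · intro e e' h1 h0
    ext i; fin_cases i
    · exact h0
    · exact h1

theorem IsStaircase.isEdgePair_limH₁_limH₂ (hI : IsStaircase I)
    (hS : Kind.m32.HasStab K (expSet I)) :
    IsEdgePair .m32 I (fun e => e 0) (fun e => e 1) (limH₁ I) (limH₂ (limH₁ I)) := by
  obtain ⟨β, hβ, h⟩ := exists_hSubst_eq_comp' (isUpperSet_expSet I) hS.1 hS.2.1
    (Polynomial.X : Polynomial (Polynomial K)) (Polynomial.C Polynomial.X)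
  refine hI.isEdgePair (κ := .m32) Polynomial.X (Polynomial.C Polynomial.X) (isCoordinates_hSubst _ _)
    (isCoordinates_hSubst _ _) ?_ (s₁ := hSubst Polynomial.X 0)
    (s₂ := hSubst 0 (Polynomial.C Polynomial.X)) ?_ ?_ hβ h
    _ _ (fun _ => 1) (fun _ => one_ne_zero) ?_ ?_ rfl
  · funext i
    rw [map_hSubst]
    simp [hSubst_zero]
  · intro i
    rw [map_hSubst]
    simp
  · intro i
    rw [map_hSubst]
    simp
  · intro e
    simp [biMonomial, mul_comm]
  · intro e e' h0 h1
    ext i; fin_cases i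
    · exact h0
    · exact h1

/-- The two ideals beside the ray `(0, 1)`, also reached from the ray `(-1, 0)`. -/
theorem IsEdgePair.top {J₀ J₁ : Ideal (PS K)}
    (h : IsEdgePair κ I (fun e => e 1) (fun e => e 0) J₀ J₁) :
    clockwise κ I (-1, 0) = {J₀} ∧ counterclockwise κ I (0, 1) = {J₀} ∧
      clockwise κ I (0, 1) = {J₁} := by
  obtain ⟨w₀, hw₀, w₁, hw₁, hq, hp, hmax, hmax', hJ₀, hJ₁⟩ := h
  beta_reduce at hq hp hmax hmax'
  -- In the direction (-1, 0) the vertex is maximal because its first exponent is 0. Moving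
  -- clockwise means breaking ties by (0, 1), where it is maximal as well.
  have h1 := hJ₀.beside_eq hw₀ (-1) 0 0 1 (by norm_num) (fun e he => by
    have := hmax e he; omega)
  have h2 := hJ₀.beside_eq hw₀ 0 1 (-1) 0 (by norm_num) (fun e he => by
    have := hmax e he; omega)
  have h3 := hJ₁.beside_eq hw₁ 0 1 1 0 (by norm_num) (fun e he => by
    have := hmax e he; have := hmax' e he; omega)
  simp only [clockwise_eq_beside, counterclockwise_eq_beside]
  norm_num at h1 h2 h3 ⊢
  exact ⟨h1, h2, h3⟩

/-- The two ideals beside the ray `(1, 0)`, also reached from the ray `(0, -1)`. -/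
theorem IsEdgePair.right {J₀ J₁ : Ideal (PS K)}
    (h : IsEdgePair κ I (fun e => e 0) (fun e => e 1) J₀ J₁) :
    counterclockwise κ I (0, -1) = {J₀} ∧ clockwise κ I (1, 0) = {J₀} ∧
      counterclockwise κ I (1, 0) = {J₁} := by
  obtain ⟨w₀, hw₀, w₁, hw₁, hq, hp, hmax, hmax', hJ₀, hJ₁⟩ := h
  beta_reduce at hq hp hmax hmax'
  have h1 := hJ₀.beside_eq hw₀ 0 (-1) 1 0 (by norm_num) (fun e he => by
    have := hmax e he; omega)
  have h2 := hJ₀.beside_eq hw₀ 1 0 0 (-1) (by norm_num) (fun e he => by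
    have := hmax e he; omega)
  have h3 := hJ₁.beside_eq hw₁ 1 0 0 1 (by norm_num) (fun e he => by
    have := hmax e he; have := hmax' e he; omega)
  simp only [clockwise_eq_beside, counterclockwise_eq_beside]
  norm_num at h1 h2 h3 ⊢
  exact ⟨h1, h2, h3⟩

/-- The two ideals beside the ray `(1, 2)`. -/
theorem IsEdgePair.one_two {J₀ J₁ : Ideal (PS K)}
    (h : IsEdgePair κ I (fun e => e 0 + 2 * e 1) (fun e => e 1) J₀ J₁) :
    clockwise κ I (1, 2) = {J₀} ∧ counterclockwise κ I (1, 2) = {J₁} := by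
  obtain ⟨w₀, hw₀, w₁, hw₁, hq, hp, hmax, hmax', hJ₀, hJ₁⟩ := h
  beta_reduce at hq hp hmax hmax'
  have h1 := hJ₀.beside_eq hw₀ 1 2 2 (-1) (by norm_num) (fun e he => by
    have := hmax e he; omega)
  have h2 := hJ₁.beside_eq hw₁ 1 2 (-2) 1 (by norm_num) (fun e he => by
    have := hmax e he; have := hmax' e he; omega)
  simp only [clockwise_eq_beside, counterclockwise_eq_beside]
  norm_num at h1 h2 ⊢
  exact ⟨h1, h2⟩

theorem IsStaircase.limits_m41 (hI : IsStaircase I) (hS : Kind.m41.HasStab K (expSet I)) :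
    clockwise .m41 I (-1, 0) = {limG₂ I} ∧
      counterclockwise .m41 I (0, 1) = {limG₂ I} ∧
      counterclockwise .m41 I (0, -1) = {limG₁ I} ∧
      (∀ J ∈ counterclockwise .m41 I (0, 1), clockwise .m41 I (0, 1) = {limG₁ J}) ∧
      (ringChar K ≠ 2 →
        counterclockwise .m41 I (0, -1) = clockwise .m41 I (1, 2) ∧
        ∀ J ∈ clockwise .m41 I (1, 2), counterclockwise .m41 I (1, 2) = {limH₂ J}) := by
  obtain ⟨t1, t2, t3⟩ := hI.isEdgePair_limG₂_limG₁.top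
  obtain ⟨r1, -, -⟩ := hI.isEdgePair_limG₁_limG₂.right
  refine ⟨t1, t2, r1, ?_, fun h2 => ?_⟩
  · rw [t2]
    rintro _ rfl
    exact t3
  · obtain ⟨d1, d2⟩ := (hI.isEdgePair_limG₁_limH₂ hS (Ring.two_ne_zero h2)).one_two
    refine ⟨r1.trans d1.symm, ?_⟩
    rw [d1]
    rintro _ rfl
    exact d2

theorem IsStaircase.limits_m32 (hI : IsStaircase I) (hS : Kind.m32.HasStab K (expSet I)) :
    clockwise .m32 I (-1, 0) = {limH₂ I} ∧
      counterclockwise .m32 I (0, 1) = {limH₂ I} ∧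
      counterclockwise .m32 I (0, -1) = {limH₁ I} ∧
      clockwise .m32 I (1, 0) = {limH₁ I} ∧
      (∀ J ∈ counterclockwise .m32 I (0, 1), clockwise .m32 I (0, 1) = {limH₁ J}) ∧
      (∀ J ∈ clockwise .m32 I (1, 0), counterclockwise .m32 I (1, 0) = {limH₂ J}) := by
  obtain ⟨t1, t2, t3⟩ := (hI.isEdgePair_limH₂_limH₁ hS).top
  obtain ⟨r1, r2, r3⟩ := (hI.isEdgePair_limH₁_limH₂ hS).right
  refine ⟨t1, t2, r1, r2, ?_, ?_⟩
  · rw [t2]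
    rintro _ rfl
    exact t3
  · rw [r2]
    rintro _ rfl
    exact r3

end LimitIdeals

/-! ### The quadrant and its faces as cones of the fan. -/

section Cones

variable {K : Type*} [Field K] {I : Ideal (PS K)} {κ : Kind}

/-- The face of the quadrant on which the coordinates selected by `p` and `q` may be negative. -/
def quadrantFace (p q : Prop) : Set (ℝ × ℝ) :=
  {u | u ∈ quadrant ∧ (¬ p → u.1 = 0) ∧ (¬ q → u.2 = 0)}

theorem quadrantFace_subset (p q : Prop) : quadrantFace p q ⊆ quadrant := fun _ hu => hu.1

theorem negXAxis_subset_quadrantFace {p q : Prop} (hp : p) : negXAxis ⊆ quadrantFace p q :=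
  fun _ hu => ⟨⟨hu.1, hu.2.le⟩, fun h => absurd hp h, fun _ => hu.2⟩

theorem negYAxis_subset_quadrantFace {p q : Prop} (hq : q) : negYAxis ⊆ quadrantFace p q :=
  fun _ hu => ⟨⟨hu.1.le, hu.2⟩, fun _ => hu.1, fun h => absurd hq h⟩

/-- All exponents have nonnegative coordinates, and the pure powers of a and b provide points of H
on both positive axes. -/
theorem normalCone_expPoint_zero (hI : IsStaircase I) (hS : κ.HasStab K (expSet I)) :
    normalCone (hull κ I) (expPoint 0) = quadrant := by
  obtain ⟨e₁, he₁, h10, h11⟩ := hI.exists_axis_zero hS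
  obtain ⟨e₂, he₂, h20, h21⟩ := hI.exists_axis_one hS
  have h11' : (0 : ℝ) < e₁ 0 := Nat.cast_pos.2 h11
  have h21' : (0 : ℝ) < e₂ 1 := Nat.cast_pos.2 h21
  ext u
  rw [mem_normalCone_hull]
  constructor
  · intro h
    have h1 := h e₁ he₁
    have h2 := h e₂ he₂
    simp only [pairing, expPoint, h10, h20, Finsupp.coe_zero, Pi.zero_apply, Nat.cast_zero,
      mul_zero, add_zero, zero_add] at h1 h2
    exact ⟨nonpos_of_mul_nonpos_left h1 h11', nonpos_of_mul_nonpos_left h2 h21'⟩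
  · rintro ⟨h1, h2⟩ e he
    simp only [pairing, expPoint, Finsupp.coe_zero, Pi.zero_apply, Nat.cast_zero,
      mul_zero, add_zero]
    have h3 := mul_nonpos_of_nonpos_of_nonneg h1 (Nat.cast_nonneg (α := ℝ) (e 0))
    have h4 := mul_nonpos_of_nonpos_of_nonneg h2 (Nat.cast_nonneg (α := ℝ) (e 1))
    linarith

/-- All faces of the quadrant belong to the fan. -/
theorem quadrantFace_mem_standardFan (hI : IsStaircase I) (hS : κ.HasStab K (expSet I))
    (p q : Prop) : quadrantFace p q ∈ standardFan κ I := by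
  classical
  obtain ⟨e₁, he₁, h10, h11⟩ := hI.exists_axis_zero hS
  obtain ⟨e₂, he₂, h20, h21⟩ := hI.exists_axis_one hS
  have hm : (0 : ℝ) < e₁ 0 := Nat.cast_pos.2 h11
  have hn : (0 : ℝ) < e₂ 1 := Nat.cast_pos.2 h21
  -- The point (s m, t n) lies on the face of the triangle 0, (m, 0), (0, n) dual to the chosen
  -- face. The value 1/3 keeps the weight of the vertex 0 positive, so it is interior to that face.
  set s : ℝ := if p then 0 else 1 / 3 with hs
  set t : ℝ := if q then 0 else 1 / 3 with ht
  have hs0 : 0 ≤ s := by rw [hs]; split_ifs <;> norm_num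
  have ht0 : 0 ≤ t := by rw [ht]; split_ifs <;> norm_num
  have hst : 0 < 1 - s - t := by rw [hs, ht]; split_ifs <;> norm_num
  have hconv : Convex ℝ (hull κ I) := convex_convexHull ℝ _
  have hmem : (s * e₁ 0, t * e₂ 1) ∈ hull κ I := by
    have h0 := expPoint_mem_hull (zero_mem_exponents κ I)
    have h1 := expPoint_mem_hull he₁
    have h2 := expPoint_mem_hull he₂
    have := hconv.sum_mem (t := Finset.univ) (w := ![1 - s - t, s, t])
      (z := ![expPoint 0, expPoint e₁, expPoint e₂])
      (by intro i _; fin_cases i; exacts [hst.le, hs0, ht0])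
      (by simp only [Fin.sum_univ_three, Matrix.cons_val]; ring)
      (by intro i _; fin_cases i; exacts [h0, h1, h2])
    rw [Fin.sum_univ_three] at this
    convert this using 1
    ext <;> simp [expPoint, h10, h20]
  refine ⟨_, hmem, ?_⟩
  ext u
  rw [mem_normalCone_hull]
  constructor
  · rintro ⟨⟨hu1, hu2⟩, hp, hq⟩ e he
    have h3 := mul_nonpos_of_nonpos_of_nonneg hu1 (Nat.cast_nonneg (α := ℝ) (e 0))
    have h4 := mul_nonpos_of_nonpos_of_nonneg hu2 (Nat.cast_nonneg (α := ℝ) (e 1))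
    have h5 : u.1 * s = 0 := by
      by_cases h : p
      · simp [hs, h]
      · simp [hp h]
    have h6 : u.2 * t = 0 := by
      by_cases h : q
      · simp [ht, h]
      · simp [hq h]
    have h7 : pairing u (s * e₁ 0, t * e₂ 1) = 0 := by
      simp only [pairing]
      linear_combination h5 * (e₁ 0 : ℝ) + h6 * (e₂ 1 : ℝ)
    rw [h7]
    simp only [pairing, expPoint]
    linarith
  · intro h
    have h0 := h 0 (zero_mem_exponents κ I)
    have h1 := h e₁ he₁
    have h2 := h e₂ he₂
    simp only [pairing, expPoint, h10, h20, Finsupp.coe_zero, Pi.zero_apply, Nat.cast_zero,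
      mul_zero, add_zero, zero_add] at h0 h1 h2
    set A := u.1 * (e₁ 0 : ℝ) with hA
    set B := u.2 * (e₂ 1 : ℝ) with hB
    have e1 : u.1 * (s * (e₁ 0 : ℝ)) = s * A := by rw [hA]; ring
    have e2 : u.2 * (t * (e₂ 1 : ℝ)) = t * B := by rw [hB]; ring
    rw [e1, e2] at h0 h1 h2
    have hz : s * A + t * B ≤ 0 := by
      have h3 := mul_le_mul_of_nonneg_left h1 hs0
      have h4 := mul_le_mul_of_nonneg_left h2 ht0
      have h5 : (1 - s - t) * (s * A + t * B) ≤ 0 := by linarith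
      exact nonpos_of_mul_nonpos_right h5 hst
    have hA0 : A ≤ 0 := h1.trans hz
    have hB0 : B ≤ 0 := h2.trans hz
    have h5 := mul_nonpos_of_nonneg_of_nonpos hs0 hA0
    have h6 := mul_nonpos_of_nonneg_of_nonpos ht0 hB0
    refine ⟨⟨nonpos_of_mul_nonpos_left hA0 hm, nonpos_of_mul_nonpos_left hB0 hn⟩, fun hp => ?_,
      fun hq => ?_⟩
    · have : s * A = 0 := by linarith
      rw [hs, if_neg hp, hA] at this
      simpa [hm.ne'] using this
    · have : t * B = 0 := by linarith
      rw [ht, if_neg hq, hB] at this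
      simpa [hn.ne'] using this

theorem quadrant_eq_quadrantFace : quadrant = quadrantFace True True := by
  ext u; simp [quadrantFace]

theorem negXAxis_eq_quadrantFace : negXAxis = quadrantFace True False := by
  ext u
  simp only [negXAxis, quadrantFace, quadrant, Set.mem_ofPred_eq, not_true, not_false_iff,
    false_imp_iff, true_imp_iff, true_and]
  exact ⟨fun h => ⟨⟨h.1, h.2.le⟩, h.2⟩, fun h => ⟨h.1.1, h.2⟩⟩

theorem negYAxis_eq_quadrantFace : negYAxis = quadrantFace False True := by
  ext u
  simp only [negYAxis, quadrantFace, quadrant, Set.mem_ofPred_eq, not_true, not_false_iff,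
    false_imp_iff, true_imp_iff, and_true]
  exact ⟨fun h => ⟨⟨h.1.le, h.2⟩, h.1⟩, fun h => ⟨h.2, h.1.2⟩⟩

end Cones

/-! ### The affine chart around I. -/

section Chart

variable {K : Type*} [Field K] {I : Ideal (PS K)} {κ : Kind}

/-- Membership in the closure is tested on homogeneous relations. Since the base coordinate is 1 on
both sides, any relation may be homogenized by powers of it. -/
theorem InClosure.eval_eq_zero {P : Coord I → K} (h : InClosure κ I P)
    (hP : P (baseCoord I) = 1) {Φ : MvPolynomial (Coord I) K}
    (hΦ : MvPolynomial.aeval (coordFun κ I) Φ = 0) : MvPolynomial.eval P Φ = 0 := by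
  set n := Φ.totalDegree
  set Ψ : MvPolynomial (Coord I) K := ∑ i ∈ Finset.range (n + 1),
    MvPolynomial.X (baseCoord I) ^ (n - i) * MvPolynomial.homogeneousComponent i Φ with hΨ
  have hhom : Ψ.IsHomogeneous n := by
    refine MvPolynomial.IsHomogeneous.sum _ _ _ fun i hi => ?_
    have h1 := (MvPolynomial.isHomogeneous_X_pow (R := K) (baseCoord I) (n - i)).mul
      (MvPolynomial.homogeneousComponent_isHomogeneous i Φ)
    rwa [Nat.sub_add_cancel (Nat.lt_succ_iff.1 (Finset.mem_range.1 hi))] at h1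
  have hsum : ∑ i ∈ Finset.range (n + 1), MvPolynomial.homogeneousComponent i Φ = Φ :=
    MvPolynomial.sum_homogeneousComponent Φ
  have h1 : MvPolynomial.aeval (coordFun κ I) Ψ = 0 := by
    rw [← hΦ, ← hsum, hΨ, map_sum, map_sum]
    refine Finset.sum_congr rfl fun i _ => ?_
    rw [map_mul, map_pow, MvPolynomial.aeval_X, coordFun_baseCoord, one_pow, one_mul]
  rw [← h n Ψ hhom h1, ← hsum, hΨ, map_sum, map_sum]
  refine Finset.sum_congr rfl fun i _ => ?_
  rw [map_mul, map_pow, MvPolynomial.eval_X, hP, one_pow, one_mul]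

/-- Some power of a and some power of b is, up to a nonzero scalar, a coordinate function, so a and
b satisfy monic equations. -/
theorem isIntegral_aeval_coordFun (hI : IsStaircase I) (hS : κ.HasStab K (expSet I)) :
    (MvPolynomial.aeval (R := K) (coordFun κ I)).toRingHom.IsIntegral := by
  have hX : ∀ (i : Fin 2) (e : Fin 2 →₀ ℕ), e ∈ exponents κ I → e = Finsupp.single i (e i) →
      0 < e i → (MvPolynomial.aeval (R := K) (coordFun κ I)).toRingHom.IsIntegralElem
        (MvPolynomial.X i) := by
    rintro i e ⟨c, hc⟩ he hpos
    obtain ⟨e', l, hel, -⟩ := exists_coordFun_eq_monomial κ c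
    have hl : l ≠ 0 := by
      rintro rfl
      rw [hel, MvPolynomial.monomial_zero] at hc
      simp at hc
    have hee : e' = e := by
      classical
      rw [hel, MvPolynomial.mem_support_iff, MvPolynomial.coeff_monomial] at hc
      by_contra hne
      exact hc (if_neg hne)
    subst hee
    refine ⟨Polynomial.X ^ e' i - Polynomial.C (MvPolynomial.C l⁻¹ * MvPolynomial.X c),
      Polynomial.monic_X_pow_sub_C _ hpos.ne', ?_⟩
    have h1 : coordFun κ I c = MvPolynomial.C l * MvPolynomial.X i ^ e' i := by
      rw [hel]
      conv_lhs => rw [he]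
      rw [MvPolynomial.X_pow_eq_monomial, MvPolynomial.C_mul_monomial, mul_one]
    rw [Polynomial.eval₂_sub, Polynomial.eval₂_X_pow, Polynomial.eval₂_C]
    change _ - MvPolynomial.aeval (coordFun κ I) _ = 0
    rw [map_mul, MvPolynomial.aeval_X, h1, MvPolynomial.aeval_C, MvPolynomial.algebraMap_eq,
      ← mul_assoc, ← map_mul, inv_mul_cancel₀ hl, map_one, one_mul, sub_self]
  intro F
  induction F using MvPolynomial.induction_on with
  | C a =>
    have := RingHom.isIntegralElem_map (MvPolynomial.aeval (R := K) (coordFun κ I)).toRingHom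
      (x := MvPolynomial.C a)
    simpa using this
  | add F G hF hG => exact RingHom.IsIntegralElem.add _ hF hG
  | mul_X F i hF =>
    refine RingHom.IsIntegralElem.mul _ hF ?_
    fin_cases i
    · obtain ⟨e, he, h1, h0⟩ := hI.exists_axis_zero hS
      refine hX 0 e he ?_ h0
      ext j; fin_cases j <;> simp [h1]
    · obtain ⟨e, he, h0, h1⟩ := hI.exists_axis_one hS
      refine hX 1 e he ?_ h1
      ext j; fin_cases j <;> simp [h0]

/-- The points of the closure in the chart of the base point come from the affine plane. -/
theorem exists_eq_aeval_coordFun [IsAlgClosed K] (hI : IsStaircase I)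
    (hS : κ.HasStab K (expSet I)) {P : Coord I → K} (h : InClosure κ I P)
    (hP : P (baseCoord I) = 1) :
    ∃ a b : K, ∀ c, MvPolynomial.aeval ![a, b] (coordFun κ I c) = P c := by
  let _ : Algebra (MvPolynomial (Coord I) K) (MvPolynomial (Fin 2) K) :=
    (MvPolynomial.aeval (R := K) (coordFun κ I)).toRingHom.toAlgebra
  have : Algebra.IsIntegral (MvPolynomial (Coord I) K) (MvPolynomial (Fin 2) K) :=
    ⟨isIntegral_aeval_coordFun hI hS⟩
  have : (RingHom.ker (MvPolynomial.eval P)).IsMaximal :=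
    RingHom.ker_isMaximal_of_surjective _ fun x => ⟨MvPolynomial.C x, MvPolynomial.eval_C x⟩
  -- Lying over gives a maximal ideal of K[a, b] above the point P; by the Nullstellensatz it is a
  -- point (a, b) of the plane.
  obtain ⟨Q, hQ, hcomap⟩ := Ideal.exists_ideal_over_maximal_of_isIntegral
    (S := MvPolynomial (Fin 2) K) (RingHom.ker (MvPolynomial.eval P))
    (fun Φ hΦ => h.eval_eq_zero hP hΦ)
  obtain ⟨x, rfl⟩ := (MvPolynomial.isMaximal_iff_eq_vanishingIdeal_singleton (K := K)).1 hQ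
  refine ⟨x 0, x 1, fun c => ?_⟩
  have hmem : MvPolynomial.X c - MvPolynomial.C (P c) ∈ RingHom.ker (MvPolynomial.eval P) := by
    simp [RingHom.mem_ker]
  rw [← hcomap, Ideal.mem_comap, MvPolynomial.mem_vanishingIdeal_iff] at hmem
  have h1 := hmem x rfl
  have h2 : algebraMap (MvPolynomial (Coord I) K) (MvPolynomial (Fin 2) K)
      (MvPolynomial.X c - MvPolynomial.C (P c)) = coordFun κ I c - MvPolynomial.C (P c) := by
    change MvPolynomial.aeval (coordFun κ I) _ = _
    simp
  have hx : ![x 0, x 1] = x := by ext i; fin_cases i <;> rfl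
  rw [h2, map_sub, sub_eq_zero, MvPolynomial.aeval_C] at h1
  rw [hx]
  simpa using h1

theorem inClosure_aeval (a b : K) :
    InClosure κ I (fun c => MvPolynomial.aeval ![a, b] (coordFun κ I c)) := by
  intro n Φ _ h0
  have h1 : MvPolynomial.aeval ![a, b] (MvPolynomial.aeval (coordFun κ I) Φ) = 0 := by
    rw [h0, map_zero]
  rwa [← MvPolynomial.aeval_eq_eval, ← MvPolynomial.comp_aeval_apply]

theorem quadrantFace_subset_normalCone_iff (hI : IsStaircase I) (hS : κ.HasStab K (expSet I))
    {p q : Prop} {e : Fin 2 →₀ ℕ} :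
    quadrantFace p q ⊆ normalCone (hull κ I) (expPoint e) ↔ (p → e 0 = 0) ∧ (q → e 1 = 0) := by
  constructor
  · intro h
    constructor
    · intro hp
      have h1 := h (negXAxis_subset_quadrantFace (q := q) hp
        (show ((-1 : ℝ), (0 : ℝ)) ∈ negXAxis from ⟨by norm_num, rfl⟩))
      have := mem_normalCone_hull.1 h1 0 (zero_mem_exponents κ I)
      simp only [pairing, expPoint, Finsupp.coe_zero, Pi.zero_apply, Nat.cast_zero] at this
      have h2 : (e 0 : ℝ) ≤ 0 := by linarith
      exact_mod_cast Nat.le_zero.1 (by exact_mod_cast h2)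
    · intro hq
      have h1 := h (negYAxis_subset_quadrantFace (p := p) hq
        (show ((0 : ℝ), (-1 : ℝ)) ∈ negYAxis from ⟨rfl, by norm_num⟩))
      have := mem_normalCone_hull.1 h1 0 (zero_mem_exponents κ I)
      simp only [pairing, expPoint, Finsupp.coe_zero, Pi.zero_apply, Nat.cast_zero] at this
      have h2 : (e 1 : ℝ) ≤ 0 := by linarith
      exact_mod_cast Nat.le_zero.1 (by exact_mod_cast h2)
  · rintro ⟨h1, h2⟩ u ⟨hu, hp, hq⟩
    rw [← normalCone_expPoint_zero hI hS, mem_normalCone_hull] at hu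
    rw [mem_normalCone_hull]
    intro e' he'
    refine (hu e' he').trans (le_of_eq ?_)
    have h3 : u.1 * (e 0 : ℝ) = 0 := by
      by_cases h : p
      · simp [h1 h]
      · simp [hp h]
    have h4 : u.2 * (e 1 : ℝ) = 0 := by
      by_cases h : q
      · simp [h2 h]
      · simp [hq h]
    simp [pairing, expPoint, h3, h4]

theorem aeval_coordFun_ne_zero_iff (a b : K) (c : Coord I) :
    MvPolynomial.aeval ![a, b] (coordFun κ I c) ≠ 0 ↔
      ∃ e ∈ (coordFun κ I c).support, (a = 0 → e 0 = 0) ∧ (b = 0 → e 1 = 0) := by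
  obtain ⟨e, l, hel, hl⟩ := exists_coordFun_eq_monomial κ c
  have hval : MvPolynomial.aeval ![a, b] (coordFun κ I c) = l * (a ^ e 0 * b ^ e 1) := by
    rw [hel]
    simp [MvPolynomial.aeval_monomial, Finsupp.prod_fintype, Fin.prod_univ_two]
  have hpow : ∀ (a : K) (n : ℕ), a ^ n ≠ 0 ↔ (a = 0 → n = 0) := by
    intro a n
    rw [Ne, pow_eq_zero_iff']
    tauto
  rw [hval, mul_ne_zero_iff, mul_ne_zero_iff, hpow, hpow]
  constructor
  · rintro ⟨h1, h2⟩
    exact ⟨e, hl h1, h2⟩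
  · rintro ⟨e', he', h2⟩
    have hl0 : l ≠ 0 := by
      rintro rfl
      rw [hel, MvPolynomial.monomial_zero] at he'
      simp at he'
    exact ⟨hl0, by rwa [eq_of_mem_support κ (hl hl0) he']⟩

/-- A monomial is nonzero at (a, b) exactly when it avoids the vanishing parameters, which is the
condition that its exponent lie on the face of H dual to the corresponding face of the quadrant. -/
theorem moved_mem_torusOrbit (hI : IsStaircase I) (hS : κ.HasStab K (expSet I)) (a b : K) :
    moved (κ.rep a b) I ∈ torusOrbit κ I (quadrantFace (a = 0) (b = 0)) := by
  refine ⟨_, hI.isPluckerVector_moved κ a b, inClosure_aeval a b, fun c => ?_⟩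
  simp only [aeval_coordFun_ne_zero_iff, quadrantFace_subset_normalCone_iff hI hS]

/-- A cone inside the quadrant, the normal cone of 0, forces the base coordinate to be nonzero, so
the point lies in the chart. If the cone contains a negative axis, the coordinate that is a pure
power of the matching parameter vanishes, and so does the parameter. -/
theorem exists_moved_eq_of_mem_torusOrbit [IsAlgClosed K] (hI : IsStaircase I)
    (hS : κ.HasStab K (expSet I)) {σ : Set (ℝ × ℝ)} (hσ : σ ⊆ quadrant) {J : Ideal (PS K)}
    (hJ : J ∈ torusOrbit κ I σ) :
    ∃ a b, J = moved (κ.rep a b) I ∧ (negXAxis ⊆ σ → a = 0) ∧ (negYAxis ⊆ σ → b = 0) := by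
  obtain ⟨P, hP, hcl, hpat⟩ := hJ
  have hbase : P (baseCoord I) ≠ 0 := by
    rw [hpat]
    refine ⟨0, ?_, by rwa [normalCone_expPoint_zero hI hS]⟩
    rw [coordFun_baseCoord, MvPolynomial.mem_support_iff, MvPolynomial.coeff_zero_one]
    exact one_ne_zero
  obtain ⟨a, b, hab⟩ := exists_eq_aeval_coordFun hI hS (hcl.mul (P (baseCoord I))⁻¹)
    (inv_mul_cancel₀ hbase)
  have hvan : ∀ c, (∀ e ∈ (coordFun κ I c).support,
      ¬ σ ⊆ normalCone (hull κ I) (expPoint e)) →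
      MvPolynomial.aeval ![a, b] (coordFun κ I c) = 0 := by
    intro c hc
    rw [hab]
    have : P c = 0 := by
      by_contra hne
      obtain ⟨e, he, h⟩ := (hpat c).1 hne
      exact hc e he h
    rw [this, mul_zero]
  refine ⟨a, b, hI.moved_eq_of_aeval_eq hP hab, fun hX => ?_, fun hY => ?_⟩
  · obtain ⟨e, ⟨c, hc⟩, h1, h0⟩ := hI.exists_axis_zero hS
    have hz := hvan c fun e' he' hsub => by
      rw [negXAxis_eq_quadrantFace] at hX
      have := ((quadrantFace_subset_normalCone_iff hI hS).1 (hX.trans hsub)).1 trivial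
      rw [eq_of_mem_support κ he' hc] at this
      omega
    by_contra ha
    exact (aeval_coordFun_ne_zero_iff a b c).2 ⟨e, hc, fun h => absurd h ha, fun _ => h1⟩ hz
  · obtain ⟨e, ⟨c, hc⟩, h0, h1⟩ := hI.exists_axis_one hS
    have hz := hvan c fun e' he' hsub => by
      rw [negYAxis_eq_quadrantFace] at hY
      have := ((quadrantFace_subset_normalCone_iff hI hS).1 (hY.trans hsub)).2 trivial
      rw [eq_of_mem_support κ he' hc] at this
      omega
    by_contra hb
    exact (aeval_coordFun_ne_zero_iff a b c).2 ⟨e, hc, fun _ => h0, fun h => absurd h hb⟩ hz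

end Chart

/-! ### The orbit of I under automorphisms fixing (x, y²). -/

section Orbit

variable {K : Type*} [Field K] {I : Ideal (PS K)} {κ : Kind}

theorem moved_gSubst_gSubst (J : Ideal (PS K)) (a b c d : K) :
    moved (gSubst c d) (moved (gSubst a b) J) = moved (gSubst (a + c) (b + d)) J := by
  rw [moved_subst (constantCoeff_gSubst _ _) (constantCoeff_gSubst _ _), subst_gSubst_gSubst]

theorem moved_hSubst_hSubst (J : Ideal (PS K)) (b d : K) :
    moved (hSubst 0 d) (moved (hSubst 0 b) J) = moved (hSubst 0 (b + d)) J := by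
  rw [moved_subst (constantCoeff_hSubst _ _) (constantCoeff_hSubst _ _),
    subst_hSubst_zero_hSubst_zero]

/-- Two parameters with the same ideal differ by one that fixes I. The h(a, b) do not form a group,
but on I the two factors can be applied in either order, and each can be cancelled in turn. -/
theorem IsStaircase.injective_moved (hI : IsStaircase I) (hS : κ.HasStab K (expSet I)) :
    Function.Injective fun q : K × K => moved (κ.rep q.1 q.2) I := by
  rintro ⟨a, b⟩ ⟨a', b'⟩ h
  suffices hmoved : moved (κ.rep (a - a') (b - b')) I = I by
    obtain ⟨h1, h2⟩ := hI.eq_zero_of_moved_eq hS hmoved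
    rw [sub_eq_zero] at h1 h2
    rw [h1, h2]
  cases κ with
  | m41 =>
    change moved (gSubst a b) I = moved (gSubst a' b') I at h
    change moved (gSubst (a - a') (b - b')) I = I
    have h1 := congrArg (moved (gSubst (-a') (-b'))) h
    simp only [moved_gSubst_gSubst, add_neg_cancel, gSubst_zero, moved_X] at h1
    simpa only [sub_eq_add_neg] using h1
  | m32 =>
    change moved (hSubst a b) I = moved (hSubst a' b') I at h
    change moved (hSubst (a - a') (b - b')) I = I
    rw [moved_hSubst_eq hI hS a b, moved_hSubst_eq hI hS a' b', hSubst_zero_right a,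
      hSubst_zero_right a'] at h
    have h1 := congrArg (moved (gSubst (-a') 0)) h
    simp only [moved_gSubst_gSubst, add_neg_cancel, gSubst_zero, moved_X, add_zero] at h1
    rw [← sub_eq_add_neg, ← hSubst_zero_right, ← moved_hSubst_eq hI hS,
      moved_hSubst_eq' hI hS] at h1
    have h2 := congrArg (moved (hSubst 0 (-b'))) h1
    simp only [moved_hSubst_hSubst, add_neg_cancel, hSubst_zero, moved_X] at h2
    rwa [← sub_eq_add_neg, ← moved_hSubst_eq' hI hS] at h2

theorem map_trans (φ ψ : PS K ≃ₐ[K] PS K) (J : Ideal (PS K)) :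
    J.map (φ.trans ψ) = (J.map φ).map ψ :=
  (Ideal.map_mapₐ (φ : PS K →ₐ[K] PS K) (ψ : PS K →ₐ[K] PS K)).symm

theorem Fixes.trans {φ ψ : PS K ≃ₐ[K] PS K} {J : Ideal (PS K)} (h : Fixes φ J) (h' : Fixes ψ J) :
    Fixes (φ.trans ψ) J := by
  rw [Fixes, map_trans, h, h']

theorem exists_equiv_gSubst (a b : K) : ∃ E : PS K ≃ₐ[K] PS K, Fixes E (powIdeal K 1 2) ∧
    (∀ J, moved (gSubst a b) J = J.map E) ∧ E (X 0) = X 0 + C a * X 1 ^ 2 + C b * X 1 ^ 3 ∧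
    E (X 1) = X 1 := by
  have hval : ∀ a b : K, equivX (Polynomial.C a * Polynomial.X + Polynomial.C b * Polynomial.X ^ 2)
      (X 0) = X 0 + C a * X 1 ^ 2 + C b * X 1 ^ 3 := by
    intro a b
    rw [equivX_X_zero]
    simp only [map_add, map_mul, Polynomial.aeval_C, map_pow, Polynomial.aeval_X,
      MvPowerSeries.algebraMap_apply, Algebra.algebraMap_self, RingHom.id_apply]
    ring
  have hle : ∀ a b : K, (powIdeal K 1 2).map
      (equivX (Polynomial.C a * Polynomial.X + Polynomial.C b * Polynomial.X ^ 2)) ≤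
      powIdeal K 1 2 := by
    intro a b
    refine map_powIdeal_le ?_ ?_
    · rw [hval, mem_powIdeal_iff]
      exact ⟨1, C a + C b * X 1, by ring⟩
    · rw [equivX_X_one, mem_powIdeal_iff]
      exact ⟨0, 1, by ring⟩
  refine ⟨_, fixes_of_le (hle a b) ?_, fun J => moved_eq_map (fun F => ?_) J, hval a b,
    equivX_X_one _⟩
  · have := hle (-a) (-b)
    rw [equivX_symm]
    convert this using 3
    simp only [map_neg]
    ring
  · rw [equivX_apply]
    congr 1
    funext i
    fin_cases i
    · exact (equivX_X_zero _).symm.trans (hval a b)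
    · rfl

/-- The composite h(a, 0) ∘ h(0, b) of two shears has an explicit inverse and moves I to the same
ideal as h(a, b), so it serves in its place. -/
theorem IsStaircase.exists_equiv_hSubst (hI : IsStaircase I) (hS : Kind.m32.HasStab K (expSet I))
    (a b : K) : ∃ E : PS K ≃ₐ[K] PS K, Fixes E (powIdeal K 1 2) ∧
    moved (hSubst a b) I = I.map E ∧ E (X 0) = X 0 + C a * X 1 ^ 2 ∧
    E (X 1) = X 1 + C b * (X 0 + C a * X 1 ^ 2) := by
  obtain ⟨E, hE, hmoved, h0, h1⟩ := exists_equiv_gSubst a 0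
  rw [map_zero, zero_mul, add_zero] at h0
  have hY := (fixes_equivY 2 1 le_rfl b).1
  have hYval : equivY (Polynomial.C b * Polynomial.X ^ (1 - 1)) (X 1) = X 1 + X 0 * C b := by
    rw [equivY_X_one]
    simp [MvPowerSeries.algebraMap_apply]
  refine ⟨(equivY (Polynomial.C b * Polynomial.X ^ (1 - 1))).trans E, hY.trans hE, ?_, ?_, ?_⟩
  · rw [moved_hSubst_eq hI hS, hSubst_zero_right, hmoved, map_trans]
    congr 1
    refine moved_eq_map (fun F => ?_) I
    rw [equivY_apply]
    congr 1
    funext i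
    fin_cases i
    · simp [shearY, hSubst]
    · refine (equivY_X_one _).symm.trans (hYval.trans ?_)
      simp [hSubst, mul_comm]
  · rw [AlgEquiv.trans_apply, equivY_X_zero, h0]
  · have hC : E (C b) = C b := by
      have := E.commutes b
      rwa [MvPowerSeries.algebraMap_apply] at this
    rw [AlgEquiv.trans_apply, hYval, map_add, map_mul, h0, h1, hC]
    ring

theorem Kind.rep_mem_orbitF (κ : Kind) (hI : IsStaircase I) (hS : κ.HasStab K (expSet I))
    (a b : K) : moved (κ.rep a b) I ∈ orbitF I := by
  cases κ with
  | m41 =>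
    obtain ⟨E, hE, hmoved, -⟩ := exists_equiv_gSubst a b
    exact ⟨E, hE, hmoved I⟩
  | m32 =>
    obtain ⟨E, hE, hmoved, -⟩ := hI.exists_equiv_hSubst hS a b
    exact ⟨E, hE, hmoved⟩

/-- Two automorphisms that agree modulo stable substitutions move `I` to the same ideal. -/
theorem IsStaircase.map_eq_map (hI : IsStaircase I) {r s : ℕ} (hX : StabX K (expSet I) r)
    (hY : StabY K (expSet I) s) (hrs : 2 ≤ r * s) {φ E : PS K ≃ₐ[K] PS K}
    (h0 : ∃ P Q, φ (X 0) = E (X 0) * P + E (X 1) ^ r * Q)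
    (h1 : ∃ P Q, φ (X 1) = E (X 0) ^ s * P + E (X 1) * Q) : I.map φ = I.map E := by
  have key : I.map (φ.trans E.symm) = I := by
    refine hI.map_eq_of_stab hX hY hrs _ ?_ ?_
    · obtain ⟨P, Q, h⟩ := h0
      rw [mem_powIdeal_iff]
      refine ⟨E.symm P, E.symm Q, ?_⟩
      rw [AlgEquiv.trans_apply, h]
      simp
    · obtain ⟨P, Q, h⟩ := h1
      rw [mem_powIdeal_iff]
      refine ⟨E.symm P, E.symm Q, ?_⟩
      rw [AlgEquiv.trans_apply, h]
      simp
  have h2 : (φ.trans E.symm).trans E = φ := by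
    ext1 F
    simp
  rw [← h2, map_trans, key]

theorem constantCoeff_map_eq_zero (φ : PS K ≃ₐ[K] PS K) {F : PS K} (h : constantCoeff F = 0) :
    constantCoeff (φ F) = 0 := by
  by_contra hne
  have h1 : IsUnit (φ F) := by
    rw [MvPowerSeries.isUnit_iff_constantCoeff]
    exact isUnit_iff_ne_zero.2 hne
  rw [isUnit_map_iff, MvPowerSeries.isUnit_iff_constantCoeff, h] at h1
  exact not_isUnit_zero h1

/-- The linear parts of an automorphism fixing `(x, y ^ 2)`. -/
theorem Fixes.exists_linear {φ : PS K ≃ₐ[K] PS K} (h : Fixes φ (powIdeal K 1 2)) :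
    ∃ F G U V : PS K, φ (X 0) = X 0 * F + X 1 ^ 2 * G ∧ φ (X 1) = X 0 * U + X 1 * V ∧
      constantCoeff F ≠ 0 ∧ constantCoeff V ≠ 0 := by
  classical
  have hmem0 : φ (X 0) ∈ powIdeal K 1 2 := by
    have : (X 0 : PS K) ∈ powIdeal K 1 2 := mem_powIdeal_iff.2 ⟨1, 0, by ring⟩
    have := Ideal.mem_map_of_mem φ this
    rwa [h] at this
  obtain ⟨F, G, h0⟩ := mem_powIdeal_iff.1 hmem0
  rw [pow_one] at h0
  obtain ⟨U, V, h1, -⟩ := exists_eq_C_add (φ (X 1))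
  rw [constantCoeff_map_eq_zero φ (by simp), map_zero, zero_add] at h1
  refine ⟨F, G, U, V, h0, h1, fun hF => ?_, fun hV => ?_⟩
  -- If F had no constant term, φ would map (x, y²) into (x, y)²; but the image is (x, y²), which
  -- contains x.
  · have hx : (X 0 : PS K) ∈ originIdeal K ^ 2 := by
      have h2 : (X 0 : PS K) ∈ (powIdeal K 1 2).map φ := by
        rw [h]
        exact mem_powIdeal_iff.2 ⟨1, 0, by ring⟩
      have hy : φ (X 1) ∈ originIdeal K :=
        mem_originIdeal_iff.2 (constantCoeff_map_eq_zero φ (by simp))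
      refine map_powIdeal_le ?_ (Ideal.pow_mem_pow hy 2) h2
      rw [pow_one, h0, sq]
      refine add_mem (Ideal.mul_mem_mul X_zero_mem_originIdeal (mem_originIdeal_iff.2 hF)) ?_
      rw [sq]
      exact Ideal.mul_mem_right _ _
        (Ideal.mul_mem_mul X_one_mem_originIdeal X_one_mem_originIdeal)
    have := mem_originIdeal_pow_iff.1 hx (Finsupp.single 0 1) (by simp [Finsupp.degree_single])
    simp [X] at this
  · obtain ⟨P, Q, h2, -⟩ := exists_eq_C_add (φ.symm (X 1))
    rw [constantCoeff_map_eq_zero φ.symm (by simp), map_zero, zero_add] at h2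
    have h3 := congrArg φ h2
    rw [φ.apply_symm_apply, map_add, map_mul, map_mul, h0, h1] at h3
    -- Writing y as the image of its preimage x P + y Q and reducing modulo x leaves y times a
    -- series divisible by x. If V had no constant term, that product would have linear coefficient
    -- 1 at y.
    have hdvd : (X 0 : PS K) ∣ X 1 * (1 - (X 1 * G * φ P + V * φ Q)) :=
      ⟨F * φ P + U * φ Q, by linear_combination h3⟩
    have h4 := MvPowerSeries.X_dvd_iff.1 hdvd (Finsupp.single 1 1) (by simp)
    rw [show (Finsupp.single 1 1 : Fin 2 →₀ ℕ) = Finsupp.single 1 1 + 0 from (add_zero _).symm, X,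
      coeff_add_monomial_mul] at h4
    have h5 : constantCoeff (monomial (Finsupp.single (1 : Fin 2) 1) (1 : K)) = 0 :=
      constantCoeff_X 1
    simp [hV, h5] at h4

/-- Stable substitutions absorb everything except φ(x) up to multiples of E(x) and of y⁴. The
equations a f₀ = g₀ and b f₀ = g₁ - a f₁ match the coefficients of y² and y³ after dividing by the
unit F. -/
theorem IsStaircase.orbitF_subset_m41 (hI : IsStaircase I) (hS : Kind.m41.HasStab K (expSet I))
    {φ : PS K ≃ₐ[K] PS K} (h : Fixes φ (powIdeal K 1 2)) :
    ∃ a b, I.map φ = moved (gSubst a b) I := by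
  obtain ⟨F, G, U, V, h0, h1, hF, -⟩ := h.exists_linear
  obtain ⟨F₁, F', eF, -⟩ := exists_eq_C_add F
  obtain ⟨F₁', F₂, eF', -⟩ := exists_eq_C_add F'
  obtain ⟨G₁, G', eG, -⟩ := exists_eq_C_add G
  obtain ⟨G₁', G₂, eG', -⟩ := exists_eq_C_add G'
  set f₀ := constantCoeff F
  set f₁ := constantCoeff F'
  set g₀ := constantCoeff G
  set g₁ := constantCoeff G'
  obtain ⟨a, ha⟩ : ∃ a, a * f₀ = g₀ := ⟨g₀ / f₀, div_mul_cancel₀ _ hF⟩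
  obtain ⟨b, hb⟩ : ∃ b, b * f₀ = g₁ - a * f₁ := ⟨(g₁ - a * f₁) / f₀, div_mul_cancel₀ _ hF⟩
  have ha' : (C a * C f₀ : PS K) = C g₀ := by rw [← map_mul, ha]
  have hb' : (C b * C f₀ : PS K) = C g₁ - C a * C f₁ := by rw [← map_mul, hb, map_sub, map_mul]
  obtain ⟨E, -, hmoved, hE0, hE1⟩ := exists_equiv_gSubst a b
  refine ⟨a, b, ?_⟩
  rw [hmoved]
  refine hI.map_eq_map hS.1 hS.2.1 (by norm_num) ?_ ?_
  · set H := G₁ + X 1 * G₁' - (C a + C b * X 1) * (F₁ + X 1 * F₁') with hH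
    refine ⟨F + X 1 ^ 2 * H, G₂ - (C a + C b * X 1) * F₂ - C b * C f₁ - (C a + C b * X 1) * H, ?_⟩
    rw [h0, hE0, hE1]
    have e1 : G - (C a + C b * X 1) * F =
        X 0 * H + X 1 ^ 2 * (G₂ - (C a + C b * X 1) * F₂ - C b * C f₁) := by
      rw [eG, eG', eF, eF', hH]
      linear_combination -ha' - X 1 * hb'
    linear_combination X 1 ^ 2 * e1
  · refine ⟨U, V - (C a * X 1 + C b * X 1 ^ 2) * U, ?_⟩
    rw [h1, hE0, hE1]
    ring

theorem IsStaircase.orbitF_subset_m32 (hI : IsStaircase I) (hS : Kind.m32.HasStab K (expSet I))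
    {φ : PS K ≃ₐ[K] PS K} (h : Fixes φ (powIdeal K 1 2)) :
    ∃ a b, I.map φ = moved (hSubst a b) I := by
  obtain ⟨F, G, U, V, h0, h1, hF, hV⟩ := h.exists_linear
  obtain ⟨F₁, F₂, eF, -⟩ := exists_eq_C_add F
  obtain ⟨G₁, G₂, eG, -⟩ := exists_eq_C_add G
  obtain ⟨U₁, U₂, eU, -⟩ := exists_eq_C_add U
  obtain ⟨V₁, V₂, eV, -⟩ := exists_eq_C_add V
  set f₀ := constantCoeff F
  set g₀ := constantCoeff G
  set u₀ := constantCoeff U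
  set v₀ := constantCoeff V
  obtain ⟨a, ha⟩ : ∃ a, a * f₀ = g₀ := ⟨g₀ / f₀, div_mul_cancel₀ _ hF⟩
  obtain ⟨b, hb⟩ : ∃ b, b * v₀ = u₀ := ⟨u₀ / v₀, div_mul_cancel₀ _ hV⟩
  have ha' : (C a * C f₀ : PS K) = C g₀ := by rw [← map_mul, ha]
  have hb' : (C b * C v₀ : PS K) = C u₀ := by rw [← map_mul, hb]
  obtain ⟨E, -, hmoved, hE0, hE1⟩ := hI.exists_equiv_hSubst hS a b
  refine ⟨a, b, ?_⟩
  rw [hmoved]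
  have e1 : G - C a * F = X 0 * (G₁ - C a * F₁) + X 1 * (G₂ - C a * F₂) := by
    rw [eG, eF]
    linear_combination -ha'
  have e2 : U - C b * V = X 0 * (U₁ - C b * V₁) + X 1 * (U₂ - C b * V₂) := by
    rw [eU, eV]
    linear_combination -hb'
  set H := G₁ - C a * F₁
  set N := G₂ - C a * F₂
  set P := U₁ - C b * V₁
  set Q := U₂ - C b * V₂
  -- w and v are E(x) and E(y). Expressing x and y by them reduces both conditions to identities
  -- modulo (w, v³) and (w², v).
  obtain ⟨w, hw⟩ : ∃ w : PS K, w = X 0 + C a * X 1 ^ 2 := ⟨_, rfl⟩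
  obtain ⟨v, hv⟩ : ∃ v : PS K, v = X 1 + C b * w := ⟨_, rfl⟩
  have hx : (X 0 : PS K) = w - C a * X 1 ^ 2 := by rw [hw]; ring
  have hy : (X 1 : PS K) = v - C b * w := by rw [hv]; ring
  rw [← hw] at hE0 hE1
  rw [← hv] at hE1
  refine hI.map_eq_map hS.1 hS.2.1 (by norm_num) ?_ ?_
  · refine ⟨F + X 1 ^ 2 * H + (-3 * C b * v ^ 2 + 3 * C b ^ 2 * v * w - C b ^ 3 * w ^ 2) *
      (N - C a * X 1 * H), N - C a * X 1 * H, ?_⟩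
    rw [h0, hE0, hE1]
    have e3 : (X 1 : PS K) ^ 3 = v ^ 3 + w * (-3 * C b * v ^ 2 + 3 * C b ^ 2 * v * w -
        C b ^ 3 * w ^ 2) := by
      rw [hy]
      ring
    linear_combination X 1 ^ 2 * e1 + (F + X 1 ^ 2 * H) * hx + (N - C a * X 1 * H) * e3
  · refine ⟨P - C b * Q - C a * C b ^ 2 * (w * P + U),
      w * Q + V - C a * (w * P + U) * (v - 2 * C b * w), ?_⟩
    rw [h1, hE0, hE1]
    have e3 : (X 1 : PS K) ^ 2 = v * (v - 2 * C b * w) + C b ^ 2 * w ^ 2 := by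
      rw [hy]
      ring
    linear_combination w * e2 + (U + w * P) * hx + (V + w * Q) * hy - (C a * (w * P + U)) * e3

theorem IsStaircase.range_moved_eq_orbitF (hI : IsStaircase I) (hS : κ.HasStab K (expSet I)) :
    (Set.range fun q : K × K => moved (κ.rep q.1 q.2) I) = orbitF I := by
  refine subset_antisymm ?_ ?_
  · rintro _ ⟨q, rfl⟩
    exact κ.rep_mem_orbitF hI hS q.1 q.2
  · rintro _ ⟨φ, hφ, rfl⟩
    cases κ with
    | m41 =>
      obtain ⟨a, b, h⟩ := hI.orbitF_subset_m41 hS hφ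
      exact ⟨(a, b), h.symm⟩
    | m32 =>
      obtain ⟨a, b, h⟩ := hI.orbitF_subset_m32 hS hφ
      exact ⟨(a, b), h.symm⟩

end Orbit

/-! ### Invariance of the fan under field extension. -/

section Extension

variable {K L : Type*} [Field K] [Field L] [Algebra K L] {I : Ideal (PS K)} {κ : Kind}

theorem coordFun_extend {ρ : Row I ≃ Row (extend L I)} (hρ : ∀ i, (ρ i).1.1 = i.1.1)
    {c : Coord I} {c' : Coord (extend L I)} (hc : ∀ i, (c' (ρ i)).1 = (c i).1) :
    coordFun κ (extend L I) c' = MvPolynomial.map (algebraMap K L) (coordFun κ I c) := by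
  rw [coordFun, coordFun, minor, minor, RingHom.map_det, ← Matrix.det_submatrix_equiv_self ρ]
  congr 1
  ext1 i j
  have hmap : ∀ s : Fin 2, MvPowerSeries.map (MvPolynomial.map (algebraMap K L))
      (κ.rep (MvPolynomial.X 0 : MvPolynomial (Fin 2) K) (MvPolynomial.X 1) s) =
      κ.rep (MvPolynomial.X 0 : MvPolynomial (Fin 2) L) (MvPolynomial.X 1) s := by
    intro s
    rw [κ.map_rep, MvPolynomial.map_X, MvPolynomial.map_X]
  simp only [Matrix.submatrix_apply, Matrix.of_apply, RingHom.mapMatrix_apply, Matrix.map_apply]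
  rw [hρ, hc, subst_monomial_one (κ.constantCoeff_rep _ _),
    subst_monomial_one (κ.constantCoeff_rep _ _), ← coeff_map]
  simp only [powProd, map_mul, map_pow, hmap]

/-- Colength and set of exponents do not change, so rows and columns correspond and the coordinate
functions are images under the injection K → L, which preserves supports. -/
theorem exponents_extend (hI : IsStaircase I) : exponents κ (extend L I) = exponents κ I := by
  have hcol : colength (extend L I) = colength I := colength_extend hI
  have hexp : expSet (extend L I) = expSet I := expSet_extend hI
  let lam : LowExp (colength I) ≃ LowExp (colength (extend L I)) :=
    Equiv.subtypeEquivRight fun e => by rw [hcol]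
  have hlam : ∀ j, (lam j).1 = j.1 := fun j => rfl
  let ρ : Row I ≃ Row (extend L I) := lam.subtypeEquiv fun j => by
    rw [hlam]
    exact (Set.ext_iff.1 hexp j.1).symm
  have hρ : ∀ i, (ρ i).1.1 = i.1.1 := fun i => rfl
  have hinj : Function.Injective (algebraMap K L) := (algebraMap K L).injective
  ext e
  constructor
  · rintro ⟨c, hc⟩
    refine ⟨fun i => lam.symm (c (ρ i)), ?_⟩
    rw [coordFun_extend hρ (c := fun i => lam.symm (c (ρ i))) (fun i => ?_),
      MvPolynomial.support_map_of_injective _ hinj] at hc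
    · exact hc
    · rw [← hlam, Equiv.apply_symm_apply]
  · rintro ⟨c, hc⟩
    refine ⟨fun i => lam (c (ρ.symm i)), ?_⟩
    rw [coordFun_extend hρ (c := c) (fun i => ?_), MvPolynomial.support_map_of_injective _ hinj]
    · exact hc
    · rw [Equiv.symm_apply_apply, hlam]

theorem standardFan_extend (hI : IsStaircase I) :
    standardFan κ (extend L I) = standardFan κ I := by
  have : hull κ (extend L I) = hull κ I :=
    congrArg (fun E => convexHull ℝ (expPoint '' E)) (exponents_extend hI)
  rw [standardFan, this, standardFan]

end Extension

/-! ### The orbit as the chart of the quadrant, and its coordinate lines. -/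

section ChartUnion

variable {K : Type*} [Field K] [IsAlgClosed K] {I : Ideal (PS K)} {κ : Kind}

theorem IsStaircase.chart_eq (hI : IsStaircase I) (hS : κ.HasStab K (expSet I)) :
    {J | ∃ σ ∈ standardFan κ I, σ ⊆ quadrant ∧ J ∈ torusOrbit κ I σ} = orbitF I ∧
    {J | ∃ σ ∈ standardFan κ I, negXAxis ⊆ σ ∧ σ ⊆ quadrant ∧ J ∈ torusOrbit κ I σ} =
      (Set.range fun b : K => moved (κ.rep 0 b) I) ∧
    {J | ∃ σ ∈ standardFan κ I, negYAxis ⊆ σ ∧ σ ⊆ quadrant ∧ J ∈ torusOrbit κ I σ} =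
      (Set.range fun a : K => moved (κ.rep a 0) I) := by
  refine ⟨?_, ?_, ?_⟩
  · rw [← hI.range_moved_eq_orbitF hS]
    ext J
    constructor
    · rintro ⟨σ, -, hσ, hJ⟩
      obtain ⟨a, b, rfl, -⟩ := exists_moved_eq_of_mem_torusOrbit hI hS hσ hJ
      exact ⟨(a, b), rfl⟩
    · rintro ⟨⟨a, b⟩, rfl⟩
      exact ⟨_, quadrantFace_mem_standardFan hI hS _ _, quadrantFace_subset _ _,
        moved_mem_torusOrbit hI hS a b⟩
  · ext J
    constructor
    · rintro ⟨σ, -, hX, hσ, hJ⟩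
      obtain ⟨a, b, rfl, ha, -⟩ := exists_moved_eq_of_mem_torusOrbit hI hS hσ hJ
      exact ⟨b, by rw [ha hX]⟩
    · rintro ⟨b, rfl⟩
      exact ⟨_, quadrantFace_mem_standardFan hI hS _ _, negXAxis_subset_quadrantFace rfl,
        quadrantFace_subset _ _, moved_mem_torusOrbit hI hS 0 b⟩
  · ext J
    constructor
    · rintro ⟨σ, -, hY, hσ, hJ⟩
      obtain ⟨a, b, rfl, -, hb⟩ := exists_moved_eq_of_mem_torusOrbit hI hS hσ hJ
      exact ⟨a, by rw [hb hY]⟩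
    · rintro ⟨a, rfl⟩
      exact ⟨_, quadrantFace_mem_standardFan hI hS _ _, negYAxis_subset_quadrantFace rfl,
        quadrantFace_subset _ _, moved_mem_torusOrbit hI hS a 0⟩

end ChartUnion

end ToricHilb

theorem proposition3p1 {K : Type*} [Field K] (I : Ideal (ToricHilb.PS K))
    (hmon : ToricHilb.IsMonomialIdeal I) (hfin : Module.Finite K (ToricHilb.PS K ⧸ I)) :
    -- the lower left quadrant of the standard fan
    (∀ κ : ToricHilb.Kind, κ.HasKind I →
      ToricHilb.quadrant ∈ ToricHilb.standardFan κ I ∧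
      ToricHilb.negXAxis ∈ ToricHilb.standardFan κ I ∧
      ToricHilb.negYAxis ∈ ToricHilb.standardFan κ I ∧
      -- the correspondence between cones and ideals, over algebraically closed fields
      ∀ (L : Type*) [Field L] [Algebra K L] [IsAlgClosed L],
        -- the affine plane `F(I)` with its coordinates `a`, `b`
        (Function.Injective fun q : L × L =>
          ToricHilb.moved (κ.rep q.1 q.2) (ToricHilb.extend L I)) ∧
        (Set.range fun q : L × L =>
          ToricHilb.moved (κ.rep q.1 q.2) (ToricHilb.extend L I)) =
            ToricHilb.orbitF (ToricHilb.extend L I) ∧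
        -- is the chart of the quadrant
        {J | ∃ σ ∈ ToricHilb.standardFan κ I, σ ⊆ ToricHilb.quadrant ∧
            J ∈ ToricHilb.torusOrbit κ (ToricHilb.extend L I) σ} =
          ToricHilb.orbitF (ToricHilb.extend L I) ∧
        -- in which the negative axes correspond to the lines `a = 0` and `b = 0`
        {J | ∃ σ ∈ ToricHilb.standardFan κ I, ToricHilb.negXAxis ⊆ σ ∧
            σ ⊆ ToricHilb.quadrant ∧ J ∈ ToricHilb.torusOrbit κ (ToricHilb.extend L I) σ} =
          (Set.range fun b : L => ToricHilb.moved (κ.rep 0 b) (ToricHilb.extend L I)) ∧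
        {J | ∃ σ ∈ ToricHilb.standardFan κ I, ToricHilb.negYAxis ⊆ σ ∧
            σ ⊆ ToricHilb.quadrant ∧ J ∈ ToricHilb.torusOrbit κ (ToricHilb.extend L I) σ} =
          (Set.range fun a : L => ToricHilb.moved (κ.rep a 0) (ToricHilb.extend L I))) ∧
    -- measuring sequence `m(4, 1)`
    (ToricHilb.HasMeasuringSequence I 4 1 →
      ToricHilb.clockwise .m41 I (-1, 0) = {ToricHilb.limG₂ I} ∧
      ToricHilb.counterclockwise .m41 I (0, 1) = {ToricHilb.limG₂ I} ∧
      ToricHilb.counterclockwise .m41 I (0, -1) = {ToricHilb.limG₁ I} ∧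
      (∀ J ∈ ToricHilb.counterclockwise .m41 I (0, 1),
        ToricHilb.clockwise .m41 I (0, 1) = {ToricHilb.limG₁ J}) ∧
      (ringChar K ≠ 2 →
        ToricHilb.counterclockwise .m41 I (0, -1) = ToricHilb.clockwise .m41 I (1, 2) ∧
        ∀ J ∈ ToricHilb.clockwise .m41 I (1, 2),
          ToricHilb.counterclockwise .m41 I (1, 2) = {ToricHilb.limH₂ J})) ∧
    -- measuring sequence `m(3, 2)`
    (ToricHilb.HasMeasuringSequence I 3 2 →
      ToricHilb.clockwise .m32 I (-1, 0) = {ToricHilb.limH₂ I} ∧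
      ToricHilb.counterclockwise .m32 I (0, 1) = {ToricHilb.limH₂ I} ∧
      ToricHilb.counterclockwise .m32 I (0, -1) = {ToricHilb.limH₁ I} ∧
      ToricHilb.clockwise .m32 I (1, 0) = {ToricHilb.limH₁ I} ∧
      (∀ J ∈ ToricHilb.counterclockwise .m32 I (0, 1),
        ToricHilb.clockwise .m32 I (0, 1) = {ToricHilb.limH₁ J}) ∧
      (∀ J ∈ ToricHilb.clockwise .m32 I (1, 0),
        ToricHilb.counterclockwise .m32 I (1, 0) = {ToricHilb.limH₂ J})) := by
  have hI := ToricHilb.isStaircase_of_isMonomialIdeal hmon hfin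
  refine ⟨fun κ hκ => ?_, fun h => ?_, fun h => ?_⟩
  · have hS := hκ.hasStab hI
    refine ⟨?_, ?_, ?_, fun L _ _ _ => ?_⟩
    · rw [ToricHilb.quadrant_eq_quadrantFace]
      exact ToricHilb.quadrantFace_mem_standardFan hI hS _ _
    · rw [ToricHilb.negXAxis_eq_quadrantFace]
      exact ToricHilb.quadrantFace_mem_standardFan hI hS _ _
    · rw [ToricHilb.negYAxis_eq_quadrantFace]
      exact ToricHilb.quadrantFace_mem_standardFan hI hS _ _
    · have hI' : ToricHilb.IsStaircase (ToricHilb.extend L I) := hI.extend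
      have hS' := hS.extend (L := L) hI
      -- The cones are those of the fan of I over K. Replacing it by the equal fan over L reduces
      -- everything to a monomial ideal over an algebraically closed field.
      rw [← ToricHilb.standardFan_extend (L := L) hI]
      exact ⟨hI'.injective_moved hS', hI'.range_moved_eq_orbitF hS', hI'.chart_eq hS'⟩
  · exact hI.limits_m41 (ToricHilb.Kind.HasKind.hasStab (κ := .m41) hI h)
  · exact hI.limits_m32 (ToricHilb.Kind.HasKind.hasStab (κ := .m32) hI h)
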